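/- For a locally compact (Hausdorff) group $G$ with left Haar measure $\mu$, let $\lambda$ be the left regular representation of $G$ on $L^2(G,\mu)$, $(\lambda(x)f)(y)=f(x^{-1}y)$, and let $\mathfrak M(G)\subseteq B(L^2(G,\mu))$ be the von Neumann algebra generated by $\lambda(G)$. The Fourier algebra $A(G)$ is the predual of $\mathfrak M(G)$, realized as an algebra of functions on $G$: it consists of the functions $u(x)=\omega(\lambda(x))$, $x\in G$, with $\omega$ a normal linear functional on $\mathfrak M(G)$, and $\|u\|_{A(G)}=\|\omega\|$. A continuous function $\varphi$ on $G$ is a multiplier of $A(G)$ if $\varphi\psi\in A(G)$ for all $\psi\in A(G)$; its completely bounded multiplier norm $\|\varphi\|_{M_0A(G)}$ is the completely bounded norm (possibly $\infty$) of the transpose $m_\varphi^*\colon\mathfrak M(G)\to\mathfrak M(G)$ of the operator $m_\varphi\colon\psi\mapsto\varphi\psi$ on $A(G)$. An approximate unit for $A(G)$ is a net $(\varphi_\alpha)$ in $A(G)$ with $\lim_\alpha\|\varphi_\alpha\psi-\psi\|_{A(G)}=0$ for all $\psi\in A(G)$. **Theorem.** Let $\Gamma$ be a lattice in a second countable locally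 compact group $G$, i.e. a closed discrete subgroup such that $G/\Gamma$ carries a non-zero bounded $G$-invariant measure, and let $k\in[1,\infty)$. Then the following conditions are equivalent. 1. $A(G)$ has an approximate unit $(\varphi_\alpha)$ such that $\|\varphi_\alpha\|_{M_0A(G)}\le k$ for all $\alpha$. 2. $A(\Gamma)$ has an approximate unit $(\psi_\alpha)$ such that $\|\psi_\alpha\|_{M_0A(\Gamma)}\le k$ for all $\alpha$, where $\Gamma$ is regarded as a discrete group with counting measure. -/

import Mathlib

open MeasureTheory Filter Topology
open scoped ENNReal

universe u

noncomputable section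

section FourierAlgebra

variable {G : Type u} [Group G] [MeasurableSpace G] [MeasurableMul G]

/-- The left regular representation on `L²(G, μ)`: `(λ(x) f)(y) = f(x⁻¹ y)`. -/
def leftRegular (μ : Measure G) [μ.IsMulLeftInvariant] (x : G) :
    Lp ℂ 2 μ →L[ℂ] Lp ℂ 2 μ :=
  (Lp.compMeasurePreservingₗᵢ ℂ (fun y => x⁻¹ * y)
    (measurePreserving_mul_left μ x⁻¹)).toContinuousLinearMap

/-- The group von Neumann algebra `M(G)`: the von Neumann algebra on `L²(G, μ)` generated by the
left regular representation, i.e. the double commutant of `{λ(x)} ∪ {λ(x)*}`. -/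
def groupVN (μ : Measure G) [μ.IsMulLeftInvariant] : VonNeumannAlgebra (Lp ℂ 2 μ) where
  toStarSubalgebra := StarSubalgebra.centralizer ℂ
    (StarSubalgebra.centralizer ℂ (Set.range (leftRegular μ)) :
      Set (Lp ℂ 2 μ →L[ℂ] Lp ℂ 2 μ))
  centralizer_centralizer' := by
    change Set.centralizer (Set.centralizer (Set.centralizer _)) = Set.centralizer _
    exact Set.centralizer_centralizer_centralizer _

/-- The elements of the group von Neumann algebra, with its operator norm. -/
abbrev GroupVN (μ : Measure G) [μ.IsMulLeftInvariant] : Type u :=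
  (groupVN μ).toStarSubalgebra

theorem leftRegular_mem_groupVN (μ : Measure G) [μ.IsMulLeftInvariant] (x : G) :
    leftRegular μ x ∈ (groupVN μ).toStarSubalgebra := by
  change leftRegular μ x ∈ StarSubalgebra.centralizer ℂ
    (StarSubalgebra.centralizer ℂ (Set.range (leftRegular μ)) :
      Set (Lp ℂ 2 μ →L[ℂ] Lp ℂ 2 μ))
  rw [← SetLike.mem_coe, StarSubalgebra.coe_centralizer_centralizer]
  exact Set.subset_centralizer_centralizer (Or.inl ⟨x, rfl⟩)

/-- `λ(x)` as an element of `M(G)`. -/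
def leftRegularVN (μ : Measure G) [μ.IsMulLeftInvariant] (x : G) : GroupVN μ :=
  ⟨leftRegular μ x, leftRegular_mem_groupVN μ x⟩

/-- A functional `ω` on `M(G)` is normal (σ-weakly continuous) if
`ω(T) = ∑ₙ ⟨T fₙ, gₙ⟩` with `∑ₙ ‖fₙ‖² < ∞` and `∑ₙ ‖gₙ‖² < ∞`. -/
def IsNormalFunctional {μ : Measure G} [μ.IsMulLeftInvariant] (ω : GroupVN μ →L[ℂ] ℂ) : Prop :=
  ∃ f g : ℕ → Lp ℂ 2 μ, Summable (fun n => ‖f n‖ ^ 2) ∧ Summable (fun n => ‖g n‖ ^ 2) ∧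
    ∀ T : GroupVN μ,
      HasSum (fun n => inner ℂ (g n) ((T : Lp ℂ 2 μ →L[ℂ] Lp ℂ 2 μ) (f n))) (ω T)

/-- The function `u` on `G` corresponds to the element `ω` of the predual of `M(G)`:
`ω` is normal and `u(x) = ω(λ(x))`. -/
def Represents {μ : Measure G} [μ.IsMulLeftInvariant] (ω : GroupVN μ →L[ℂ] ℂ) (u : G → ℂ) :
    Prop :=
  IsNormalFunctional ω ∧ ∀ x, u x = ω (leftRegularVN μ x)

/-- The Fourier algebra `A(G)`: the predual of `M(G)`, realized as functions on `G`. -/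
def fourierAlgebra (μ : Measure G) [μ.IsMulLeftInvariant] : Set (G → ℂ) :=
  {u | ∃ ω : GroupVN μ →L[ℂ] ℂ, Represents ω u}

/-- The norm of `A(G)`, i.e. the norm of the (unique) corresponding functional on `M(G)`;
it is `⊤` for functions outside `A(G)`. -/
def fourierNorm (μ : Measure G) [μ.IsMulLeftInvariant] (u : G → ℂ) : ℝ≥0∞ :=
  ⨅ (ω : GroupVN μ →L[ℂ] ℂ) (_ : Represents ω u), ‖ω‖ₑ

/-- An `n × n` matrix over `M(G)`, as an operator on the Hilbert space sum of `n` copies of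
`L²(G, μ)`. -/
def matrixOperator {μ : Measure G} [μ.IsMulLeftInvariant] {n : ℕ}
    (a : Matrix (Fin n) (Fin n) (GroupVN μ)) :
    PiLp 2 (fun _ : Fin n => Lp ℂ 2 μ) →L[ℂ] PiLp 2 (fun _ : Fin n => Lp ℂ 2 μ) :=
  ((PiLp.continuousLinearEquiv 2 ℂ (fun _ : Fin n => Lp ℂ 2 μ)).symm :
      (Fin n → Lp ℂ 2 μ) →L[ℂ] PiLp 2 (fun _ : Fin n => Lp ℂ 2 μ)) ∘L
    (ContinuousLinearMap.pi fun i => ∑ j,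
      (a i j : Lp ℂ 2 μ →L[ℂ] Lp ℂ 2 μ) ∘L
        ContinuousLinearMap.proj (R := ℂ) (φ := fun _ : Fin n => Lp ℂ 2 μ) j) ∘L
    ((PiLp.continuousLinearEquiv 2 ℂ (fun _ : Fin n => Lp ℂ 2 μ)) :
      PiLp 2 (fun _ : Fin n => Lp ℂ 2 μ) →L[ℂ] (Fin n → Lp ℂ 2 μ))

/-- The completely bounded norm of a linear map `S` on `M(G)`: the supremum over `n` of the norms
of `S ⊗ id` on `n × n` matrices. It is `⊤` if `S` is not completely bounded. -/
def cbNorm {μ : Measure G} [μ.IsMulLeftInvariant] (S : GroupVN μ →ₗ[ℂ] GroupVN μ) : ℝ≥0∞ :=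
  ⨆ (n : ℕ) (a : Matrix (Fin n) (Fin n) (GroupVN μ)) (_ : ‖matrixOperator a‖ ≤ 1),
    ‖matrixOperator (a.map S)‖ₑ

variable [TopologicalSpace G]

/-- `φ` is a multiplier of `A(G)`: it is continuous and `φ ψ ∈ A(G)` for every `ψ ∈ A(G)`. -/
def IsFourierMultiplier (μ : Measure G) [μ.IsMulLeftInvariant] (φ : G → ℂ) : Prop :=
  Continuous φ ∧ ∀ ψ ∈ fourierAlgebra μ, φ * ψ ∈ fourierAlgebra μ

/-- `S` is the transpose `m_φ*` of the operator `m_φ : ψ ↦ φ ψ` on `A(G)`: for `T ∈ M(G)` and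
`ψ ∈ A(G)`, `⟨S T, ψ⟩ = ⟨T, φ ψ⟩`. -/
def IsTransposeMultiplier {μ : Measure G} [μ.IsMulLeftInvariant] (φ : G → ℂ)
    (S : GroupVN μ →ₗ[ℂ] GroupVN μ) : Prop :=
  ∀ (ψ : G → ℂ) (ω ω' : GroupVN μ →L[ℂ] ℂ), Represents ω ψ → Represents ω' (φ * ψ) →
    ∀ T, ω (S T) = ω' T

/-- The completely bounded multiplier norm `‖φ‖_{M₀A(G)} = ‖m_φ*‖_cb`;
it is `⊤` for functions that are not completely bounded multipliers. -/
def cbMultiplierNorm (μ : Measure G) [μ.IsMulLeftInvariant] (φ : G → ℂ) : ℝ≥0∞ :=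
  ⨅ (_ : IsFourierMultiplier μ φ) (S : GroupVN μ →ₗ[ℂ] GroupVN μ)
    (_ : IsTransposeMultiplier φ S), cbNorm S

/-- `A(G)` has an approximate unit `(φ_α)` with `‖φ_α‖_{M₀A(G)} ≤ k` for all `α`: a net in `A(G)`
with `‖φ_α ψ - ψ‖_{A(G)} → 0` for all `ψ ∈ A(G)`. -/
def HasCBApproximateUnit (μ : Measure G) [μ.IsMulLeftInvariant] (k : ℝ) : Prop :=
  ∃ (ι : Type u) (_ : Preorder ι) (_ : IsDirectedOrder ι) (_ : Nonempty ι) (φ : ι → G → ℂ),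
    (∀ α, φ α ∈ fourierAlgebra μ) ∧
    (∀ ψ ∈ fourierAlgebra μ, Tendsto (fun α => fourierNorm μ (φ α * ψ - ψ)) atTop (𝓝 0)) ∧
    ∀ α, cbMultiplierNorm μ (φ α) ≤ ENNReal.ofReal k

end FourierAlgebra

/-- A lattice: a closed discrete subgroup `Γ` such that `G ⧸ Γ` has a non-zero bounded
`G`-invariant measure. -/
structure IsGroupLattice {G : Type u} [Group G] [TopologicalSpace G] [MeasurableSpace G]
    (Γ : Subgroup G) : Prop where
  isClosed : IsClosed (Γ : Set G)
  discrete : DiscreteTopology Γ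
  exists_measure : ∃ ν : Measure (G ⧸ Γ), ν ≠ 0 ∧ IsFiniteMeasure ν ∧
    SMulInvariantMeasure G (G ⧸ Γ) ν

end

/-! Both conditions are equivalent to `HasFiniteHerzSchurApproximation` for `Γ`: the constant 1 is a
pointwise limit of finitely supported `ψ` whose matrices `ψ(i j⁻¹)` are Schur multipliers of norm at
most `k`. Two implications, each proved for a general group, suffice, because `Γ` is also a lattice
in itself with fundamental domain `{1}`.

From approximate units to Schur multipliers on a closed discrete subgroup
(`HasCBApproximateUnit.hasFiniteHerzSchurApproximation`): a completely bounded multiplier is a Schur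
multiplier of no larger norm, because the operator matrix with entries `a i j • λ(i j⁻¹)` is
unitarily equivalent to `a ⊗ 1` (`herzSchurBound_of_cbNorm_le`). Elements of `A(G)` are limits, in
Herz-Schur norm, of compactly supported functions, and these restrict to finitely supported
functions on the subgroup. A small rescaling restores the bound `k`.

From Schur multipliers to approximate units (`IsLatticeDomain.hasCBApproximateUnit`): let `D` be a
fundamental domain and lift `ψ` to `φ(x) = μ(D)⁻¹ ∑ ψ(σ) μ(Dσ ∩ xD)`. For each `p ∈ D` the sets
`Dγp⁻¹` partition `G` and cut `L²(G)` into blocks. Multiplying block `(i, j)` of `T` by `ψ(i j⁻¹)`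
and averaging over `p ∈ D` defines a normal map `S` on `M(G)` with `S(λ(x)) = φ(x) λ(x)`
(`IsLatticeDomain.exists_isLift`). The Schur bound holds blockwise (`HerzSchurBound.block_le`), so
the cb norm of `S` is at most `k` (`IsLatticeDomain.IsLift.cbNorm_le`). When `ψ` tends to 1
pointwise within this bound, `⟨S(T) ξ, η⟩` tends to `⟨T ξ, η⟩` uniformly for `T` in the unit ball
(`IsLatticeDomain.exists_finset_norm_inner_sub_le`), which is norm convergence on `A(G)`.

Two further ingredients: a normal functional is determined by its values on `λ(G)`, by von Neumann's
amplification argument (`inner_diagOp_eq_zero_of_bicommutant`); and `D` has finite measure, with `μ`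
right `Γ`-invariant, by uniqueness of Haar measure (`IsGroupLattice.exists_isLatticeDomain`). -/

noncomputable section

/-! ### Schur multipliers and Herz-Schur bounds. -/

section SchurMultipliers

/-- The matrix `a`, restricted to the finite index set `s`, has operator norm at most `K`. -/
def FormBound {Λ : Type*} (s : Finset Λ) (a : Λ → Λ → ℂ) (K : ℝ) : Prop :=
  ∀ ξ η : Λ → ℂ, ‖∑ i ∈ s, ∑ j ∈ s, a i j * ξ j * η i‖ ≤
    K * (√(∑ j ∈ s, ‖ξ j‖ ^ 2) * √(∑ i ∈ s, ‖η i‖ ^ 2))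

/-- Every finite section of `(φ(i j⁻¹))` is a Schur multiplier of norm at most `K`. -/
def HerzSchurBound {Λ : Type*} [Group Λ] (φ : Λ → ℂ) (K : ℝ) : Prop :=
  ∀ (s : Finset Λ) (a : Λ → Λ → ℂ), FormBound s a 1 →
    FormBound s (fun i j => φ (i * j⁻¹) * a i j) K

/-- Approximation of `1` by finitely supported functions with Herz-Schur norms at most `k`. -/
def HasFiniteHerzSchurApproximation (Λ : Type*) [Group Λ] (k : ℝ) : Prop :=
  ∀ (F : Finset Λ) (ε : ℝ), 0 < ε → ∃ ψ : Λ → ℂ, (Function.support ψ).Finite ∧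
    HerzSchurBound ψ k ∧ ∀ x ∈ F, ‖ψ x - 1‖ < ε

variable {Λ : Type*} {E : Type*} [NormedAddCommGroup E] [InnerProductSpace ℂ E]

/-- Passing from `a` to `a ⊗ 1` does not increase the norm. In coordinates of an orthonormal basis
of the span of the finitely many vectors, the form is a sum of scalar forms, and Cauchy-Schwarz over
the basis index recombines the bounds. -/
theorem FormBound.inner_le {s : Finset Λ} {a : Λ → Λ → ℂ} {K : ℝ} (hK : 0 ≤ K)
    (h : FormBound s a K) (x y : Λ → E) :
    ‖∑ i ∈ s, ∑ j ∈ s, a i j * inner ℂ (y i) (x j)‖ ≤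
      K * (√(∑ j ∈ s, ‖x j‖ ^ 2) * √(∑ i ∈ s, ‖y i‖ ^ 2)) := by
  classical
  let W : Submodule ℂ E := Submodule.span ℂ (((s.image x ∪ s.image y : Finset E)) : Set E)
  have hWfin : FiniteDimensional ℂ W := FiniteDimensional.span_finset ℂ _
  have hx : ∀ j ∈ s, x j ∈ W := fun j hj => Submodule.subset_span (by
    simp only [Finset.coe_union, Finset.coe_image]; exact Or.inl ⟨j, hj, rfl⟩)
  have hy : ∀ j ∈ s, y j ∈ W := fun j hj => Submodule.subset_span (by
    simp only [Finset.coe_union, Finset.coe_image]; exact Or.inr ⟨j, hj, rfl⟩)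
  let b := stdOrthonormalBasis ℂ W
  let x' : Λ → W := fun j => if hj : j ∈ s then ⟨x j, hx j hj⟩ else 0
  let y' : Λ → W := fun j => if hj : j ∈ s then ⟨y j, hy j hj⟩ else 0
  have hx' : ∀ j ∈ s, ((x' j : W) : E) = x j := fun j hj => by simp [x', hj]
  have hy' : ∀ j ∈ s, ((y' j : W) : E) = y j := fun j hj => by simp [y', hj]
  have hin : ∀ i ∈ s, ∀ j ∈ s, inner ℂ (y i) (x j) =
      ∑ m, inner ℂ (b m) (x' j) * inner ℂ (y' i) (b m) := by
    intro i hi j hj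
    rw [← hx' j hj, ← hy' i hi, ← Submodule.coe_inner, ← b.sum_inner_mul_inner]
    exact Finset.sum_congr rfl fun m _ => mul_comm _ _
  have hsum : ∑ i ∈ s, ∑ j ∈ s, a i j * inner ℂ (y i) (x j) =
      ∑ m, ∑ i ∈ s, ∑ j ∈ s, a i j * inner ℂ (b m) (x' j) * inner ℂ (y' i) (b m) := by
    rw [Finset.sum_comm (s := Finset.univ)]
    refine Finset.sum_congr rfl fun i hi => ?_
    rw [Finset.sum_comm (s := Finset.univ)]
    refine Finset.sum_congr rfl fun j hj => ?_
    rw [hin i hi j hj, Finset.mul_sum]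
    exact Finset.sum_congr rfl fun m _ => (mul_assoc _ _ _).symm
  have hnx : ∑ j ∈ s, ‖x j‖ ^ 2 = ∑ m, ∑ j ∈ s, ‖inner ℂ (b m) (x' j)‖ ^ 2 := by
    rw [Finset.sum_comm]
    refine Finset.sum_congr rfl fun j hj => ?_
    rw [← hx' j hj, Submodule.norm_coe, b.sum_sq_norm_inner_right]
  have hny : ∑ j ∈ s, ‖y j‖ ^ 2 = ∑ m, ∑ j ∈ s, ‖inner ℂ (y' j) (b m)‖ ^ 2 := by
    rw [Finset.sum_comm]
    refine Finset.sum_congr rfl fun j hj => ?_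
    rw [← hy' j hj, Submodule.norm_coe, b.sum_sq_norm_inner_left]
  rw [hsum, hnx, hny]
  calc _ ≤ ∑ m, ‖∑ i ∈ s, ∑ j ∈ s, a i j * inner ℂ (b m) (x' j) * inner ℂ (y' i) (b m)‖ :=
        norm_sum_le _ _
    _ ≤ ∑ m, K * (√(∑ j ∈ s, ‖inner ℂ (b m) (x' j)‖ ^ 2) *
          √(∑ i ∈ s, ‖inner ℂ (y' i) (b m)‖ ^ 2)) :=
        Finset.sum_le_sum fun m _ => h _ _
    _ ≤ _ := by
        rw [← Finset.mul_sum]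
        refine mul_le_mul_of_nonneg_left ?_ hK
        exact Real.sum_sqrt_mul_sqrt_le _ (fun _ => Finset.sum_nonneg fun _ _ => by positivity)
          (fun _ => Finset.sum_nonneg fun _ _ => by positivity)

theorem norm_sum_smul_le_of_orthogonal {s : Finset Λ} {e : Λ → E} (he : ∀ i, ‖e i‖ ≤ 1)
    (ho : ∀ i ∈ s, ∀ j ∈ s, i ≠ j → inner ℂ (e i) (e j) = 0) (c : Λ → ℂ) :
    ‖∑ i ∈ s, c i • e i‖ ≤ √(∑ i ∈ s, ‖c i‖ ^ 2) := by
  classical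
  apply Real.le_sqrt_of_sq_le
  have h1 : ((‖∑ i ∈ s, c i • e i‖ ^ 2 : ℝ) : ℂ) = ∑ i ∈ s, ((‖c i • e i‖ ^ 2 : ℝ) : ℂ) := by
    have hv : ∀ v : E, ((‖v‖ : ℝ) : ℂ) ^ 2 = inner ℂ v v :=
      fun v => (inner_self_eq_norm_sq_to_K v).symm
    push_cast
    simp only [hv]
    rw [sum_inner]
    refine Finset.sum_congr rfl fun i hi => ?_
    rw [inner_sum, Finset.sum_eq_single i]
    · intro j hj hij
      rw [inner_smul_left, inner_smul_right, ho i hi j hj (Ne.symm hij)]; simp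
    · exact fun h => absurd hi h
  rw [← Complex.ofReal_sum] at h1
  rw [Complex.ofReal_injective h1]
  refine Finset.sum_le_sum fun i _ => ?_
  rw [norm_smul]
  exact pow_le_pow_left₀ (by positivity) (mul_le_of_le_one_right (norm_nonneg _) (he i)) 2

/-- Block version of the Schur multiplier bound. -/
theorem HerzSchurBound.block_le [Group Λ] {ψ : Λ → ℂ} {k : ℝ} (h : HerzSchurBound ψ k)
    (A : E →L[ℂ] E) (s : Finset Λ) (x y : Λ → E)
    (hx : ∀ i ∈ s, ∀ j ∈ s, i ≠ j → inner ℂ (x i) (x j) = 0)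
    (hy : ∀ i ∈ s, ∀ j ∈ s, i ≠ j → inner ℂ (y i) (y j) = 0) :
    ‖∑ i ∈ s, ∑ j ∈ s, ψ (i * j⁻¹) * inner ℂ (y i) (A (x j))‖ ≤
      k * ‖A‖ * (√(∑ j ∈ s, ‖x j‖ ^ 2) * √(∑ i ∈ s, ‖y i‖ ^ 2)) := by
  rcases eq_or_ne A 0 with rfl | hA
  · simp
  have hA0 : 0 < ‖A‖ := norm_pos_iff.2 hA
  -- Since `0⁻¹ = 0`, zero vectors stay zero; the normalised families are orthonormal up to zeros.
  let nrm : E → E := fun v => ((‖v‖⁻¹ : ℝ) : ℂ) • v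
  have hn1 : ∀ v, ‖nrm v‖ ≤ 1 := by
    intro v
    simp only [nrm, norm_smul, Complex.norm_real, norm_inv, norm_norm]
    exact inv_mul_le_one
  have hn2 : ∀ v, ((‖v‖ : ℝ) : ℂ) • nrm v = v := by
    intro v
    rcases eq_or_ne v 0 with rfl | hv
    · simp [nrm]
    · simp only [nrm, smul_smul]
      rw [← Complex.ofReal_mul, mul_inv_cancel₀ (norm_ne_zero_iff.2 hv)]; simp
  have hno : ∀ v w : E, inner ℂ v w = 0 → inner ℂ (nrm v) (nrm w) = 0 := by
    intro v w hvw
    simp [nrm, hvw]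
  -- A compression of `A / ‖A‖` to two orthonormal families, hence a contraction. The lengths of the
  -- vectors come back later as the scalar test vectors.
  let a : Λ → Λ → ℂ := fun i j => ((‖A‖⁻¹ : ℝ) : ℂ) * inner ℂ (nrm (y i)) (A (nrm (x j)))
  have ha : FormBound s a 1 := by
    intro ξ η
    have e : ∑ i ∈ s, ∑ j ∈ s, a i j * ξ j * η i = ((‖A‖⁻¹ : ℝ) : ℂ) *
        inner ℂ (∑ i ∈ s, (starRingEnd ℂ) (η i) • nrm (y i)) (A (∑ j ∈ s, ξ j • nrm (x j))) := by
      rw [map_sum, sum_inner, Finset.mul_sum]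
      refine Finset.sum_congr rfl fun i _ => ?_
      rw [inner_sum, Finset.mul_sum]
      refine Finset.sum_congr rfl fun j _ => ?_
      rw [map_smul, inner_smul_left, inner_smul_right, RingHomCompTriple.comp_apply]
      simp only [a, RingHom.id_apply]; ring
    rw [e, norm_mul, Complex.norm_real, norm_inv, norm_norm, one_mul]
    have b1 := norm_sum_smul_le_of_orthogonal (s := s) (e := fun i => nrm (x i)) (fun _ => hn1 _)
      (fun i hi j hj hij => hno _ _ (hx i hi j hj hij)) ξ
    have b2 := norm_sum_smul_le_of_orthogonal (s := s) (e := fun i => nrm (y i)) (fun _ => hn1 _)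
      (fun i hi j hj hij => hno _ _ (hy i hi j hj hij)) (fun i => (starRingEnd ℂ) (η i))
    simp only [RCLike.norm_conj] at b2
    calc _ ≤ ‖A‖⁻¹ * (‖∑ i ∈ s, (starRingEnd ℂ) (η i) • nrm (y i)‖ *
          (‖A‖ * ‖∑ j ∈ s, ξ j • nrm (x j)‖)) := by
          gcongr
          exact (norm_inner_le_norm _ _).trans (by gcongr; exact A.le_opNorm _)
      _ = ‖∑ j ∈ s, ξ j • nrm (x j)‖ * ‖∑ i ∈ s, (starRingEnd ℂ) (η i) • nrm (y i)‖ := by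
          field_simp
      _ ≤ _ := by gcongr
  have key := h s a ha (fun j => ((‖x j‖ : ℝ) : ℂ)) (fun i => ((‖y i‖ : ℝ) : ℂ))
  simp only [Complex.norm_real, norm_norm] at key
  have e2 : ∑ i ∈ s, ∑ j ∈ s, ψ (i * j⁻¹) * inner ℂ (y i) (A (x j)) = ((‖A‖ : ℝ) : ℂ) *
      ∑ i ∈ s, ∑ j ∈ s, ψ (i * j⁻¹) * a i j * ((‖x j‖ : ℝ) : ℂ) * ((‖y i‖ : ℝ) : ℂ) := by
    rw [Finset.mul_sum]
    refine Finset.sum_congr rfl fun i _ => ?_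
    rw [Finset.mul_sum]
    refine Finset.sum_congr rfl fun j _ => ?_
    conv_lhs => rw [← hn2 (y i), ← hn2 (x j), map_smul, inner_smul_left, inner_smul_right,
      Complex.conj_ofReal]
    simp only [a]
    have : ((‖A‖ : ℝ) : ℂ) ≠ 0 := by exact_mod_cast hA0.ne'
    push_cast
    field_simp
  rw [e2, norm_mul, Complex.norm_real, norm_norm]
  calc _ ≤ ‖A‖ * (k * (√(∑ j ∈ s, ‖x j‖ ^ 2) * √(∑ i ∈ s, ‖y i‖ ^ 2))) := by gcongr
    _ = _ := by ring

/-- A matrix unit at position `(x, 1)` isolates the value `ψ x`; the two indices coincide when `x =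
1`, hence the case split. -/
theorem HerzSchurBound.norm_le [Group Λ] {ψ : Λ → ℂ} {k : ℝ} (h : HerzSchurBound ψ k) (x : Λ) :
    ‖ψ x‖ ≤ k := by
  classical
  rcases eq_or_ne x 1 with rfl | hx
  · have := h {1} (fun _ _ => 1) (fun ξ η => by simp) 1 1
    simpa using this
  · have := h {x, 1} (fun i j => if i = x ∧ j = 1 then 1 else 0) (fun ξ η => by
      simp only [Finset.sum_pair hx, hx, hx.symm]
      simp only [and_false, and_true, ↓reduceIte]
      simp only [zero_mul, one_mul, zero_add, add_zero, norm_mul]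
      refine mul_le_mul ?_ ?_ (norm_nonneg _) (Real.sqrt_nonneg _)
      · exact Real.le_sqrt_of_sq_le (by nlinarith [sq_nonneg ‖ξ x‖])
      · exact Real.le_sqrt_of_sq_le (by nlinarith [sq_nonneg ‖η 1‖]))
      (fun j => if j = 1 then 1 else 0) (fun i => if i = x then 1 else 0)
    simpa [Finset.sum_pair hx, hx, hx.symm] using this

theorem HerzSchurBound.add [Group Λ] {φ ψ : Λ → ℂ} {k l : ℝ} (hφ : HerzSchurBound φ k)
    (hψ : HerzSchurBound ψ l) : HerzSchurBound (φ + ψ) (k + l) := by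
  intro s a ha ξ η
  have := (norm_add_le _ _).trans (add_le_add (hφ s a ha ξ η) (hψ s a ha ξ η))
  rw [← Finset.sum_add_distrib, ← add_mul] at this
  simpa only [← Finset.sum_add_distrib, ← add_mul, Pi.add_apply] using this

theorem HerzSchurBound.const_mul [Group Λ] {φ : Λ → ℂ} {k : ℝ} (hφ : HerzSchurBound φ k)
    (c : ℂ) : HerzSchurBound (fun x => c * φ x) (‖c‖ * k) := by
  intro s a ha ξ η
  have e : ∑ i ∈ s, ∑ j ∈ s, c * φ (i * j⁻¹) * a i j * ξ j * η i =
      c * ∑ i ∈ s, ∑ j ∈ s, φ (i * j⁻¹) * a i j * ξ j * η i := by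
    simp only [Finset.mul_sum, mul_assoc]
  rw [e, norm_mul, mul_assoc]
  exact mul_le_mul_of_nonneg_left (hφ s a ha ξ η) (norm_nonneg _)

theorem HerzSchurBound.comp [Group Λ] {Λ' : Type*} [Group Λ'] {φ : Λ → ℂ} {k : ℝ}
    (hφ : HerzSchurBound φ k) (j : Λ' →* Λ) (hj : Function.Injective j) :
    HerzSchurBound (φ ∘ j) k := by
  intro s a ha ξ η
  have hinv : ∀ x, Function.invFun j (j x) = x := Function.leftInverse_invFun hj
  let g := Function.invFun j
  have h2 := hφ (s.map ⟨j, hj⟩) (fun x y => a (g x) (g y)) (fun ξ η => by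
    simpa [g, hinv] using ha (ξ ∘ j) (η ∘ j)) (ξ ∘ g) (η ∘ g)
  simpa [g, hinv] using h2

/-- Needed because `cbMultiplierNorm` is an infimum, so that a bound by `k` only yields a transpose
map of cb norm below `k + ε`. -/
theorem HerzSchurBound.of_tendsto [Group Λ] {φ : Λ → ℂ} {k : ℝ}
    (h : ∀ ε > 0, HerzSchurBound φ (k + ε)) : HerzSchurBound φ k := by
  intro s a ha ξ η
  have h2 : ∀ ε > 0, ‖∑ i ∈ s, ∑ j ∈ s, φ (i * j⁻¹) * a i j * ξ j * η i‖ ≤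
      (k + ε) * (√(∑ j ∈ s, ‖ξ j‖ ^ 2) * √(∑ i ∈ s, ‖η i‖ ^ 2)) := fun ε hε => h ε hε s a ha ξ η
  have t : Tendsto (fun ε : ℝ => (k + ε) * (√(∑ j ∈ s, ‖ξ j‖ ^ 2) * √(∑ i ∈ s, ‖η i‖ ^ 2)))
      (𝓝[>] 0) (𝓝 (k * (√(∑ j ∈ s, ‖ξ j‖ ^ 2) * √(∑ i ∈ s, ‖η i‖ ^ 2)))) := by
    apply Tendsto.mono_left _ nhdsWithin_le_nhds
    apply Continuous.tendsto'
    · fun_prop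
    · simp
  exact ge_of_tendsto t (eventually_mem_nhdsWithin.mono fun ε hε => h2 ε hε)

end SchurMultipliers

/-! ### Amplifications and the bicommutant argument. -/

section DiagonalOperators

theorem lp.norm_sq_eq_tsum {ι H : Type*} [NormedAddCommGroup H]
    (f : lp (fun _ : ι => H) 2) :
    HasSum (fun i => ‖f i‖ ^ 2) (‖f‖ ^ 2) := by
  have := lp.hasSum_norm (p := 2) (by simp) f
  simpa using this

theorem memℓp_two_of_summable {ι H : Type*} [NormedAddCommGroup H] {f : ι → H}
    (hf : Summable fun i => ‖f i‖ ^ 2) :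
    Memℓp (E := fun _ : ι => H) f 2 :=
  memℓp_gen (by simpa using hf)

variable {H : Type*} [NormedAddCommGroup H] [InnerProductSpace ℂ H]

theorem summable_inner_apply {ι : Type*} {f g : ι → H} (hf : Summable fun i => ‖f i‖ ^ 2)
    (hg : Summable fun i => ‖g i‖ ^ 2) (T : H →L[ℂ] H) :
    Summable fun i => inner ℂ (g i) (T (f i)) := by
  refine Summable.of_norm_bounded (g := fun i => ‖T‖ * (‖f i‖ ^ 2 + ‖g i‖ ^ 2))
    ((hf.add hg).mul_left _) fun i => ?_
  calc _ ≤ ‖g i‖ * (‖T‖ * ‖f i‖) :=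
        (norm_inner_le_norm _ _).trans (by gcongr; exact T.le_opNorm _)
    _ = ‖T‖ * (‖f i‖ * ‖g i‖) := by ring
    _ ≤ _ := by
        gcongr
        nlinarith [sq_nonneg (‖f i‖ - ‖g i‖), sq_nonneg (‖f i‖), sq_nonneg ‖g i‖]

/-- The operator `T ⊕ T ⊕ ⋯` on a Hilbert sum of copies of `H`. -/
def diagOp (ι : Type*) (T : H →L[ℂ] H) : lp (fun _ : ι => H) 2 →L[ℂ] lp (fun _ : ι => H) 2 :=
  LinearMap.mkContinuous
    { toFun := fun f => ⟨fun i => T (f i), by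
        refine memℓp_two_of_summable (((lp.norm_sq_eq_tsum f).summable.mul_left (‖T‖ ^ 2)).of_nonneg_of_le
          (fun _ => by positivity) fun i => ?_)
        rw [← mul_pow]
        exact pow_le_pow_left₀ (norm_nonneg _) (T.le_opNorm _) 2⟩
      map_add' := fun f g => lp.ext (funext fun i => map_add T (f i) (g i))
      map_smul' := fun c f => lp.ext (funext fun i => map_smul T c (f i)) }
    ‖T‖ (fun f => by
      refine lp.norm_le_of_tsum_le (by simp) (by positivity) ?_
      have h1 : ∀ i, ‖T (f i)‖ ^ 2 ≤ ‖T‖ ^ 2 * ‖f i‖ ^ 2 := fun i => by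
        rw [← mul_pow]
        exact pow_le_pow_left₀ (norm_nonneg _) (T.le_opNorm _) 2
      have h2 := ((lp.norm_sq_eq_tsum f).mul_left (‖T‖ ^ 2))
      have h3 : Summable fun i => ‖T (f i)‖ ^ 2 :=
        h2.summable.of_nonneg_of_le (fun _ => by positivity) h1
      simp only [ENNReal.toReal_ofNat, Real.rpow_ofNat, mul_pow]
      rw [← h2.tsum_eq]
      exact h3.tsum_le_tsum h1 h2.summable)

@[simp] theorem diagOp_apply {ι : Type*} (T : H →L[ℂ] H) (f : lp (fun _ : ι => H) 2) (i : ι) :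
    diagOp ι T f i = T (f i) := rfl

theorem norm_diagOp_le {ι : Type*} (T : H →L[ℂ] H) : ‖diagOp ι T‖ ≤ ‖T‖ :=
  LinearMap.mkContinuous_norm_le _ (norm_nonneg _) _

theorem diagOp_single {ι : Type*} [DecidableEq ι] (T : H →L[ℂ] H) (i : ι) (h : H) :
    diagOp ι T (lp.single 2 i h) = lp.single 2 i (T h) := by
  refine lp.ext (funext fun j => ?_)
  rw [diagOp_apply]
  rcases eq_or_ne j i with rfl | hj
  · simp
  · rw [lp.single_apply_ne _ _ _ hj, lp.single_apply_ne _ _ _ hj, map_zero]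

/-- Von Neumann's argument: let `M` be the closed span of the vectors `diagOp ι A f` with `A ∈ 𝒮`.
Its projection commutes with the amplification of `𝒮`, hence with that of `T`, so `diagOp ι T f`
stays in `M`, which is orthogonal to `g`. -/
theorem inner_diagOp_eq_zero_of_bicommutant [CompleteSpace H] {ι : Type*}
    (𝒮 : Set (H →L[ℂ] H)) (h1 : 1 ∈ 𝒮) (hmul : ∀ A ∈ 𝒮, ∀ B ∈ 𝒮, A * B ∈ 𝒮)
    (hstar : ∀ A ∈ 𝒮, star A ∈ 𝒮) (T : H →L[ℂ] H)
    (hT : ∀ C : H →L[ℂ] H, (∀ A ∈ 𝒮, A * C = C * A) → C * T = T * C)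
    (f g : lp (fun _ : ι => H) 2) (h0 : ∀ A ∈ 𝒮, inner ℂ g (diagOp ι A f) = 0) :
    inner ℂ g (diagOp ι T f) = 0 := by
  classical
  let N : Submodule ℂ (lp (fun _ : ι => H) 2) :=
    Submodule.span ℂ ((fun A => diagOp ι A f) '' 𝒮)
  let M := N.topologicalClosure
  have hMc : IsClosed (M : Set (lp (fun _ : ι => H) 2)) := N.isClosed_topologicalClosure
  have hMcomp : CompleteSpace M := hMc.completeSpace_coe
  have hNinv : ∀ B ∈ 𝒮, ∀ v ∈ N, diagOp ι B v ∈ N := by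
    intro B hB v hv
    induction hv using Submodule.span_induction with
    | mem x hx =>
      obtain ⟨A, hA, rfl⟩ := hx
      exact Submodule.subset_span ⟨B * A, hmul B hB A hA, rfl⟩
    | zero => simp
    | add x y _ _ hx hy => rw [map_add]; exact N.add_mem hx hy
    | smul c x _ hx => rw [map_smul]; exact N.smul_mem c hx
  have hMinv : ∀ B ∈ 𝒮, ∀ v ∈ M, diagOp ι B v ∈ M := by
    intro B hB v hv
    exact map_mem_closure (diagOp ι B).continuous hv (fun w hw => hNinv B hB w hw)
  have hadj : ∀ (B : H →L[ℂ] H) (v w : lp (fun _ : ι => H) 2),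
      inner ℂ v (diagOp ι B w) = inner ℂ (diagOp ι (star B) v) w := by
    intro B v w
    rw [lp.inner_eq_tsum, lp.inner_eq_tsum]
    refine tsum_congr fun i => ?_
    rw [diagOp_apply, diagOp_apply, ContinuousLinearMap.star_eq_adjoint,
      ContinuousLinearMap.adjoint_inner_left]
  let P := M.starProjection
  have hPc : ∀ B ∈ 𝒮, ∀ v, P (diagOp ι B v) = diagOp ι B (P v) := by
    intro B hB v
    refine Submodule.eq_starProjection_of_mem_of_inner_eq_zero
      (hMinv B hB _ (Submodule.starProjection_apply_mem _ _)) fun w hw => ?_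
    rw [← map_sub, ← inner_conj_symm, hadj, ← inner_conj_symm,
      Submodule.starProjection_inner_eq_zero v _ (hMinv _ (hstar B hB) w hw)]
    simp
  -- Each matrix entry of `P` is an operator on `H` commuting with `𝒮`, so it commutes with `T`.
  have hslice : ∀ (m n : ι) (h : H), T (P (lp.single 2 n h) m) = P (lp.single 2 n (T h)) m := by
    intro m n h
    let C : H →L[ℂ] H := (lp.evalCLM ℂ (fun _ : ι => H) 2 m) ∘L P ∘L
      (lp.singleContinuousLinearMap ℂ (fun _ : ι => H) 2 n)
    have := hT C (fun A hA => ContinuousLinearMap.ext fun h => by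
      change A (P (lp.single 2 n h) m) = P (lp.single 2 n (A h)) m
      rw [← diagOp_single, hPc A hA, diagOp_apply])
    exact (DFunLike.congr_fun this h).symm
  have hPT : (diagOp ι T) ∘L P = P ∘L diagOp ι T := by
    refine lp.ext_continuousLinearMap (by simp) fun n => ContinuousLinearMap.ext fun h => ?_
    refine lp.ext (funext fun m => ?_)
    change T (P (lp.single 2 n h) m) = P (diagOp ι T (lp.single 2 n h)) m
    rw [diagOp_single, hslice]
  have hfM : f ∈ M := N.le_topologicalClosure (Submodule.subset_span ⟨1, h1, rfl⟩)
  have hTf : diagOp ι T f ∈ M := by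
    have : diagOp ι T f = P (diagOp ι T f) := by
      have := DFunLike.congr_fun hPT f
      simp only [ContinuousLinearMap.comp_apply] at this
      rw [← this, show P f = f from Submodule.starProjection_eq_self_iff.2 hfM]
    rw [this]; exact Submodule.starProjection_apply_mem _ _
  have hperp : ∀ v ∈ N, inner ℂ g v = 0 := by
    intro v hv
    induction hv using Submodule.span_induction with
    | mem x hx => obtain ⟨A, hA, rfl⟩ := hx; exact h0 A hA
    | zero => simp
    | add x y _ _ hx hy => rw [inner_add_right, hx, hy, add_zero]
    | smul c x _ hx => rw [inner_smul_right, hx, mul_zero]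
  have hcl : IsClosed {v : lp (fun _ : ι => H) 2 | inner ℂ g v = 0} :=
    isClosed_eq (by fun_prop) continuous_const
  exact closure_minimal (fun v hv => hperp v hv) hcl hTf

end DiagonalOperators

/-! ### The left regular representation and its bicommutant. -/

section LeftRegular

variable {G : Type u} [Group G] [MeasurableSpace G] [MeasurableMul G]
  (μ : Measure G) [μ.IsMulLeftInvariant]

theorem leftRegular_coeFn (x : G) (f : Lp ℂ 2 μ) :
    leftRegular μ x f =ᵐ[μ] fun y => f (x⁻¹ * y) :=
  Lp.coeFn_compMeasurePreserving f (measurePreserving_mul_left μ x⁻¹)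

theorem leftRegular_mul (x y : G) : leftRegular μ x * leftRegular μ y = leftRegular μ (x * y) := by
  refine ContinuousLinearMap.ext fun f => ?_
  change Lp.compMeasurePreserving _ _ (Lp.compMeasurePreserving _ _ f) =
    Lp.compMeasurePreserving _ _ f
  rw [← Lp.compMeasurePreserving_comp_apply]
  congr 2
  funext z
  simp [mul_assoc]

theorem leftRegular_mul_apply (x y : G) (f : Lp ℂ 2 μ) :
    leftRegular μ x (leftRegular μ y f) = leftRegular μ (x * y) f := by
  rw [← leftRegular_mul]; rfl

theorem leftRegular_one : leftRegular μ (1 : G) = 1 := by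
  refine ContinuousLinearMap.ext fun f => Lp.ext ?_
  filter_upwards [leftRegular_coeFn μ 1 f] with y hy
  simpa using hy

theorem norm_leftRegular_apply (x : G) (f : Lp ℂ 2 μ) : ‖leftRegular μ x f‖ = ‖f‖ :=
  LinearIsometry.norm_map _ f

theorem inner_leftRegular_leftRegular (x : G) (f g : Lp ℂ 2 μ) :
    inner ℂ (leftRegular μ x f) (leftRegular μ x g) = inner ℂ f g :=
  LinearIsometry.inner_map_map (Lp.compMeasurePreservingₗᵢ ℂ (fun y => x⁻¹ * y)
    (measurePreserving_mul_left μ x⁻¹)) f g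

theorem inner_leftRegular_right (x : G) (f g : Lp ℂ 2 μ) :
    inner ℂ f (leftRegular μ x g) = inner ℂ (leftRegular μ x⁻¹ f) g := by
  rw [← inner_leftRegular_leftRegular μ x (leftRegular μ x⁻¹ f) g, leftRegular_mul_apply,
    mul_inv_cancel, leftRegular_one]; rfl

theorem star_leftRegular (x : G) : star (leftRegular μ x) = leftRegular μ x⁻¹ := by
  rw [ContinuousLinearMap.star_eq_adjoint]
  symm
  rw [ContinuousLinearMap.eq_adjoint_iff]
  intro f g
  rw [inner_leftRegular_right]

theorem mem_groupVN_iff (T : Lp ℂ 2 μ →L[ℂ] Lp ℂ 2 μ) :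
    T ∈ (groupVN μ).toStarSubalgebra ↔ ∀ C : Lp ℂ 2 μ →L[ℂ] Lp ℂ 2 μ,
      (∀ x, leftRegular μ x * C = C * leftRegular μ x) → C * T = T * C := by
  change T ∈ StarSubalgebra.centralizer ℂ
    (StarSubalgebra.centralizer ℂ (Set.range (leftRegular μ)) :
      Set (Lp ℂ 2 μ →L[ℂ] Lp ℂ 2 μ)) ↔ _
  rw [← SetLike.mem_coe, StarSubalgebra.coe_centralizer_centralizer]
  have hu : Set.range (leftRegular μ) ∪ star (Set.range (leftRegular μ)) =
      Set.range (leftRegular μ) := by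
    refine Set.union_eq_left.2 ?_
    rintro A ⟨x, hx⟩
    exact ⟨x⁻¹, by rw [← star_leftRegular, hx, star_star]⟩
  rw [hu]
  constructor
  · intro h C hC
    exact h C (by rintro _ ⟨x, rfl⟩; exact hC x)
  · intro h C hC
    exact h C (fun x => hC _ ⟨x, rfl⟩)

end LeftRegular

/-! ### Normal functionals on the group von Neumann algebra. -/

section NormalFunctionals

variable {G : Type u} [Group G] [MeasurableSpace G] [MeasurableMul G]
  {μ : Measure G} [μ.IsMulLeftInvariant]

theorem IsNormalFunctional.of_countable {ι : Type*} [Countable ι] {ω : GroupVN μ →L[ℂ] ℂ}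
    {f g : ι → Lp ℂ 2 μ} (hf : Summable fun i => ‖f i‖ ^ 2) (hg : Summable fun i => ‖g i‖ ^ 2)
    (h : ∀ T : GroupVN μ,
      HasSum (fun i => inner ℂ (g i) ((T : Lp ℂ 2 μ →L[ℂ] Lp ℂ 2 μ) (f i))) (ω T)) :
    IsNormalFunctional ω := by
  obtain ⟨e, he⟩ := Countable.exists_injective_nat ι
  refine ⟨Function.extend e f 0, Function.extend e g 0, ?_, ?_, fun T => ?_⟩
  · have := (hasSum_extend_zero he).2 hf.hasSum
    refine this.summable.congr fun n => ?_
    by_cases hn : ∃ i, e i = n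
    · obtain ⟨i, rfl⟩ := hn
      simp only [he.extend_apply]
    · simp [Function.extend_apply' _ _ _ hn]
  · have := (hasSum_extend_zero he).2 hg.hasSum
    refine this.summable.congr fun n => ?_
    by_cases hn : ∃ i, e i = n
    · obtain ⟨i, rfl⟩ := hn
      simp only [he.extend_apply]
    · simp [Function.extend_apply' _ _ _ hn]
  · refine ((hasSum_extend_zero he).2 (h T)).congr_fun ?_
    intro n
    by_cases hn : ∃ i, e i = n
    · obtain ⟨i, rfl⟩ := hn
      simp only [he.extend_apply]
    · simp [Function.extend_apply' _ _ _ hn]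

theorem IsNormalFunctional.add {ω ω' : GroupVN μ →L[ℂ] ℂ} (h : IsNormalFunctional ω)
    (h' : IsNormalFunctional ω') : IsNormalFunctional (ω + ω') := by
  obtain ⟨f, g, hf, hg, hω⟩ := h
  obtain ⟨f', g', hf', hg', hω'⟩ := h'
  refine IsNormalFunctional.of_countable (f := Sum.elim f f') (g := Sum.elim g g') ?_ ?_ ?_
  · exact (HasSum.sum (f := fun i => ‖Sum.elim f f' i‖ ^ 2) hf.hasSum hf'.hasSum).summable
  · exact (HasSum.sum (f := fun i => ‖Sum.elim g g' i‖ ^ 2) hg.hasSum hg'.hasSum).summable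
  · intro T
    exact HasSum.sum (hω T) (hω' T)

theorem IsNormalFunctional.smul {ω : GroupVN μ →L[ℂ] ℂ} (h : IsNormalFunctional ω) (c : ℂ) :
    IsNormalFunctional (c • ω) := by
  obtain ⟨f, g, hf, hg, hω⟩ := h
  refine ⟨fun n => c • f n, g, ?_, hg, fun T => ?_⟩
  · simpa only [norm_smul, mul_pow] using hf.mul_left (‖c‖ ^ 2)
  · simp only [map_smul, inner_smul_right]
    exact (hω T).mul_left c

theorem IsNormalFunctional.zero : IsNormalFunctional (0 : GroupVN μ →L[ℂ] ℂ) :=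
  ⟨0, 0, by simp, by simp, fun T => by simp⟩

theorem IsNormalFunctional.sub {ω ω' : GroupVN μ →L[ℂ] ℂ} (h : IsNormalFunctional ω)
    (h' : IsNormalFunctional ω') : IsNormalFunctional (ω - ω') := by
  have e : ω - ω' = ω + (-1 : ℂ) • ω' := by
    ext T
    simp [sub_eq_add_neg]
  exact e ▸ h.add (h'.smul (-1))

/-- A normal functional is a vector functional of the amplification to `ℓ²(ℕ; L²)`, so the
bicommutant argument applies to it. This is the uniqueness behind the identification of `A(G)` with
functions on `G`. -/
theorem IsNormalFunctional.eq_zero {ω : GroupVN μ →L[ℂ] ℂ} (h : IsNormalFunctional ω)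
    (h0 : ∀ x, ω (leftRegularVN μ x) = 0) : ω = 0 := by
  obtain ⟨f, g, hf, hg, hω⟩ := h
  let F : lp (fun _ : ℕ => Lp ℂ 2 μ) 2 := ⟨f, memℓp_two_of_summable hf⟩
  let F' : lp (fun _ : ℕ => Lp ℂ 2 μ) 2 := ⟨g, memℓp_two_of_summable hg⟩
  have hin : ∀ T : GroupVN μ, ω T = inner ℂ F' (diagOp ℕ (T : Lp ℂ 2 μ →L[ℂ] Lp ℂ 2 μ) F) := by
    intro T
    rw [lp.inner_eq_tsum]
    exact (hω T).tsum_eq.symm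
  refine ContinuousLinearMap.ext fun T => ?_
  rw [hin]
  refine inner_diagOp_eq_zero_of_bicommutant (Set.range (leftRegular μ))
    ⟨1, leftRegular_one μ⟩ ?_ ?_ _ (fun C hC => ?_) _ _ ?_
  · rintro _ ⟨x, rfl⟩ _ ⟨y, rfl⟩
    exact ⟨x * y, (leftRegular_mul μ x y).symm⟩
  · rintro _ ⟨x, rfl⟩
    exact ⟨x⁻¹, (star_leftRegular μ x).symm⟩
  · exact (mem_groupVN_iff μ _).1 T.2 C fun x => hC _ ⟨x, rfl⟩
  · rintro _ ⟨x, rfl⟩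
    exact (hin (leftRegularVN μ x)).symm.trans (h0 x)

theorem IsNormalFunctional.ext {ω ω' : GroupVN μ →L[ℂ] ℂ} (h : IsNormalFunctional ω)
    (h' : IsNormalFunctional ω')
    (he : ∀ x, ω (leftRegularVN μ x) = ω' (leftRegularVN μ x)) : ω = ω' :=
  sub_eq_zero.1 ((h.sub h').eq_zero fun x => by simp [he x])

/-- The vector functional `T ↦ ⟨T f, g⟩`. -/
def vectorFunctional (f g : Lp ℂ 2 μ) : GroupVN μ →L[ℂ] ℂ :=
  LinearMap.mkContinuous
    { toFun := fun T => inner ℂ g ((T : Lp ℂ 2 μ →L[ℂ] Lp ℂ 2 μ) f)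
      map_add' := fun S T => by simp [inner_add_right]
      map_smul' := fun c T => by simp [inner_smul_right] } (‖f‖ * ‖g‖) (fun T => by
      change ‖inner ℂ g ((T : Lp ℂ 2 μ →L[ℂ] Lp ℂ 2 μ) f)‖ ≤ _
      refine (norm_inner_le_norm _ _).trans ?_
      have := (T : Lp ℂ 2 μ →L[ℂ] Lp ℂ 2 μ).le_opNorm f
      calc _ ≤ ‖g‖ * (‖(T : Lp ℂ 2 μ →L[ℂ] Lp ℂ 2 μ)‖ * ‖f‖) := by gcongr
        _ = ‖f‖ * ‖g‖ * ‖(T : Lp ℂ 2 μ →L[ℂ] Lp ℂ 2 μ)‖ := by ring)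

theorem vectorFunctional_apply (f g : Lp ℂ 2 μ) (T : GroupVN μ) :
    vectorFunctional f g T = inner ℂ g ((T : Lp ℂ 2 μ →L[ℂ] Lp ℂ 2 μ) f) := rfl

theorem isNormalFunctional_vectorFunctional (f g : Lp ℂ 2 μ) :
    IsNormalFunctional (vectorFunctional f g) :=
  IsNormalFunctional.of_countable (ι := Unit) (f := fun _ => f) (g := fun _ => g)
    (Summable.of_finite) (Summable.of_finite) fun T =>
      hasSum_unique (fun _ : Unit => inner ℂ g ((T : Lp ℂ 2 μ →L[ℂ] Lp ℂ 2 μ) f)) _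

end NormalFunctionals

/-! ### Normal maps that implement multipliers. -/

section NormalMultiplierMaps

variable {G : Type u} [Group G] [MeasurableSpace G] [MeasurableMul G]
  {μ : Measure G} [μ.IsMulLeftInvariant]

/-- A normal map on the group von Neumann algebra with `S(λ(x)) = φ(x) λ(x)`. -/
structure IsNormalMultiplierMap (φ : G → ℂ) (S : GroupVN μ →L[ℂ] GroupVN μ) : Prop where
  normal : ∀ ω : GroupVN μ →L[ℂ] ℂ, IsNormalFunctional ω → IsNormalFunctional (ω ∘L S)
  apply_leftRegular : ∀ x, S (leftRegularVN μ x) = φ x • leftRegularVN μ x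

namespace IsNormalMultiplierMap

variable {φ φ' : G → ℂ} {S S' : GroupVN μ →L[ℂ] GroupVN μ}

theorem represents (h : IsNormalMultiplierMap φ S) {ω : GroupVN μ →L[ℂ] ℂ} {ψ : G → ℂ}
    (hω : Represents ω ψ) : Represents (ω ∘L S) (φ * ψ) :=
  ⟨h.normal ω hω.1, fun x => by
    rw [ContinuousLinearMap.comp_apply, h.apply_leftRegular, map_smul, Pi.mul_apply, hω.2 x]; rfl⟩

/-- `ω ∘ S` and `ω'` are both normal and agree on every `λ(x)`, so they coincide. -/
theorem isTransposeMultiplier (h : IsNormalMultiplierMap φ S) :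
    IsTransposeMultiplier φ (S : GroupVN μ →ₗ[ℂ] GroupVN μ) := by
  intro ψ ω ω' hω hω' T
  have hr := h.represents hω
  have := hr.1.ext hω'.1 fun x => by rw [← hr.2 x, hω'.2 x]
  exact DFunLike.congr_fun this T

theorem mul_mem (h : IsNormalMultiplierMap φ S) {ψ : G → ℂ} (hψ : ψ ∈ fourierAlgebra μ) :
    φ * ψ ∈ fourierAlgebra μ := by
  obtain ⟨ω, hω⟩ := hψ
  exact ⟨_, h.represents hω⟩

theorem add (h : IsNormalMultiplierMap φ S) (h' : IsNormalMultiplierMap φ' S') :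
    IsNormalMultiplierMap (φ + φ') (S + S') where
  normal ω hω := by
    rw [ContinuousLinearMap.comp_add]
    exact (h.normal ω hω).add (h'.normal ω hω)
  apply_leftRegular x := by
    rw [add_apply, h.apply_leftRegular, h'.apply_leftRegular, Pi.add_apply,
      add_smul]

theorem smul (h : IsNormalMultiplierMap φ S) (c : ℂ) :
    IsNormalMultiplierMap (fun x => c * φ x) (c • S) where
  normal ω hω := by
    rw [ContinuousLinearMap.comp_smul]
    exact (h.normal ω hω).smul c
  apply_leftRegular x := by
    rw [smul_apply, h.apply_leftRegular, smul_smul]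

theorem zero : IsNormalMultiplierMap (0 : G → ℂ) (0 : GroupVN μ →L[ℂ] GroupVN μ) where
  normal ω hω := by
    rw [ContinuousLinearMap.comp_zero]
    exact IsNormalFunctional.zero
  apply_leftRegular x := by simp

theorem sum {ι : Type*} (s : Finset ι) {φ : ι → G → ℂ} {S : ι → GroupVN μ →L[ℂ] GroupVN μ}
    (h : ∀ i, IsNormalMultiplierMap (φ i) (S i)) :
    IsNormalMultiplierMap (fun x => ∑ i ∈ s, φ i x) (∑ i ∈ s, S i) := by
  classical
  induction s using Finset.induction_on with
  | empty => simpa using! IsNormalMultiplierMap.zero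
  | insert a s ha ih =>
    rw [Finset.sum_insert ha]
    convert! (h a).add ih using 1
    funext x
    rw [Finset.sum_insert ha]; rfl

end IsNormalMultiplierMap

/-- The normal map `T ↦ W^* (T ⊕ T ⊕ ⋯) V` into the bounded operators. -/
def sliceOp {ι : Type*} (V W : Lp ℂ 2 μ →L[ℂ] lp (fun _ : ι => Lp ℂ 2 μ) 2) :
    (Lp ℂ 2 μ →L[ℂ] Lp ℂ 2 μ) →L[ℂ] (Lp ℂ 2 μ →L[ℂ] Lp ℂ 2 μ) :=
  LinearMap.mkContinuous
    { toFun := fun T => W.adjoint ∘L (diagOp ι T) ∘L V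
      map_add' := fun S T => by
        have : diagOp ι (S + T) = diagOp ι S + diagOp ι T := rfl
        rw [this, ContinuousLinearMap.add_comp, ContinuousLinearMap.comp_add]
      map_smul' := fun c T => by
        have : diagOp ι (c • T) = c • diagOp ι T := rfl
        rw [this, ContinuousLinearMap.smul_comp, ContinuousLinearMap.comp_smul]; rfl }
    (‖W‖ * ‖V‖) (fun T => by
      change ‖W.adjoint ∘L (diagOp ι T) ∘L V‖ ≤ _
      calc _ ≤ ‖W.adjoint‖ * (‖diagOp ι T‖ * ‖V‖) :=
            (ContinuousLinearMap.opNorm_comp_le _ _).trans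
              (by gcongr; exact ContinuousLinearMap.opNorm_comp_le _ _)
        _ ≤ ‖W‖ * (‖T‖ * ‖V‖) := by
            rw [LinearIsometryEquiv.norm_map]
            gcongr
            exact norm_diagOp_le T
        _ = _ := by ring)

theorem inner_sliceOp {ι : Type*} (V W : Lp ℂ 2 μ →L[ℂ] lp (fun _ : ι => Lp ℂ 2 μ) 2)
    (T : Lp ℂ 2 μ →L[ℂ] Lp ℂ 2 μ) (ξ η : Lp ℂ 2 μ) :
    inner ℂ η (sliceOp V W T ξ) = inner ℂ (W η) (diagOp ι T (V ξ)) := by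
  change inner ℂ η (W.adjoint (diagOp ι T (V ξ))) = _
  rw [ContinuousLinearMap.adjoint_inner_right]

theorem hasSum_inner_sliceOp {ι : Type*} (V W : Lp ℂ 2 μ →L[ℂ] lp (fun _ : ι => Lp ℂ 2 μ) 2)
    (T : Lp ℂ 2 μ →L[ℂ] Lp ℂ 2 μ) (ξ η : Lp ℂ 2 μ) :
    HasSum (fun i => inner ℂ (W η i) (T (V ξ i))) (inner ℂ η (sliceOp V W T ξ)) := by
  rw [inner_sliceOp]
  exact lp.hasSum_inner (W η) (diagOp ι T (V ξ))

/-- For `C` in the commutant, the functionals `T ↦ ⟨S(T) ξ, C*η⟩` and `T ↦ ⟨S(T) C ξ, η⟩` are normal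
and agree on `λ(G)`, because there `S` only rescales; hence they agree everywhere and `S(T)`
commutes with `C`. -/
theorem sliceOp_mem {ι : Type*} [Countable ι]
    {V W : Lp ℂ 2 μ →L[ℂ] lp (fun _ : ι => Lp ℂ 2 μ) 2} {φ : G → ℂ}
    (h : ∀ x, sliceOp V W (leftRegular μ x) = φ x • leftRegular μ x) (T : GroupVN μ) :
    sliceOp V W (T : Lp ℂ 2 μ →L[ℂ] Lp ℂ 2 μ) ∈ (groupVN μ).toStarSubalgebra := by
  rw [mem_groupVN_iff]
  intro C hC
  refine ContinuousLinearMap.ext fun ξ => ext_inner_left ℂ fun η => ?_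
  let incl : GroupVN μ →L[ℂ] (Lp ℂ 2 μ →L[ℂ] Lp ℂ 2 μ) :=
    LinearMap.mkContinuous (groupVN μ).toStarSubalgebra.subtype.toLinearMap 1 (fun T => by
      simp)
  let vec : Lp ℂ 2 μ → Lp ℂ 2 μ → (Lp ℂ 2 μ →L[ℂ] Lp ℂ 2 μ) →L[ℂ] ℂ := fun ξ η =>
    (innerSL ℂ η) ∘L (ContinuousLinearMap.apply ℂ (Lp ℂ 2 μ) ξ)
  have hn : ∀ ξ η, IsNormalFunctional (vec ξ η ∘L sliceOp V W ∘L incl) := by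
    intro ξ η
    exact IsNormalFunctional.of_countable (lp.norm_sq_eq_tsum (V ξ)).summable
      (lp.norm_sq_eq_tsum (W η)).summable fun T => hasSum_inner_sliceOp V W _ ξ η
  have key := (hn ξ (C.adjoint η)).ext (hn (C ξ) η) fun x => by
    change inner ℂ (C.adjoint η) (sliceOp V W (leftRegular μ x) ξ) =
      inner ℂ η (sliceOp V W (leftRegular μ x) (C ξ))
    rw [ContinuousLinearMap.adjoint_inner_left, h]
    congr 1
    have := DFunLike.congr_fun (hC x) ξ
    simp only [mul_apply_eq_comp] at this
    simp [this]
  have := DFunLike.congr_fun key T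
  change inner ℂ (C.adjoint η) (sliceOp V W (T : Lp ℂ 2 μ →L[ℂ] Lp ℂ 2 μ) ξ) =
      inner ℂ η (sliceOp V W (T : Lp ℂ 2 μ →L[ℂ] Lp ℂ 2 μ) (C ξ)) at this
  rw [ContinuousLinearMap.adjoint_inner_left] at this
  exact this

/-- The map `T ↦ W^* (T ⊕ T ⊕ ⋯) V` as a map on the group von Neumann algebra. -/
def sliceVN {ι : Type*} [Countable ι] (V W : Lp ℂ 2 μ →L[ℂ] lp (fun _ : ι => Lp ℂ 2 μ) 2)
    (φ : G → ℂ) (h : ∀ x, sliceOp V W (leftRegular μ x) = φ x • leftRegular μ x) :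
    GroupVN μ →L[ℂ] GroupVN μ :=
  LinearMap.mkContinuous
    { toFun := fun T => ⟨sliceOp V W T, sliceOp_mem h T⟩
      map_add' := fun _ _ => Subtype.ext (map_add (sliceOp V W) _ _)
      map_smul' := fun c _ => Subtype.ext (map_smul (sliceOp V W) c _) }
    ‖sliceOp V W‖ (fun _ => (sliceOp V W).le_opNorm _)

theorem sliceVN_coe {ι : Type*} [Countable ι]
    (V W : Lp ℂ 2 μ →L[ℂ] lp (fun _ : ι => Lp ℂ 2 μ) 2)
    (φ : G → ℂ) (h : ∀ x, sliceOp V W (leftRegular μ x) = φ x • leftRegular μ x) (T : GroupVN μ) :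
    (sliceVN V W φ h T : Lp ℂ 2 μ →L[ℂ] Lp ℂ 2 μ) = sliceOp V W T := rfl

theorem summable_norm_sq_apply {ι : Type*} (V : Lp ℂ 2 μ →L[ℂ] lp (fun _ : ι => Lp ℂ 2 μ) 2)
    {f : ℕ → Lp ℂ 2 μ} (hf : Summable fun n => ‖f n‖ ^ 2) :
    Summable fun p : ℕ × ι => ‖V (f p.1) p.2‖ ^ 2 := by
  rw [summable_prod_of_nonneg (fun _ => by positivity)]
  refine ⟨fun n => (lp.norm_sq_eq_tsum (V (f n))).summable, ?_⟩
  refine (hf.mul_left (‖V‖ ^ 2)).of_nonneg_of_le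
    (fun n => tsum_nonneg fun _ => by positivity) fun n => ?_
  change ∑' i, ‖V (f n) i‖ ^ 2 ≤ _
  rw [(lp.norm_sq_eq_tsum (V (f n))).tsum_eq, ← mul_pow]
  exact pow_le_pow_left₀ (norm_nonneg _) (V.le_opNorm _) 2

theorem isNormalMultiplierMap_sliceVN {ι : Type*} [Countable ι]
    (V W : Lp ℂ 2 μ →L[ℂ] lp (fun _ : ι => Lp ℂ 2 μ) 2)
    (φ : G → ℂ) (h : ∀ x, sliceOp V W (leftRegular μ x) = φ x • leftRegular μ x) :
    IsNormalMultiplierMap φ (sliceVN V W φ h) where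
  normal ω hω := by
    obtain ⟨f, g, hf, hg, hω⟩ := hω
    have hf' := summable_norm_sq_apply V hf
    have hg' := summable_norm_sq_apply W hg
    -- The new vectors are the coordinates of all `V (f n)` and `W (g n)`; their squares are
    -- summable because `V` and `W` are bounded.
    refine IsNormalFunctional.of_countable (ι := ℕ × ι) hf' hg' fun T => ?_
    have hs := (summable_inner_apply hf' hg' (T : Lp ℂ 2 μ →L[ℂ] Lp ℂ 2 μ)).hasSum
    have h2 := hs.prod_fiberwise fun n =>
      hasSum_inner_sliceOp V W (T : Lp ℂ 2 μ →L[ℂ] Lp ℂ 2 μ) (f n) (g n)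
    have h3 := hω (sliceVN V W φ h T)
    simp only [sliceVN_coe] at h3
    rw [ContinuousLinearMap.comp_apply, h3.unique h2]
    exact hs
  apply_leftRegular x := Subtype.ext (h x)

end NormalMultiplierMaps

/-! ### Operator norms of matrices over the algebra. -/

section MatrixOperators

theorem ContinuousLinearMap.opNorm_le_of_inner {E : Type*} [NormedAddCommGroup E]
    [InnerProductSpace ℂ E] (A : E →L[ℂ] E) {K : ℝ} (hK : 0 ≤ K)
    (h : ∀ ξ η : E, ‖inner ℂ η (A ξ)‖ ≤ K * (‖ξ‖ * ‖η‖)) : ‖A‖ ≤ K := by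
  refine A.opNorm_le_bound hK fun ξ => ?_
  have h1 := h ξ (A ξ)
  rw [inner_self_eq_norm_sq_to_K] at h1
  simp only [norm_pow, RCLike.norm_ofReal, abs_norm] at h1
  rcases eq_or_ne ‖A ξ‖ 0 with h0 | h0
  · rw [h0]; positivity
  · have : 0 < ‖A ξ‖ := lt_of_le_of_ne (norm_nonneg _) h0.symm
    nlinarith

variable {G : Type u} [Group G] [MeasurableSpace G] [MeasurableMul G]
  {μ : Measure G} [μ.IsMulLeftInvariant]

theorem inner_matrixOperator {n : ℕ} (a : Matrix (Fin n) (Fin n) (GroupVN μ))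
    (ξ η : PiLp 2 (fun _ : Fin n => Lp ℂ 2 μ)) :
    inner ℂ η (matrixOperator a ξ) =
      ∑ i, ∑ j, inner ℂ (η i) ((a i j : Lp ℂ 2 μ →L[ℂ] Lp ℂ 2 μ) (ξ j)) := by
  rw [PiLp.inner_apply]
  refine Finset.sum_congr rfl fun i _ => ?_
  rw [← inner_sum]
  congr 1
  simp [matrixOperator]

end MatrixOperators

/-! ### From completely bounded multipliers to Schur multipliers. -/

section Necessity

theorem summable_norm_mul_norm {E : Type*} [SeminormedAddCommGroup E] {f g : ℕ → E}
    (hf : Summable fun n => ‖f n‖ ^ 2) (hg : Summable fun n => ‖g n‖ ^ 2) :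
    Summable fun n => ‖f n‖ * ‖g n‖ :=
  (hf.add hg).of_nonneg_of_le (fun _ => by positivity) fun n => by
    nlinarith [sq_nonneg (‖f n‖ - ‖g n‖), sq_nonneg (‖f n‖), sq_nonneg ‖g n‖]

variable {G : Type u} [Group G] [MeasurableSpace G] [MeasurableMul G]
  {μ : Measure G} [μ.IsMulLeftInvariant]

/-- Testing against vector functionals suffices: their coefficient functions lie in `A(G)`, and the
multiplier property provides the functional for the product with `φ`. -/
theorem IsTransposeMultiplier.apply_leftRegular [TopologicalSpace G] {φ : G → ℂ}
    (hφ : IsFourierMultiplier μ φ) {S : GroupVN μ →ₗ[ℂ] GroupVN μ}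
    (hS : IsTransposeMultiplier φ S) (x : G) :
    S (leftRegularVN μ x) = φ x • leftRegularVN μ x := by
  refine Subtype.ext (ContinuousLinearMap.ext fun ξ => ext_inner_left ℂ fun η => ?_)
  have hω : Represents (vectorFunctional ξ η) (fun x => vectorFunctional ξ η (leftRegularVN μ x)) :=
    ⟨isNormalFunctional_vectorFunctional ξ η, fun _ => rfl⟩
  obtain ⟨ω', hω'⟩ := hφ.2 _ ⟨_, hω⟩
  have h := hS _ _ _ hω hω' (leftRegularVN μ x)
  rw [← hω'.2 x] at h
  have e : inner ℂ η ((φ x • leftRegular μ x) ξ) = φ x * inner ℂ η (leftRegular μ x ξ) := by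
    simp [inner_smul_right]
  exact h.trans e.symm

theorem herzSchurBound_of_cbNorm_le {φ : G → ℂ} {S : GroupVN μ →ₗ[ℂ] GroupVN μ} {k : ℝ}
    (hk : 0 ≤ k) (hS : ∀ x, S (leftRegularVN μ x) = φ x • leftRegularVN μ x)
    (hcb : cbNorm S ≤ ENNReal.ofReal k) (f₀ : Lp ℂ 2 μ) (hf₀ : ‖f₀‖ = 1) :
    HerzSchurBound φ k := by
  classical
  intro s a ha ξ η
  let e := s.equivFin
  let x : Fin s.card → G := fun i => (e.symm i : G)
  have hconv : ∀ {M : Type} [AddCommMonoid M] (F : G → M), ∑ i ∈ s, F i = ∑ i, F (x i) := by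
    intro M _ F
    rw [← Finset.sum_coe_sort s F]
    exact (Equiv.sum_comp e.symm (fun i : s => F i)).symm
  -- Conjugating by the diagonal unitary with entries `λ(x i)` turns this matrix into `a ⊗ 1`.
  let A : Matrix (Fin s.card) (Fin s.card) (GroupVN μ) := fun i j =>
    a (x i) (x j) • leftRegularVN μ (x i * (x j)⁻¹)
  have hreg : ∀ (y z : G) (v w : Lp ℂ 2 μ), inner ℂ w (leftRegular μ (y * z⁻¹) v) =
      inner ℂ (leftRegular μ y⁻¹ w) (leftRegular μ z⁻¹ v) := by
    intro y z v w
    rw [← leftRegular_mul_apply, inner_leftRegular_right]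
  have hA : ‖matrixOperator A‖ ≤ 1 := by
    refine ContinuousLinearMap.opNorm_le_of_inner _ zero_le_one fun v w => ?_
    let X : G → Lp ℂ 2 μ := fun y => if h : y ∈ s then leftRegular μ y⁻¹ (v (e ⟨y, h⟩)) else 0
    let Y : G → Lp ℂ 2 μ := fun y => if h : y ∈ s then leftRegular μ y⁻¹ (w (e ⟨y, h⟩)) else 0
    have hX : ∀ i, X (x i) = leftRegular μ (x i)⁻¹ (v i) := fun i => by simp [X, x]
    have hY : ∀ i, Y (x i) = leftRegular μ (x i)⁻¹ (w i) := fun i => by simp [Y, x]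
    have key := ha.inner_le zero_le_one X Y
    simp only [hconv, hX, hY, norm_leftRegular_apply] at key
    rw [inner_matrixOperator, PiLp.norm_eq_of_L2 v, PiLp.norm_eq_of_L2 w]
    convert key using 2
    refine Finset.sum_congr rfl fun i _ => Finset.sum_congr rfl fun j _ => ?_
    rw [← hreg, ← inner_smul_right]
    rfl
  have hB : ‖matrixOperator (A.map S)‖ ≤ k := by
    have h1 : ‖matrixOperator (A.map S)‖ₑ ≤ ENNReal.ofReal k := by
      refine le_trans ?_ hcb
      unfold cbNorm
      exact le_iSup_of_le s.card (le_iSup_of_le A (le_iSup_of_le hA le_rfl))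
    rw [← ofReal_norm] at h1
    exact (ENNReal.ofReal_le_ofReal_iff hk).1 h1
  -- On vectors of the form `ξ i • λ(i) f₀` the translations cancel, and the scalar form of the
  -- Schur product remains. The conjugate in `w` is due to `FormBound` being bilinear.
  let v : PiLp 2 (fun _ : Fin s.card => Lp ℂ 2 μ) :=
    WithLp.toLp 2 fun i => ξ (x i) • leftRegular μ (x i) f₀
  let w : PiLp 2 (fun _ : Fin s.card => Lp ℂ 2 μ) :=
    WithLp.toLp 2 fun i => (starRingEnd ℂ) (η (x i)) • leftRegular μ (x i) f₀
  have hv : ‖v‖ = √(∑ j ∈ s, ‖ξ j‖ ^ 2) := by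
    rw [PiLp.norm_eq_of_L2, hconv]
    simp [v, norm_smul, norm_leftRegular_apply, hf₀]
  have hw : ‖w‖ = √(∑ j ∈ s, ‖η j‖ ^ 2) := by
    rw [PiLp.norm_eq_of_L2, hconv]
    simp [w, norm_smul, norm_leftRegular_apply, hf₀]
  have hin : inner ℂ w (matrixOperator (A.map S) v) =
      ∑ i ∈ s, ∑ j ∈ s, φ (i * j⁻¹) * a i j * ξ j * η i := by
    rw [inner_matrixOperator, hconv]
    refine Finset.sum_congr rfl fun i _ => ?_
    rw [hconv]
    refine Finset.sum_congr rfl fun j _ => ?_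
    have e1 : ((A.map S) i j : Lp ℂ 2 μ →L[ℂ] Lp ℂ 2 μ) =
        (a (x i) (x j) * φ (x i * (x j)⁻¹)) • leftRegular μ (x i * (x j)⁻¹) := by
      have e0 : (A.map S) i j =
          (a (x i) (x j) * φ (x i * (x j)⁻¹)) • leftRegularVN μ (x i * (x j)⁻¹) := by
        change S (a (x i) (x j) • leftRegularVN μ (x i * (x j)⁻¹)) = _
        rw [map_smul, hS, smul_smul]
      rw [e0]; rfl
    rw [e1]
    simp only [v, w, smul_apply, map_smul, inner_smul_left, inner_smul_right, Complex.conj_conj]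
    rw [leftRegular_mul_apply, inv_mul_cancel_right, inner_self_eq_norm_sq_to_K,
      norm_leftRegular_apply, hf₀]
    simp; ring
  rw [← hin, ← hv, ← hw]
  calc _ ≤ ‖w‖ * ‖matrixOperator (A.map S) v‖ := norm_inner_le_norm _ _
    _ ≤ ‖w‖ * (k * ‖v‖) := by
        gcongr
        exact (ContinuousLinearMap.le_opNorm _ _).trans (by gcongr)
    _ = _ := by ring

theorem herzSchurBound_of_cbMultiplierNorm_le [TopologicalSpace G] {φ : G → ℂ} {k : ℝ}
    (hk : 0 ≤ k) (h : cbMultiplierNorm μ φ ≤ ENNReal.ofReal k) (f₀ : Lp ℂ 2 μ) (hf₀ : ‖f₀‖ = 1) :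
    HerzSchurBound φ k := by
  refine HerzSchurBound.of_tendsto fun ε hε => ?_
  have h1 : cbMultiplierNorm μ φ < ENNReal.ofReal (k + ε) :=
    h.trans_lt ((ENNReal.ofReal_lt_ofReal_iff (by positivity)).2 (by linarith))
  unfold cbMultiplierNorm at h1
  simp only [iInf_lt_iff] at h1
  obtain ⟨hm, S, hS, hlt⟩ := h1
  exact herzSchurBound_of_cbNorm_le (by positivity) (hS.apply_leftRegular hm) hlt.le f₀ hf₀

theorem enorm_le_fourierNorm (u : G → ℂ) (x : G) : ‖u x‖ₑ ≤ fourierNorm μ u := by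
  refine le_iInf₂ fun ω hω => ?_
  rw [hω.2 x, ← ofReal_norm, ← ofReal_norm]
  refine ENNReal.ofReal_le_ofReal ((ω.le_opNorm _).trans ?_)
  refine mul_le_of_le_one_right (norm_nonneg _) ?_
  exact ContinuousLinearMap.opNorm_le_bound _ zero_le_one fun f => by
    rw [one_mul]; exact (norm_leftRegular_apply μ x f).le

/-- The kernel factors as `⟨λ(i j⁻¹) f, g⟩ = ⟨λ(j⁻¹) f, λ(i⁻¹) g⟩`, a Gram kernel of vectors of
constant norms `‖f‖` and `‖g‖`. -/
theorem herzSchurBound_coefficient (f g : Lp ℂ 2 μ) :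
    HerzSchurBound (fun x => inner ℂ g (leftRegular μ x f)) (‖f‖ * ‖g‖) := by
  intro s a ha ξ η
  have key := ha.inner_le zero_le_one (fun j => ξ j • leftRegular μ j⁻¹ f)
    (fun i => (starRingEnd ℂ) (η i) • leftRegular μ i⁻¹ g)
  simp only [norm_smul, norm_leftRegular_apply, inner_smul_left, inner_smul_right,
    Complex.conj_conj, RCLike.norm_conj, mul_pow, ← Finset.sum_mul] at key
  rw [Real.sqrt_mul (by positivity), Real.sqrt_mul (by positivity),
    Real.sqrt_sq (norm_nonneg _), Real.sqrt_sq (norm_nonneg _)] at key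
  have e : ∑ i ∈ s, ∑ j ∈ s, inner ℂ g (leftRegular μ (i * j⁻¹) f) * a i j * ξ j * η i =
      ∑ i ∈ s, ∑ j ∈ s,
        a i j * (ξ j * (η i * inner ℂ (leftRegular μ i⁻¹ g) (leftRegular μ j⁻¹ f))) := by
    refine Finset.sum_congr rfl fun i _ => Finset.sum_congr rfl fun j _ => ?_
    rw [← leftRegular_mul_apply, inner_leftRegular_right]
    ring
  rw [e]
  exact key.trans_eq (by ring)

theorem HerzSchurBound.of_hasSum {Λ ι : Type*} [Group Λ] {φ : Λ → ℂ} {φ' : ι → Λ → ℂ}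
    {K' : ι → ℝ} {K : ℝ} (hφ : ∀ x, HasSum (fun n => φ' n x) (φ x)) (hK : HasSum K' K)
    (h : ∀ n, HerzSchurBound (φ' n) (K' n)) : HerzSchurBound φ K := by
  intro s a ha ξ η
  have h1 : HasSum (fun n => ∑ i ∈ s, ∑ j ∈ s, φ' n (i * j⁻¹) * a i j * ξ j * η i)
      (∑ i ∈ s, ∑ j ∈ s, φ (i * j⁻¹) * a i j * ξ j * η i) :=
    hasSum_sum fun i _ => hasSum_sum fun j _ =>
      (((hφ (i * j⁻¹)).mul_right (a i j)).mul_right (ξ j)).mul_right (η i)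
  exact h1.norm_le_of_bounded (hK.mul_right _) fun n => h n s a ha ξ η

end Necessity

/-! ### Truncation to compact support and restriction to discrete subgroups. -/

section CompactSupport

theorem exists_Lp_norm_eq_one {G : Type*} [Group G] [TopologicalSpace G] [T2Space G]
    [LocallyCompactSpace G] [MeasurableSpace G] [BorelSpace G] (μ : Measure G) [μ.IsHaarMeasure] :
    ∃ f : Lp ℂ 2 μ, ‖f‖ = 1 := by
  obtain ⟨K, hK⟩ := exists_positiveCompacts_subset (isOpen_univ (X := G)) ⟨1, trivial⟩
  have hKm : MeasurableSet (K : Set G) := K.isCompact.isClosed.measurableSet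
  have hfin : μ (K : Set G) ≠ ∞ := K.isCompact.measure_lt_top.ne
  have hpos : 0 < μ.real (K : Set G) :=
    ENNReal.toReal_pos (Measure.measure_pos_of_nonempty_interior μ K.interior_nonempty).ne' hfin
  have hne : (indicatorConstLp 2 hKm hfin (1 : ℂ)) ≠ 0 := by
    rw [← norm_pos_iff, norm_indicatorConstLp (by simp) (by simp)]
    simp only [norm_one, one_mul]
    positivity
  exact ⟨((‖indicatorConstLp 2 hKm hfin (1 : ℂ)‖⁻¹ : ℝ) : ℂ) • indicatorConstLp 2 hKm hfin (1 : ℂ),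
    by
      rw [norm_smul, Complex.norm_real, norm_inv, norm_norm,
        inv_mul_cancel₀ (norm_ne_zero_iff.2 hne)]⟩

/-- `φ` is a limit, in the Herz-Schur norm, of functions with compact support. -/
def IsHerzSchurLimitOfCompactSupport {G : Type*} [Group G] [TopologicalSpace G] (φ : G → ℂ) : Prop :=
  ∀ ε > 0, ∃ φ' : G → ℂ, HerzSchurBound (φ - φ') ε ∧
    ∃ K : Set G, IsCompact K ∧ ∀ x ∉ K, φ' x = 0

theorem IsHerzSchurLimitOfCompactSupport.add {G : Type*} [Group G] [TopologicalSpace G]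
    {φ ψ : G → ℂ}
    (hφ : IsHerzSchurLimitOfCompactSupport φ) (hψ : IsHerzSchurLimitOfCompactSupport ψ) :
    IsHerzSchurLimitOfCompactSupport (φ + ψ) := by
  intro ε hε
  obtain ⟨φ', h1, K, hK, hφ'⟩ := hφ (ε / 2) (by positivity)
  obtain ⟨ψ', h2, L, hL, hψ'⟩ := hψ (ε / 2) (by positivity)
  refine ⟨φ' + ψ', ?_, K ∪ L, hK.union hL, fun x hx => ?_⟩
  · have := h1.add h2
    rwa [add_halves, sub_add_sub_comm] at this
  · simp only [Set.mem_union, not_or] at hx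
    rw [Pi.add_apply, hφ' x hx.1, hψ' x hx.2, add_zero]

variable {G : Type u} [Group G] [TopologicalSpace G] [IsTopologicalGroup G]
  [T2Space G] [LocallyCompactSpace G] [SecondCountableTopology G]
  [MeasurableSpace G] [BorelSpace G] {μ : Measure G} [μ.IsHaarMeasure]

theorem exists_compactSupport_norm_sub_le (f : Lp ℂ 2 μ) {ε : ℝ} (hε : 0 < ε) :
    ∃ (f' : Lp ℂ 2 μ) (K : Set G), ‖f - f'‖ ≤ ε ∧ IsCompact K ∧ ∀ᵐ x ∂μ, x ∉ K → f' x = 0 := by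
  obtain ⟨g, hgc, hg, -, hgm⟩ := (Lp.memLp f).exists_hasCompactSupport_eLpNorm_sub_le
    (by simp) (ε := ENNReal.ofReal ε) (by simpa using hε)
  refine ⟨hgm.toLp g, tsupport g, ?_, hgc, ?_⟩
  · have : f - hgm.toLp g = ((Lp.memLp f).sub hgm).toLp := by
      rw [MemLp.toLp_sub (Lp.memLp f) hgm, Lp.toLp_coeFn]
    rw [this, Lp.norm_toLp]
    exact ENNReal.toReal_le_of_le_ofReal hε.le hg
  · filter_upwards [hgm.coeFn_toLp] with x hx hxK
    rw [hx, image_eq_zero_of_notMem_tsupport hxK]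

theorem isHerzSchurLimitOfCompactSupport_coefficient (f g : Lp ℂ 2 μ) :
    IsHerzSchurLimitOfCompactSupport (fun x => inner ℂ g (leftRegular μ x f)) := by
  intro ε hε
  -- `g'` is fixed first because the tolerance for `f` depends on its norm. The coefficient of `f'`
  -- and `g'` is supported in `K L⁻¹`.
  obtain ⟨g', K, hg', hK, hgK⟩ := exists_compactSupport_norm_sub_le g
    (ε := ε / 2 / (‖f‖ + 1)) (by positivity)
  obtain ⟨f', L, hf', hL, hfL⟩ := exists_compactSupport_norm_sub_le f
    (ε := ε / 2 / (‖g'‖ + 1)) (by positivity)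
  refine ⟨fun x => inner ℂ g' (leftRegular μ x f'), ?_, (fun p : G × G => p.1 * p.2⁻¹) '' K ×ˢ L,
    (hK.prod hL).image (by fun_prop), fun x hx => ?_⟩
  · have h1 := (herzSchurBound_coefficient f (g - g')).add (herzSchurBound_coefficient (f - f') g')
    have e : ((fun x => inner ℂ g (leftRegular μ x f)) - fun x => inner ℂ g' (leftRegular μ x f')) =
        ((fun x => inner ℂ (g - g') (leftRegular μ x f)) +
          fun x => inner ℂ g' (leftRegular μ x (f - f'))) := by
      funext x
      simp only [Pi.sub_apply, Pi.add_apply, map_sub, inner_sub_left, inner_sub_right]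
      ring
    rw [e]
    intro s a ha ξ η
    refine (h1 s a ha ξ η).trans (mul_le_mul_of_nonneg_right ?_ (by positivity))
    have b1 : ‖f‖ * ‖g - g'‖ ≤ ε / 2 := by
      calc _ ≤ (‖f‖ + 1) * (ε / 2 / (‖f‖ + 1)) := by gcongr; linarith
        _ = _ := by field_simp
    have b2 : ‖f - f'‖ * ‖g'‖ ≤ ε / 2 := by
      calc _ ≤ (ε / 2 / (‖g'‖ + 1)) * (‖g'‖ + 1) := by gcongr; linarith
        _ = _ := by field_simp
    linarith
  · change inner ℂ g' (leftRegular μ x f') = 0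
    rw [L2.inner_def]
    refine integral_eq_zero_of_ae ?_
    have hq := (measurePreserving_mul_left μ x⁻¹).quasiMeasurePreserving.ae hfL
    filter_upwards [hgK, leftRegular_coeFn μ x f', hq] with z h1 h2 h3
    rw [h2, Pi.zero_apply]
    by_cases hz : z ∈ K
    · have : x⁻¹ * z ∉ L := fun hL' => hx ⟨(z, x⁻¹ * z), ⟨hz, hL'⟩, by simp⟩
      rw [h3 this, inner_zero_right]
    · rw [h1 hz, inner_zero_left]

/-- A finite partial sum of coefficients is handled term by term, and the tail has Herz-Schur norm
at most `∑ ‖f n‖ ‖g n‖` over the tail. -/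
theorem isHerzSchurLimitOfCompactSupport_of_mem_fourierAlgebra {φ : G → ℂ}
    (hφ : φ ∈ fourierAlgebra μ) : IsHerzSchurLimitOfCompactSupport φ := by
  obtain ⟨ω, ⟨f, g, hf, hg, hω⟩, hφω⟩ := hφ
  have hs := summable_norm_mul_norm hf hg
  have hfin : ∀ N : ℕ, IsHerzSchurLimitOfCompactSupport
      (fun x => ∑ n ∈ Finset.range N, inner ℂ (g n) (leftRegular μ x (f n))) := by
    intro N
    induction N with
    | zero => exact fun ε hε => ⟨0, fun s a ha ξ η => by simp; positivity, ∅, isCompact_empty,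
        fun x _ => rfl⟩
    | succ N ih =>
      simp only [Finset.sum_range_succ]
      exact ih.add (isHerzSchurLimitOfCompactSupport_coefficient (f N) (g N))
  intro ε hε
  have htail := tendsto_sum_nat_add (fun n => ‖f n‖ * ‖g n‖)
  obtain ⟨N, hN⟩ := (htail.eventually (gt_mem_nhds (show (0 : ℝ) < ε / 2 by positivity))).exists
  obtain ⟨φ', h1, hK⟩ := hfin N (ε / 2) (by positivity)
  refine ⟨φ', ?_, hK⟩
  have h2 : HerzSchurBound (fun x => φ x -
      ∑ n ∈ Finset.range N, inner ℂ (g n) (leftRegular μ x (f n)))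
      (∑' n, ‖f (n + N)‖ * ‖g (n + N)‖) := by
    refine HerzSchurBound.of_hasSum
      (φ' := fun n x => inner ℂ (g (n + N)) (leftRegular μ x (f (n + N)))) (fun x => ?_)
      ((summable_nat_add_iff N).2 hs).hasSum fun n => herzSchurBound_coefficient _ _
    rw [hφω x]
    exact (hasSum_nat_add_iff' N).2 (hω (leftRegularVN μ x))
  have h3 := h2.add h1
  intro s a ha ξ η
  have h4 := h3 s a ha ξ η
  simp only [Pi.add_apply, Pi.sub_apply, sub_add_sub_cancel] at h4
  exact h4.trans (mul_le_mul_of_nonneg_right (by linarith) (by positivity))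

/-- Approximate units of `A(G)` restrict to Herz-Schur approximations on discrete subgroups. -/
theorem HasCBApproximateUnit.hasFiniteHerzSchurApproximation {k : ℝ} (hk : 1 ≤ k)
    (h : HasCBApproximateUnit μ k) (Γ : Subgroup G) (hcl : IsClosed (Γ : Set G))
    [DiscreteTopology Γ] : HasFiniteHerzSchurApproximation Γ k := by
  obtain ⟨ι, _, _, _, φ, hA, hlim, hcb⟩ := h
  obtain ⟨f₀, hf₀⟩ := exists_Lp_norm_eq_one μ
  intro F ε hε
  have hpt : ∀ x : G, Tendsto (fun α => φ α x) atTop (𝓝 1) := by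
    intro x
    -- An element of `A(G)` with value 1 at `x`; since the norm of `A(G)` dominates point values,
    -- convergence on `ψ` forces `φ α x → 1`.
    let ψ : G → ℂ := fun y => vectorFunctional f₀ (leftRegular μ x f₀) (leftRegularVN μ y)
    have hψ : ψ ∈ fourierAlgebra μ := ⟨_, isNormalFunctional_vectorFunctional _ _, fun _ => rfl⟩
    have hψx : ψ x = 1 := by
      change inner ℂ (leftRegular μ x f₀) (leftRegular μ x f₀) = 1
      rw [inner_leftRegular_leftRegular, inner_self_eq_norm_sq_to_K, hf₀]; simp
    rw [tendsto_iff_norm_sub_tendsto_zero]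
    have h1 : Tendsto (fun α => ‖φ α x - 1‖ₑ) atTop (𝓝 0) := by
      refine tendsto_of_tendsto_of_tendsto_of_le_of_le tendsto_const_nhds (hlim ψ hψ)
        (fun _ => zero_le) fun α => ?_
      have := enorm_le_fourierNorm (μ := μ) (φ α * ψ - ψ) x
      rwa [Pi.sub_apply, Pi.mul_apply, hψx, mul_one] at this
    have h2 := (ENNReal.tendsto_toReal ENNReal.zero_ne_top).comp h1
    simpa [Function.comp_def] using h2
  have hk0 : 0 < k := by linarith
  -- Three errors of size `δ` arise: distance of `φ α` to 1, truncation, and rescaling by `k / (k +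
  -- δ)`.
  set δ := ε / 4 with hδ
  have hδ0 : 0 < δ := by positivity
  have hev : ∀ᶠ α in atTop, ∀ x ∈ F, ‖φ α (x : G) - 1‖ < δ := by
    rw [Filter.eventually_all_finset]
    intro x _
    have := (hpt x).eventually (Metric.ball_mem_nhds 1 hδ0)
    simpa [dist_eq_norm] using this
  obtain ⟨α, hα⟩ := hev.exists
  obtain ⟨φ', hφ', K, hK, hφK⟩ := isHerzSchurLimitOfCompactSupport_of_mem_fourierAlgebra (hA α) δ hδ0
  have hb := herzSchurBound_of_cbMultiplierNorm_le hk0.le (hcb α) f₀ hf₀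
  have hb' : HerzSchurBound φ' (k + δ) := by
    have := hb.add (hφ'.const_mul (-1))
    simp only [norm_neg, norm_one, one_mul] at this
    convert this using 1
    funext x; simp
  have hc := (hb'.comp Γ.subtype Γ.subtype_injective).const_mul ((k / (k + δ) : ℝ) : ℂ)
  have hnorm : ‖((k / (k + δ) : ℝ) : ℂ)‖ = k / (k + δ) := by
    rw [Complex.norm_real, Real.norm_of_nonneg (by positivity)]
  rw [hnorm, div_mul_cancel₀ _ (by positivity)] at hc
  refine ⟨_, ?_, hc, fun x hx => ?_⟩
  · have hcomp : IsCompact ((↑) ⁻¹' K : Set Γ) :=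
      (hcl.isClosedEmbedding_subtypeVal).isCompact_preimage hK
    refine hcomp.finite_of_discrete.subset fun x hx => ?_
    by_contra hxK
    exact hx (by simp [hφK x hxK])
  · have h1 : ‖φ' (x : G) - 1‖ ≤ 2 * δ := by
      have e : φ' (x : G) - 1 = (φ α x - 1) - (φ α - φ') x := by simp
      rw [e]
      exact (norm_sub_le _ _).trans (by linarith [hα x hx, hφ'.norm_le (x : G)])
    have e : ((k / (k + δ) : ℝ) : ℂ) * (φ' ∘ Γ.subtype) x - 1 =
        ((k / (k + δ) : ℝ) : ℂ) * (φ' x - 1) - ((δ / (k + δ) : ℝ) : ℂ) := by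
      have h2 : ((δ / (k + δ) : ℝ) : ℂ) = 1 - ((k / (k + δ) : ℝ) : ℂ) := by
        rw [← Complex.ofReal_one, ← Complex.ofReal_sub]
        congr 1
        field_simp; ring
      rw [h2]; simp; ring
    rw [e]
    have h3 : ‖((δ / (k + δ) : ℝ) : ℂ)‖ ≤ δ := by
      rw [Complex.norm_real, Real.norm_of_nonneg (by positivity)]
      exact div_le_self hδ0.le (by linarith)
    have h4 : k / (k + δ) ≤ 1 := (div_le_one (by positivity)).2 (by linarith)
    calc _ ≤ ‖((k / (k + δ) : ℝ) : ℂ) * (φ' x - 1)‖ + ‖((δ / (k + δ) : ℝ) : ℂ)‖ := norm_sub_le _ _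
      _ ≤ 1 * (2 * δ) + δ := by
          rw [norm_mul, hnorm]
          gcongr
      _ < ε := by rw [hδ]; linarith

end CompactSupport

/-! ### Separable Hilbert spaces. -/

section HilbertBases

/-- Distinct orthonormal vectors are at distance `√2`, so the balls of radius `1/2` around them are
disjoint open sets in a second countable space. -/
theorem exists_countable_hilbertBasis (E : Type*) [NormedAddCommGroup E] [InnerProductSpace ℂ E]
    [CompleteSpace E] [SecondCountableTopology E] :
    ∃ w : Set E, Countable w ∧ Nonempty (HilbertBasis w ℂ E) := by
  obtain ⟨w, b, hb⟩ := exists_hilbertBasis ℂ E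
  refine ⟨w, ?_, ⟨b⟩⟩
  have ho := b.orthonormal
  have hd : ∀ i j : w, i ≠ j → √2 ≤ dist (b i) (b j) := by
    intro i j hij
    have h1 : ‖b i - b j‖ ^ 2 = 2 := by
      rw [@norm_sub_sq ℂ, ho.1 i, ho.1 j, ho.2 hij]; norm_num
    rw [dist_eq_norm, ← h1, Real.sqrt_sq (norm_nonneg _)]
  have hdisj : (Set.univ : Set w).PairwiseDisjoint (fun i => Metric.ball (b i) (1 / 2)) := by
    intro i _ j _ hij
    refine Metric.ball_disjoint_ball ?_
    have := hd i j hij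
    have h2 : (1 : ℝ) ≤ √2 := Real.one_le_sqrt.2 (by norm_num)
    linarith
  have hc := hdisj.countable_of_isOpen (fun i _ => Metric.isOpen_ball)
    (fun i _ => ⟨b i, Metric.mem_ball_self (by norm_num)⟩)
  exact Set.countable_univ_iff.1 hc

variable {E : Type*} [NormedAddCommGroup E] [InnerProductSpace ℂ E]

theorem HilbertBasis.tsum_enorm_inner_sq {ι : Type*} (b : HilbertBasis ι ℂ E) (x : E) :
    ∑' i, ‖inner ℂ (b i) x‖ₑ ^ 2 = ‖x‖ₑ ^ 2 := by
  have h1 : HasSum (fun i => ‖inner ℂ (b i) x‖ ^ 2) (‖x‖ ^ 2) := by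
    have := lp.norm_sq_eq_tsum (b.repr x)
    simpa only [b.repr_apply_apply, LinearIsometryEquiv.norm_map] using this
  have h2 := ENNReal.ofReal_tsum_of_nonneg (fun i => by positivity) h1.summable
  rw [h1.tsum_eq] at h2
  simpa only [ENNReal.ofReal_pow (norm_nonneg _), ofReal_norm] using h2.symm

/-- In a separable Hilbert space, weak measurability implies strong measurability. -/
theorem stronglyMeasurable_of_inner [CompleteSpace E] [SecondCountableTopology E]
    {X : Type*} [MeasurableSpace X]
    {u : X → E} (h : ∀ v : E, StronglyMeasurable fun q => inner ℂ v (u q)) :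
    StronglyMeasurable u := by
  obtain ⟨w, hw, ⟨b⟩⟩ := exists_countable_hilbertBasis E
  refine stronglyMeasurable_of_tendsto (atTop : Filter (Finset w))
    (f := fun s q => ∑ i ∈ s, inner ℂ (b i) (u q) • b i) (fun s => ?_) ?_
  · exact Finset.stronglyMeasurable_fun_sum s fun i _ => (h (b i)).smul_const (b i)
  · rw [tendsto_pi_nhds]
    intro q
    have := b.hasSum_repr (u q)
    simp only [b.repr_apply_apply] at this
    exact this

end HilbertBases

/-! ### Vector-valued `L²` as a Hilbert sum. -/

section VectorValued

theorem Lp.enorm_sq_eq_lintegral {X E : Type*} [MeasurableSpace X] {ν : Measure X}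
    [NormedAddCommGroup E] (F : Lp E 2 ν) : ‖F‖ₑ ^ 2 = ∫⁻ q, ‖F q‖ₑ ^ 2 ∂ν := by
  have := eLpNorm_nnreal_pow_eq_lintegral (f := F) (μ := ν) (p := 2) (by norm_num)
  rw [Lp.enorm_def]
  simpa using this

variable {X : Type*} [MeasurableSpace X] {ν : Measure X}
  {H : Type*} [NormedAddCommGroup H] [InnerProductSpace ℂ H]

/-- The map `h ↦ c ⊗ h` from `H` to `L²(ν; H)`. -/
def tensorLp (c : Lp ℂ 2 ν) : H →L[ℂ] Lp H 2 ν :=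
  LinearMap.mkContinuous
    { toFun := fun h => (ContinuousLinearMap.toSpanSingleton ℂ h).compLpL 2 ν c
      map_add' := fun h h' => by
        rw [ContinuousLinearMap.toSpanSingleton_add, ContinuousLinearMap.add_compLpL]; rfl
      map_smul' := fun a h => by
        rw [ContinuousLinearMap.toSpanSingleton_smul, ContinuousLinearMap.smul_compLpL]; rfl }
    ‖c‖ (fun h => by
      refine (ContinuousLinearMap.norm_compLp_le _ _).trans ?_
      rw [ContinuousLinearMap.norm_toSpanSingleton, mul_comm])

theorem tensorLp_coeFn (c : Lp ℂ 2 ν) (h : H) : tensorLp c h =ᵐ[ν] fun q => c q • h :=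
  ContinuousLinearMap.coeFn_compLp _ _

theorem inner_tensorLp (c : Lp ℂ 2 ν) (h : H) (F : Lp H 2 ν) :
    inner ℂ (tensorLp c h) F = inner ℂ c ((innerSL ℂ h).compLpL 2 ν F) := by
  rw [L2.inner_def, L2.inner_def]
  refine integral_congr_ae ?_
  filter_upwards [tensorLp_coeFn c h, (innerSL ℂ h).coeFn_compLpL F] with q h1 h2
  rw [h1, h2, inner_smul_left, innerSL_apply_apply]
  simp [mul_comm]

variable [CompleteSpace H]

theorem adjoint_tensorLp_compLpL (c : Lp ℂ 2 ν) (T : H →L[ℂ] H) (F : Lp H 2 ν) :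
    (tensorLp c).adjoint (T.compLpL 2 ν F) = T ((tensorLp c).adjoint F) := by
  refine ext_inner_left ℂ fun h => ?_
  rw [ContinuousLinearMap.adjoint_inner_right, ← T.adjoint_inner_left _ h,
    ContinuousLinearMap.adjoint_inner_right, inner_tensorLp, inner_tensorLp]
  congr 1
  refine Lp.ext ?_
  filter_upwards [(innerSL ℂ h).coeFn_compLpL (T.compLpL 2 ν F), T.coeFn_compLpL F,
    (innerSL ℂ (T.adjoint h)).coeFn_compLpL F] with q h1 h2 h3
  rw [h1, h2, h3, innerSL_apply_apply, innerSL_apply_apply, ContinuousLinearMap.adjoint_inner_left]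

/-- Parseval is used three times: in `H` for each coefficient, in `L²(ν)` after exchanging the two
sums, and in `H` again under the integral. In `ℝ≥0∞` the exchanges require no summability. -/
theorem tsum_enorm_adjoint_tensorLp_sq [SecondCountableTopology H] {ι : Type*}
    (b : HilbertBasis ι ℂ (Lp ℂ 2 ν)) (F : Lp H 2 ν) :
    ∑' m, ‖(tensorLp (H := H) (b m)).adjoint F‖ₑ ^ 2 = ‖F‖ₑ ^ 2 := by
  obtain ⟨w, hw, ⟨e⟩⟩ := exists_countable_hilbertBasis H
  have h1 : ∀ m, ‖(tensorLp (H := H) (b m)).adjoint F‖ₑ ^ 2 =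
      ∑' j, ‖inner ℂ (b m) ((innerSL ℂ (e j)).compLpL 2 ν F)‖ₑ ^ 2 := by
    intro m
    rw [← e.tsum_enorm_inner_sq]
    refine tsum_congr fun j => ?_
    rw [ContinuousLinearMap.adjoint_inner_right, inner_tensorLp]
  simp only [h1]
  rw [ENNReal.tsum_comm]
  simp only [b.tsum_enorm_inner_sq, Lp.enorm_sq_eq_lintegral]
  rw [← lintegral_tsum]
  · refine lintegral_congr_ae ?_
    have h2 : ∀ᵐ q ∂ν, ∀ j : w, (innerSL ℂ (e j)).compLpL 2 ν F q = inner ℂ (e j) (F q) := by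
      rw [ae_all_iff]
      exact fun j => (innerSL ℂ (e j)).coeFn_compLpL F
    filter_upwards [h2] with q hq
    simp only [hq, e.tsum_enorm_inner_sq]
  · exact fun j => ((Lp.stronglyMeasurable _).enorm.pow_const 2).aemeasurable

theorem hasSum_norm_adjoint_tensorLp_sq [SecondCountableTopology H] {ι : Type*}
    (b : HilbertBasis ι ℂ (Lp ℂ 2 ν)) (F : Lp H 2 ν) :
    HasSum (fun m => ‖(tensorLp (H := H) (b m)).adjoint F‖ ^ 2) (‖F‖ ^ 2) := by
  have h := tsum_enorm_adjoint_tensorLp_sq b F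
  have h2 := ENNReal.hasSum_toReal (f := fun m => ‖(tensorLp (H := H) (b m)).adjoint F‖ₑ ^ 2)
    (by rw [h]; simp)
  rw [← ENNReal.tsum_toReal_eq (fun m => by simp), h] at h2
  simpa using h2

/-- The coefficients of `F ∈ L²(ν; H)` along a Hilbert basis of `L²(ν)`. -/
def coefficientsLp [SecondCountableTopology H] {ι : Type*} (b : HilbertBasis ι ℂ (Lp ℂ 2 ν))
    (F : Lp H 2 ν) : lp (fun _ : ι => H) 2 :=
  Subtype.mk (p := fun f => f ∈ lp (fun _ : ι => H) 2)
    ((fun m => (tensorLp (H := H) (b m)).adjoint F : ι → H))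
    (memℓp_two_of_summable (hasSum_norm_adjoint_tensorLp_sq b F).summable)

theorem coefficientsLp_apply [SecondCountableTopology H] {ι : Type*}
    (b : HilbertBasis ι ℂ (Lp ℂ 2 ν)) (F : Lp H 2 ν) (m : ι) :
    coefficientsLp b F m = (tensorLp (H := H) (b m)).adjoint F := rfl

/-- Expansion of `L²(ν; H)` along a Hilbert basis of `L²(ν)`. -/
def expandLp [SecondCountableTopology H] {ι : Type*} (b : HilbertBasis ι ℂ (Lp ℂ 2 ν)) :
    Lp H 2 ν →ₗᵢ[ℂ] lp (fun _ : ι => H) 2 where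
  toFun := coefficientsLp b
  map_add' F F' := by
    refine lp.ext (funext fun m => ?_)
    rw [lp.coeFn_add, Pi.add_apply, coefficientsLp_apply, coefficientsLp_apply,
      coefficientsLp_apply, map_add]
  map_smul' c F := by
    refine lp.ext (funext fun m => ?_)
    rw [RingHom.id_apply, lp.coeFn_smul, Pi.smul_apply, coefficientsLp_apply,
      coefficientsLp_apply, map_smul]
  norm_map' F := by
    rw [← sq_eq_sq₀ (norm_nonneg _) (norm_nonneg _)]
    exact (lp.norm_sq_eq_tsum (coefficientsLp b F)).unique (hasSum_norm_adjoint_tensorLp_sq b F)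

theorem expandLp_compLpL [SecondCountableTopology H] {ι : Type*}
    (b : HilbertBasis ι ℂ (Lp ℂ 2 ν)) (T : H →L[ℂ] H) (F : Lp H 2 ν) :
    expandLp b (T.compLpL 2 ν F) = diagOp ι T (expandLp b F) :=
  lp.ext (funext fun m => adjoint_tensorLp_compLpL (b m) T F)

theorem inner_expandLp_diagOp [SecondCountableTopology H] {ι : Type*}
    (b : HilbertBasis ι ℂ (Lp ℂ 2 ν)) (T : H →L[ℂ] H) (F F' : Lp H 2 ν) :
    inner ℂ (expandLp b F') (diagOp ι T (expandLp b F)) = inner ℂ F' (T.compLpL 2 ν F) := by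
  rw [← expandLp_compLpL, LinearIsometry.inner_map_map]

end VectorValued

/-! ### Restriction to measurable sets. -/

section Restriction

variable {X : Type*} [MeasurableSpace X] {ν : Measure X}

/-- Multiplication by the indicator function of `s` on `L²(ν)`. -/
def restrictLp (ν : Measure X) {s : Set X} (hs : MeasurableSet s) : Lp ℂ 2 ν →L[ℂ] Lp ℂ 2 ν :=
  LinearMap.mkContinuous
    { toFun := fun f => ((Lp.memLp f).indicator hs).toLp
      map_add' := fun f g => by
        rw [← MemLp.toLp_add]
        refine MemLp.toLp_congr _ _ ?_
        filter_upwards [Lp.coeFn_add f g] with x hx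
        by_cases h : x ∈ s
        · simpa [h] using hx
        · simp [h]
      map_smul' := fun c f => by
        rw [RingHom.id_apply, ← MemLp.toLp_const_smul]
        refine MemLp.toLp_congr _ _ ?_
        filter_upwards [Lp.coeFn_smul c f] with x hx
        by_cases h : x ∈ s
        · simpa [h] using hx
        · simp [h] } 1 (fun f => by
      rw [one_mul]
      refine Lp.norm_le_norm_of_ae_le ?_
      filter_upwards [((Lp.memLp f).indicator hs).coeFn_toLp] with x hx
      refine (congrArg norm hx).trans_le ?_
      exact norm_indicator_le_norm_self _ _)

theorem restrictLp_congr {s t : Set X} (h : s = t) (hs : MeasurableSet s) (ht : MeasurableSet t) :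
    restrictLp ν hs = restrictLp ν ht := by
  subst h; rfl

theorem restrictLp_coeFn {s : Set X} (hs : MeasurableSet s) (f : Lp ℂ 2 ν) :
    restrictLp ν hs f =ᵐ[ν] s.indicator f :=
  ((Lp.memLp f).indicator hs).coeFn_toLp

theorem inner_restrictLp_of_disjoint {s t : Set X} (hs : MeasurableSet s) (ht : MeasurableSet t)
    (h : Disjoint s t) (f g : Lp ℂ 2 ν) :
    inner ℂ (restrictLp ν hs f) (restrictLp ν ht g) = 0 := by
  rw [L2.inner_def]
  refine integral_eq_zero_of_ae ?_
  filter_upwards [restrictLp_coeFn hs f, restrictLp_coeFn ht g] with x h1 h2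
  rw [h1, h2]
  by_cases hx : x ∈ s
  · simp [Set.disjoint_left.1 h hx]
  · simp [hx]

theorem inner_restrictLp_self {s : Set X} (hs : MeasurableSet s) (f : Lp ℂ 2 ν) :
    inner ℂ (restrictLp ν hs f) f = (‖restrictLp ν hs f‖ ^ 2 : ℝ) := by
  have : ((‖restrictLp ν hs f‖ ^ 2 : ℝ) : ℂ) = inner ℂ (restrictLp ν hs f) (restrictLp ν hs f) := by
    rw [inner_self_eq_norm_sq_to_K]; simp
  rw [this, L2.inner_def, L2.inner_def]
  refine integral_congr_ae ?_
  filter_upwards [restrictLp_coeFn hs f] with x h1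
  rw [h1]
  by_cases hx : x ∈ s <;> simp [hx]

end Restriction

/-! ### Fields of translated restrictions and the multiplier `x ↦ μ(E' ∩ xE)`. -/

section TranslationFields

variable {G : Type u} [Group G] [TopologicalSpace G] [IsTopologicalGroup G]
  [SecondCountableTopology G] [MeasurableSpace G] [BorelSpace G]

/-- The shear `(z, q) ↦ (z, zq)` preserves `μ × μ` by left invariance and separates the variables;
no modular function enters. -/
theorem integral_integral_indicator_mul (μ : Measure G) [μ.IsMulLeftInvariant] [SFinite μ]
    {A : Set G} (hA : MeasurableSet A) (hfin : μ A ≠ ∞) {w : G → ℂ} (hw : Integrable w μ) :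
    ∫ q, ∫ z, ((fun z => z * q) ⁻¹' A).indicator w z ∂μ ∂μ = (μ.real A : ℂ) * ∫ z, w z ∂μ := by
  have hA1 : Integrable (A.indicator (fun _ => (1 : ℂ))) μ :=
    (integrable_indicator_iff hA).2 (integrableOn_const hfin)
  have hprod : Integrable (fun p : G × G => w p.1 * A.indicator (fun _ => (1 : ℂ)) p.2)
      (μ.prod μ) := hw.mul_prod hA1
  have hshear := measurePreserving_prod_mul μ μ
  have e : ∀ p : G × G, ((fun z => z * p.2) ⁻¹' A).indicator w p.1 =
      w p.1 * A.indicator (fun _ => (1 : ℂ)) (p.1 * p.2) := by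
    intro p
    by_cases h : p.1 * p.2 ∈ A <;> simp [Set.indicator, h]
  have hint : Integrable (fun p : G × G => ((fun z => z * p.2) ⁻¹' A).indicator w p.1)
      (μ.prod μ) := by
    simp only [e]
    exact hshear.integrable_comp_of_integrable hprod
  rw [← integral_prod_symm _ hint]
  simp only [e]
  rw [hshear.integral_comp (MeasurableEquiv.shearMulRight G).measurableEmbedding
    (fun p : G × G => w p.1 * A.indicator (fun _ => (1 : ℂ)) p.2),
    integral_prod_mul w (A.indicator fun _ => (1 : ℂ)), integral_indicator hA]
  simp [mul_comm]

theorem lintegral_lintegral_indicator_mul (μ : Measure G) [μ.IsMulLeftInvariant] [SFinite μ]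
    {A : Set G} (hA : MeasurableSet A) {w : G → ℝ≥0∞} (hw : Measurable w) :
    ∫⁻ q, ∫⁻ z, ((fun z => z * q) ⁻¹' A).indicator w z ∂μ ∂μ = μ A * ∫⁻ z, w z ∂μ := by
  have e : ∀ z q : G, ((fun z => z * q) ⁻¹' A).indicator w z =
      w z * A.indicator (fun _ => (1 : ℝ≥0∞)) (z * q) := by
    intro z q
    by_cases h : z * q ∈ A <;> simp [Set.indicator, h]
  simp only [e]
  have hA1 : Measurable (A.indicator (fun _ => (1 : ℝ≥0∞))) := measurable_one.indicator hA
  rw [lintegral_lintegral_swap]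
  · have : ∀ z, ∫⁻ q, w z * A.indicator (fun _ => (1 : ℝ≥0∞)) (z * q) ∂μ = w z * μ A := by
      intro z
      rw [lintegral_const_mul (w z)
          (show Measurable fun q => A.indicator (fun _ => (1 : ℝ≥0∞)) (z * q) from
            hA1.comp (measurable_const_mul z)),
        lintegral_mul_left_eq_self (fun q => A.indicator (fun _ => (1 : ℝ≥0∞)) q) z,
        lintegral_indicator hA]
      simp
    simp only [this]
    rw [lintegral_mul_const _ hw, mul_comm]
  · refine Measurable.aemeasurable ?_
    exact (hw.comp measurable_snd).mul (hA1.comp (measurable_snd.mul measurable_fst))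

/-- The vector field `q ↦ χ(E q⁻¹) ξ` in `L²(G, μ)`. -/
def translateField (μ : Measure G) {E : Set G} (hE : MeasurableSet E) (ξ : Lp ℂ 2 μ) (q : G) :
    Lp ℂ 2 μ :=
  restrictLp μ (hE.preimage (measurable_mul_const q)) ξ

theorem translateField_coeFn (μ : Measure G) {E : Set G} (hE : MeasurableSet E) (ξ : Lp ℂ 2 μ)
    (q : G) : translateField μ hE ξ q =ᵐ[μ] ((fun z => z * q) ⁻¹' E).indicator ξ :=
  restrictLp_coeFn _ _

variable {μ : Measure G} [SigmaFinite μ]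

theorem stronglyMeasurable_translateField {E : Set G} (hE : MeasurableSet E)
    (ξ : Lp ℂ 2 μ) : StronglyMeasurable (translateField μ hE ξ) := by
  -- Makes separability of `L²(G)` available, on which passing from weak to strong measurability
  -- depends.
  have : Fact ((2 : ℝ≥0∞) ≠ ∞) := ⟨by simp⟩
  refine stronglyMeasurable_of_inner fun v => ?_
  have e : ∀ q, inner ℂ v (translateField μ hE ξ q) =
      ∫ z, E.indicator (fun _ => (1 : ℂ)) (z * q) * inner ℂ (v z) (ξ z) ∂μ := by
    intro q
    rw [L2.inner_def]
    refine integral_congr_ae ?_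
    filter_upwards [translateField_coeFn μ hE ξ q] with z hz
    rw [hz]
    by_cases h : z * q ∈ E <;> simp [Set.indicator, h]
  simp only [e]
  refine StronglyMeasurable.integral_prod_right'
    (f := fun p : G × G => E.indicator (fun _ => (1 : ℂ)) (p.2 * p.1) * inner ℂ (v p.2) (ξ p.2)) ?_
  refine StronglyMeasurable.mul ?_ ?_
  · exact ((stronglyMeasurable_const.indicator hE).comp_measurable
      (measurable_snd.mul measurable_fst))
  · exact ((Lp.stronglyMeasurable v).comp_measurable measurable_snd).inner
      ((Lp.stronglyMeasurable ξ).comp_measurable measurable_snd)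

theorem lintegral_enorm_translateField_sq [μ.IsMulLeftInvariant] {E : Set G}
    (hE : MeasurableSet E) (ξ : Lp ℂ 2 μ) :
    ∫⁻ q, ‖translateField μ hE ξ q‖ₑ ^ 2 ∂μ = μ E * ‖ξ‖ₑ ^ 2 := by
  rw [Lp.enorm_sq_eq_lintegral ξ, ← lintegral_lintegral_indicator_mul μ hE
    ((Lp.stronglyMeasurable ξ).enorm.pow_const 2)]
  refine lintegral_congr fun q => ?_
  rw [Lp.enorm_sq_eq_lintegral]
  refine lintegral_congr_ae ?_
  filter_upwards [translateField_coeFn μ hE ξ q] with z hz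
  rw [hz]
  by_cases h : z * q ∈ E <;> simp [Set.indicator, h]

theorem eLpNorm_translateField [μ.IsMulLeftInvariant] {E : Set G}
    (hE : MeasurableSet E) (ξ : Lp ℂ 2 μ) :
    eLpNorm (translateField μ hE ξ) 2 μ ^ 2 = μ E * ‖ξ‖ₑ ^ 2 := by
  have := eLpNorm_nnreal_pow_eq_lintegral (f := translateField μ hE ξ) (μ := μ) (p := 2)
    (by norm_num)
  rw [← lintegral_enorm_translateField_sq hE]
  simpa using this

theorem memLp_translateField [μ.IsMulLeftInvariant] {E : Set G} (hE : MeasurableSet E)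
    (hfin : μ E ≠ ∞) (ξ : Lp ℂ 2 μ) : MemLp (translateField μ hE ξ) 2 μ := by
  refine ⟨(stronglyMeasurable_translateField hE ξ).aestronglyMeasurable, ?_⟩
  have h := eLpNorm_translateField hE ξ
  by_contra htop
  rw [not_lt, top_le_iff] at htop
  rw [htop] at h
  have : μ E * ‖ξ‖ₑ ^ 2 ≠ ∞ := ENNReal.mul_ne_top hfin (by simp)
  exact this (by rw [← h]; simp)

/-- The operator `ξ ↦ (q ↦ χ(E q⁻¹) ξ)` from `L²(G)` to `L²(G; L²(G))`. -/
def translateLp (μ : Measure G) [SigmaFinite μ] [μ.IsMulLeftInvariant] {E : Set G}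
    (hE : MeasurableSet E) (hfin : μ E ≠ ∞) : Lp ℂ 2 μ →L[ℂ] Lp (Lp ℂ 2 μ) 2 μ :=
  LinearMap.mkContinuous
    { toFun := fun ξ => (memLp_translateField hE hfin ξ).toLp
      map_add' := fun ξ ξ' => by
        rw [← MemLp.toLp_add]
        exact MemLp.toLp_congr _ _ (Eventually.of_forall fun q => map_add _ ξ ξ')
      map_smul' := fun c ξ => by
        rw [RingHom.id_apply, ← MemLp.toLp_const_smul]
        exact MemLp.toLp_congr _ _ (Eventually.of_forall fun q => map_smul _ c ξ) }
    √(μ.real E) (fun ξ => by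
      change ‖(memLp_translateField hE hfin ξ).toLp‖ ≤ _
      refine le_of_sq_le_sq ?_ (by positivity)
      rw [Lp.norm_toLp, ← ENNReal.toReal_pow, eLpNorm_translateField, mul_pow,
        Real.sq_sqrt measureReal_nonneg, ENNReal.toReal_mul, ENNReal.toReal_pow, toReal_enorm]
      rfl)

theorem translateLp_coeFn [μ.IsMulLeftInvariant] {E : Set G}
    (hE : MeasurableSet E) (hfin : μ E ≠ ∞) (ξ : Lp ℂ 2 μ) :
    translateLp μ hE hfin ξ =ᵐ[μ] translateField μ hE ξ :=
  (memLp_translateField hE hfin ξ).coeFn_toLp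

theorem ae_inner_translateLp [μ.IsMulLeftInvariant] {E E' : Set G}
    (hE : MeasurableSet E) (hfin : μ E ≠ ∞) (hE' : MeasurableSet E') (hfin' : μ E' ≠ ∞)
    (T : Lp ℂ 2 μ →L[ℂ] Lp ℂ 2 μ) (ξ η : Lp ℂ 2 μ) :
    (fun q => inner ℂ (translateLp μ hE' hfin' η q) (T.compLpL 2 μ (translateLp μ hE hfin ξ) q))
      =ᵐ[μ] fun q => inner ℂ (translateField μ hE' η q) (T (translateField μ hE ξ q)) := by
  filter_upwards [translateLp_coeFn hE' hfin' η, translateLp_coeFn hE hfin ξ,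
    T.coeFn_compLpL (translateLp μ hE hfin ξ)] with q h1 h2 h3
  rw [h1, h3, h2]

theorem integrable_inner_translateField [μ.IsMulLeftInvariant] {E E' : Set G}
    (hE : MeasurableSet E) (hfin : μ E ≠ ∞) (hE' : MeasurableSet E') (hfin' : μ E' ≠ ∞)
    (T : Lp ℂ 2 μ →L[ℂ] Lp ℂ 2 μ) (ξ η : Lp ℂ 2 μ) :
    Integrable (fun q => inner ℂ (translateField μ hE' η q) (T (translateField μ hE ξ q))) μ :=
  (L2.integrable_inner (𝕜 := ℂ) (translateLp μ hE' hfin' η)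
    (T.compLpL 2 μ (translateLp μ hE hfin ξ))).congr
    (ae_inner_translateLp hE hfin hE' hfin' T ξ η)

theorem inner_translateLp [μ.IsMulLeftInvariant] {E E' : Set G}
    (hE : MeasurableSet E) (hfin : μ E ≠ ∞) (hE' : MeasurableSet E') (hfin' : μ E' ≠ ∞)
    (T : Lp ℂ 2 μ →L[ℂ] Lp ℂ 2 μ) (ξ η : Lp ℂ 2 μ) :
    inner ℂ (translateLp μ hE' hfin' η) (T.compLpL 2 μ (translateLp μ hE hfin ξ)) =
      ∫ q, inner ℂ (translateField μ hE' η q) (T (translateField μ hE ξ q)) ∂μ := by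
  rw [L2.inner_def]
  exact integral_congr_ae (ae_inner_translateLp hE hfin hE' hfin' T ξ η)

/-- For fixed `q`, the integrand in `z` is that of `⟨λ(x) ξ, η⟩` cut down to `zq ∈ E' ∩ xE`;
integrating over `q` first gives the factor `μ(E' ∩ xE)` for every `z`. -/
theorem integral_inner_translateField_leftRegular [μ.IsMulLeftInvariant] {E E' : Set G}
    (hE : MeasurableSet E) (hE' : MeasurableSet E') (hfin' : μ E' ≠ ∞)
    (x : G) (ξ η : Lp ℂ 2 μ) :
    ∫ q, inner ℂ (translateField μ hE' η q) (leftRegular μ x (translateField μ hE ξ q)) ∂μ =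
      (μ.real (E' ∩ (fun z => x⁻¹ * z) ⁻¹' E) : ℂ) * inner ℂ η (leftRegular μ x ξ) := by
  have hA : MeasurableSet (E' ∩ (fun z => x⁻¹ * z) ⁻¹' E) :=
    hE'.inter (hE.preimage (measurable_const_mul _))
  have hAfin : μ (E' ∩ (fun z => x⁻¹ * z) ⁻¹' E) ≠ ∞ :=
    measure_ne_top_of_subset Set.inter_subset_left hfin'
  have hw : Integrable (fun z => inner ℂ (η z) (leftRegular μ x ξ z)) μ :=
    L2.integrable_inner η (leftRegular μ x ξ)
  rw [L2.inner_def, ← integral_integral_indicator_mul μ hA hAfin hw]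
  refine integral_congr_ae (Eventually.of_forall fun q => ?_)
  beta_reduce
  rw [L2.inner_def]
  refine integral_congr_ae ?_
  have hq := (measurePreserving_mul_left μ x⁻¹).quasiMeasurePreserving.ae_eq_comp
    (translateField_coeFn μ hE ξ q)
  filter_upwards [translateField_coeFn μ hE' η q, leftRegular_coeFn μ x (translateField μ hE ξ q),
    hq, leftRegular_coeFn μ x ξ] with z h1 h2 h3 h4
  simp only [Function.comp_apply] at h3
  rw [h1, h2, h3]
  by_cases h : z * q ∈ E'
  · by_cases h' : x⁻¹ * (z * q) ∈ E
    · have h'' : x⁻¹ * z * q ∈ E := by rwa [mul_assoc]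
      simp [Set.indicator, h, h', h'', h4]
    · have h'' : x⁻¹ * z * q ∉ E := by rwa [mul_assoc]
      simp [Set.indicator, h, h', h'']
  · simp [Set.indicator, h]

/-- The multiplier map belonging to the coefficient `x ↦ μ(E' ∩ xE)`. -/
theorem exists_translateMap [μ.IsMulLeftInvariant] {E E' : Set G}
    (hE : MeasurableSet E) (hfin : μ E ≠ ∞) (hE' : MeasurableSet E') (hfin' : μ E' ≠ ∞) :
    ∃ S : GroupVN μ →L[ℂ] GroupVN μ,
      IsNormalMultiplierMap (fun x => (μ.real (E' ∩ (fun z => x⁻¹ * z) ⁻¹' E) : ℂ)) S ∧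
      ∀ (T : GroupVN μ) (ξ η : Lp ℂ 2 μ),
        inner ℂ η ((S T : Lp ℂ 2 μ →L[ℂ] Lp ℂ 2 μ) ξ) =
          ∫ q, inner ℂ (translateField μ hE' η q)
            ((T : Lp ℂ 2 μ →L[ℂ] Lp ℂ 2 μ) (translateField μ hE ξ q)) ∂μ := by
  have : Fact ((2 : ℝ≥0∞) ≠ ∞) := ⟨by simp⟩
  obtain ⟨w, hw, ⟨b⟩⟩ := exists_countable_hilbertBasis (Lp ℂ 2 μ)
  -- Expansion along a countable basis of `L²(G)` replaces the integral over `q` by a countable sum,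
  -- so that the slice map is normal.
  let V := (expandLp (H := Lp ℂ 2 μ) b).toContinuousLinearMap ∘L translateLp μ hE hfin
  let W := (expandLp (H := Lp ℂ 2 μ) b).toContinuousLinearMap ∘L translateLp μ hE' hfin'
  have hin : ∀ (T : Lp ℂ 2 μ →L[ℂ] Lp ℂ 2 μ) (ξ η : Lp ℂ 2 μ),
      inner ℂ η (sliceOp V W T ξ) =
        ∫ q, inner ℂ (translateField μ hE' η q) (T (translateField μ hE ξ q)) ∂μ := by
    intro T ξ η
    rw [inner_sliceOp, ← inner_translateLp hE hfin hE' hfin', ← inner_expandLp_diagOp b]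
    rfl
  have hS : ∀ x, sliceOp V W (leftRegular μ x) =
      (μ.real (E' ∩ (fun z => x⁻¹ * z) ⁻¹' E) : ℂ) • leftRegular μ x := by
    intro x
    refine ContinuousLinearMap.ext fun ξ => ext_inner_left ℂ fun η => ?_
    rw [hin, integral_inner_translateField_leftRegular hE hE' hfin', smul_apply, inner_smul_right]
  exact ⟨sliceVN V W _ hS, isNormalMultiplierMap_sliceVN V W _ hS, fun T ξ η => hin _ ξ η⟩

end TranslationFields

/-! ### Matrix coefficients of indicator functions. -/

section Coefficients

variable {G : Type u} [Group G] [TopologicalSpace G] [IsTopologicalGroup G]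
  [T2Space G] [LocallyCompactSpace G] [SecondCountableTopology G]
  [MeasurableSpace G] [BorelSpace G] (μ : Measure G) [μ.IsHaarMeasure]

theorem continuous_leftRegular (f : Lp ℂ 2 μ) : Continuous fun x => leftRegular μ x f := by
  let g : C(G × G, G) := ⟨fun p => p.1⁻¹ * p.2, by fun_prop⟩
  exact Continuous.compMeasurePreservingLp (f := fun _ : G => f) (g := fun x => g.curry x)
    continuous_const g.curry.continuous (fun x => measurePreserving_mul_left μ x⁻¹) (by simp)

/-- Exhibits the lifted functions as combinations of matrix coefficients, hence as continuous
elements of `A(G)`. -/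
theorem inner_indicator_leftRegular_indicator {E E' : Set G} (hE : MeasurableSet E)
    (hfin : μ E ≠ ∞) (hE' : MeasurableSet E') (hfin' : μ E' ≠ ∞) (x : G) :
    inner ℂ (indicatorConstLp 2 hE' hfin' (1 : ℂ))
      (leftRegular μ x (indicatorConstLp 2 hE hfin (1 : ℂ))) =
      (μ.real (E' ∩ (fun z => x⁻¹ * z) ⁻¹' E) : ℂ) := by
  rw [L2.inner_indicatorConstLp_one]
  have hpre : MeasurableSet ((fun z => x⁻¹ * z) ⁻¹' E) := hE.preimage (measurable_const_mul _)
  have hq := (measurePreserving_mul_left μ x⁻¹).quasiMeasurePreserving.ae_eq_comp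
    (indicatorConstLp_coeFn (p := 2) (hs := hE) (hμs := hfin) (c := (1 : ℂ)))
  have : ∫ z in E', leftRegular μ x (indicatorConstLp 2 hE hfin (1 : ℂ)) z ∂μ =
      ∫ z in E', ((fun z => x⁻¹ * z) ⁻¹' E).indicator (fun _ => (1 : ℂ)) z ∂μ := by
    refine integral_congr_ae (ae_restrict_of_ae ?_)
    filter_upwards [leftRegular_coeFn μ x (indicatorConstLp 2 hE hfin (1 : ℂ)), hq] with z h1 h2
    rw [h1]
    exact h2
  rw [this, integral_indicator hpre, Measure.restrict_restrict hpre, Set.inter_comm]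
  simp

end Coefficients

/-! ### Schur multipliers acting on orthogonal blocks. -/

section BlockDecompositions

variable {Λ : Type*} {E : Type*} [NormedAddCommGroup E] [InnerProductSpace ℂ E]

/-- The vectors `x i` are orthogonal components of `ξ`. -/
structure IsBlockFamily (ξ : E) (x : Λ → E) : Prop where
  orthogonal : ∀ i j, i ≠ j → inner ℂ (x i) (x j) = 0
  inner_self : ∀ i, inner ℂ (x i) ξ = ((‖x i‖ ^ 2 : ℝ) : ℂ)

namespace IsBlockFamily

variable {ξ η : E} {x y : Λ → E}

theorem norm_sub_sum_sq (h : IsBlockFamily ξ x) (A : Finset Λ) :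
    ‖ξ - ∑ j ∈ A, x j‖ ^ 2 = ‖ξ‖ ^ 2 - ∑ j ∈ A, ‖x j‖ ^ 2 := by
  classical
  have hv : ∀ v : E, ((‖v‖ ^ 2 : ℝ) : ℂ) = inner ℂ v v := fun v => by
    rw [inner_self_eq_norm_sq_to_K]; simp
  have h1 : inner ℂ (∑ j ∈ A, x j) ξ = ((∑ j ∈ A, ‖x j‖ ^ 2 : ℝ) : ℂ) := by
    rw [sum_inner, Complex.ofReal_sum]
    exact Finset.sum_congr rfl fun j _ => h.inner_self j
  have h2 : inner ℂ ξ (∑ j ∈ A, x j) = ((∑ j ∈ A, ‖x j‖ ^ 2 : ℝ) : ℂ) := by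
    rw [← inner_conj_symm, h1, Complex.conj_ofReal]
  have h3 : inner ℂ (∑ j ∈ A, x j) (∑ j ∈ A, x j) = ((∑ j ∈ A, ‖x j‖ ^ 2 : ℝ) : ℂ) := by
    rw [sum_inner, Complex.ofReal_sum]
    refine Finset.sum_congr rfl fun i hi => ?_
    rw [inner_sum, Finset.sum_eq_single i]
    · exact (hv _).symm
    · exact fun j _ hji => h.orthogonal i j hji.symm
    · exact fun hn => absurd hi hn
  apply Complex.ofReal_injective
  rw [hv, inner_sub_left, inner_sub_right, inner_sub_right, h1, h2, h3, ← hv]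
  push_cast
  ring

theorem sum_sq_le (h : IsBlockFamily ξ x) (A : Finset Λ) : ∑ j ∈ A, ‖x j‖ ^ 2 ≤ ‖ξ‖ ^ 2 := by
  have := h.norm_sub_sum_sq A
  nlinarith [sq_nonneg ‖ξ - ∑ j ∈ A, x j‖]

theorem sqrt_sum_sq_le (h : IsBlockFamily ξ x) (A : Finset Λ) :
    √(∑ j ∈ A, ‖x j‖ ^ 2) ≤ ‖ξ‖ :=
  (Real.sqrt_le_sqrt (h.sum_sq_le A)).trans_eq (Real.sqrt_sq (norm_nonneg _))

theorem norm_le (h : IsBlockFamily ξ x) (i : Λ) : ‖x i‖ ≤ ‖ξ‖ := by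
  have := h.sqrt_sum_sq_le {i}
  simpa using this

theorem sqrt_sum_sq_sdiff_le [DecidableEq Λ] (h : IsBlockFamily ξ x) (A B : Finset Λ)
    (hAB : A ⊆ B) : √(∑ j ∈ B \ A, ‖x j‖ ^ 2) ≤ ‖ξ - ∑ j ∈ A, x j‖ := by
  rw [← Real.sqrt_sq (norm_nonneg (ξ - ∑ j ∈ A, x j)), h.norm_sub_sum_sq]
  apply Real.sqrt_le_sqrt
  have h1 := Finset.sum_sdiff hAB (f := fun j => ‖x j‖ ^ 2)
  linarith [h.sum_sq_le B]

end IsBlockFamily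

variable [Group Λ] {ψ : Λ → ℂ} {k : ℝ} {ξ η : E} {x y : Λ → E}

theorem HerzSchurBound.block_rect_le (h : HerzSchurBound ψ k) (T : E →L[ℂ] E)
    (hx : IsBlockFamily ξ x) (hy : IsBlockFamily η y) (A B : Finset Λ) :
    ‖∑ i ∈ B, ∑ j ∈ A, ψ (i * j⁻¹) * inner ℂ (y i) (T (x j))‖ ≤
      k * ‖T‖ * (√(∑ j ∈ A, ‖x j‖ ^ 2) * √(∑ i ∈ B, ‖y i‖ ^ 2)) := by
  classical
  have key := h.block_le T (A ∪ B) (fun j => if j ∈ A then x j else 0)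
    (fun i => if i ∈ B then y i else 0)
    (fun i _ j _ hij => by
      by_cases h1 : i ∈ A <;> by_cases h2 : j ∈ A <;> simp [h1, h2, hx.orthogonal i j hij])
    (fun i _ j _ hij => by
      by_cases h1 : i ∈ B <;> by_cases h2 : j ∈ B <;> simp [h1, h2, hy.orthogonal i j hij])
  have e1 : ∑ j ∈ A ∪ B, ‖if j ∈ A then x j else 0‖ ^ 2 = ∑ j ∈ A, ‖x j‖ ^ 2 := by
    rw [← Finset.sum_subset Finset.subset_union_left]
    · exact Finset.sum_congr rfl fun j hj => by rw [if_pos hj]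
    · intro j _ hj; simp [hj]
  have e2 : ∑ j ∈ A ∪ B, ‖if j ∈ B then y j else 0‖ ^ 2 = ∑ j ∈ B, ‖y j‖ ^ 2 := by
    rw [← Finset.sum_subset Finset.subset_union_right]
    · exact Finset.sum_congr rfl fun j hj => by rw [if_pos hj]
    · intro j _ hj; simp [hj]
  have e3 : ∑ i ∈ A ∪ B, ∑ j ∈ A ∪ B, ψ (i * j⁻¹) *
      inner ℂ (if i ∈ B then y i else 0) (T (if j ∈ A then x j else 0)) =
      ∑ i ∈ B, ∑ j ∈ A, ψ (i * j⁻¹) * inner ℂ (y i) (T (x j)) := by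
    rw [← Finset.sum_subset Finset.subset_union_right]
    · refine Finset.sum_congr rfl fun i hi => ?_
      rw [← Finset.sum_subset Finset.subset_union_left]
      · exact Finset.sum_congr rfl fun j hj => by rw [if_pos hj, if_pos hi]
      · intro j _ hj; simp [hj]
    · intro i _ hi; simp [hi]
  rwa [e1, e2, e3] at key

/-- Substituting `i = σ j` turns the finite sum over the support into Schur form; the rectangle may
be enlarged because the added entries vanish. -/
theorem sum_support_eq_sum_rect [DecidableEq Λ] {F A s : Finset Λ} (hF : ∀ i, ψ i ≠ 0 → i ∈ F)
    (hs : ∀ σ ∈ F, ∀ j ∈ A, σ * j ∈ s) (B : Λ → Λ → ℂ) :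
    ∑ j ∈ A, ∑ σ ∈ F, ψ σ * B (σ * j) j = ∑ i ∈ s, ∑ j ∈ A, ψ (i * j⁻¹) * B i j := by
  rw [Finset.sum_comm (s := s)]
  refine Finset.sum_congr rfl fun j hj => ?_
  have e : ∑ σ ∈ F, ψ σ * B (σ * j) j =
      ∑ i ∈ F.image (fun σ => σ * j), ψ (i * j⁻¹) * B i j := by
    rw [Finset.sum_image (fun a _ b _ hab => mul_right_cancel hab)]
    exact Finset.sum_congr rfl fun σ _ => by rw [mul_inv_cancel_right]
  rw [e]
  refine Finset.sum_subset (fun i hi => ?_) fun i _ hi => ?_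
  · obtain ⟨σ, hσ, rfl⟩ := Finset.mem_image.1 hi
    exact hs σ hσ j hj
  · have : ψ (i * j⁻¹) = 0 := by
      by_contra h0
      exact hi (Finset.mem_image.2 ⟨i * j⁻¹, hF _ h0, by simp⟩)
    rw [this, zero_mul]

theorem HerzSchurBound.norm_sum_support_le (h : HerzSchurBound ψ k) (hk : 0 ≤ k)
    (T : E →L[ℂ] E) (hx : IsBlockFamily ξ x) (hy : IsBlockFamily η y) {F : Finset Λ}
    (hF : ∀ i, ψ i ≠ 0 → i ∈ F) (A : Finset Λ) :
    ‖∑ j ∈ A, ∑ σ ∈ F, ψ σ * inner ℂ (y (σ * j)) (T (x j))‖ ≤ k * ‖T‖ * (‖ξ‖ * ‖η‖) := by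
  classical
  rw [sum_support_eq_sum_rect hF (s := (F ×ˢ A).image fun p => p.1 * p.2)
    (fun σ hσ j hj => Finset.mem_image.2 ⟨(σ, j), Finset.mk_mem_product hσ hj, rfl⟩)
    (fun i j => inner ℂ (y i) (T (x j)))]
  refine (h.block_rect_le T hx hy _ _).trans ?_
  gcongr
  · exact hx.sqrt_sum_sq_le _
  · exact hy.sqrt_sum_sq_le _

/-- On the core `A × A` the multiplier is within `δ` of 1, entry by entry. The rest of the rectangle
has a block index outside `A`, and there the Schur bound costs `k` times the length of the missing
part of `ξ` or `η`. Replacing `ξ` and `η` by their partial sums over `A` accounts for the extra 1 in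
`k + 1`. -/
theorem HerzSchurBound.norm_sum_support_sub_le (h : HerzSchurBound ψ k) (hk : 0 ≤ k)
    (T : E →L[ℂ] E) (hx : IsBlockFamily ξ x) (hy : IsBlockFamily η y) {F : Finset Λ}
    (hF : ∀ i, ψ i ≠ 0 → i ∈ F) {A A' : Finset Λ} (hA : A ⊆ A') {δ : ℝ}
    (hδ : ∀ i ∈ A, ∀ j ∈ A, ‖ψ (i * j⁻¹) - 1‖ ≤ δ) :
    ‖∑ j ∈ A', ∑ σ ∈ F, ψ σ * inner ℂ (y (σ * j)) (T (x j)) - inner ℂ η (T ξ)‖ ≤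
      ‖T‖ * ((k + 1) * (‖ξ - ∑ j ∈ A, x j‖ * ‖η‖ + ‖ξ‖ * ‖η - ∑ j ∈ A, y j‖) +
        (A.card : ℝ) ^ 2 * δ * (‖ξ‖ * ‖η‖)) := by
  classical
  -- The row set must contain every `σ j`, and also `A` so that the core can be split off.
  set s : Finset Λ := A ∪ (F ×ˢ A').image fun p => p.1 * p.2 with hs
  have hAs : A ⊆ s := Finset.subset_union_left
  rw [sum_support_eq_sum_rect hF (s := s)
    (fun σ hσ j hj => Finset.mem_union_right _
      (Finset.mem_image.2 ⟨(σ, j), Finset.mk_mem_product hσ hj, rfl⟩))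
    (fun i j => inner ℂ (y i) (T (x j)))]
  set B : Λ → Λ → ℂ := fun i j => ψ (i * j⁻¹) * inner ℂ (y i) (T (x j)) with hB
  have split1 : ∑ i ∈ s, ∑ j ∈ A', B i j = ∑ i ∈ s, ∑ j ∈ A' \ A, B i j +
      (∑ i ∈ s \ A, ∑ j ∈ A, B i j + ∑ i ∈ A, ∑ j ∈ A, B i j) := by
    rw [Finset.sum_sdiff hAs, ← Finset.sum_add_distrib]
    exact Finset.sum_congr rfl fun i _ => (Finset.sum_sdiff hA).symm
  have split2 : ∑ i ∈ A, ∑ j ∈ A, B i j = ∑ i ∈ A, ∑ j ∈ A,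
      (ψ (i * j⁻¹) - 1) * inner ℂ (y i) (T (x j)) +
      inner ℂ (∑ i ∈ A, y i) (T (∑ j ∈ A, x j)) := by
    rw [map_sum, sum_inner, ← Finset.sum_add_distrib]
    refine Finset.sum_congr rfl fun i _ => ?_
    rw [inner_sum, ← Finset.sum_add_distrib]
    exact Finset.sum_congr rfl fun j _ => by simp only [hB]; ring
  have split3 : inner ℂ (∑ i ∈ A, y i) (T (∑ j ∈ A, x j)) - inner ℂ η (T ξ) =
      -(inner ℂ (η - ∑ i ∈ A, y i) (T (∑ j ∈ A, x j)) + inner ℂ η (T (ξ - ∑ j ∈ A, x j))) := by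
    simp only [map_sub, inner_sub_left, inner_sub_right]; ring
  have b1 : ‖∑ i ∈ s, ∑ j ∈ A' \ A, B i j‖ ≤ k * ‖T‖ * (‖ξ - ∑ j ∈ A, x j‖ * ‖η‖) := by
    refine (h.block_rect_le T hx hy _ _).trans ?_
    gcongr
    · exact hx.sqrt_sum_sq_sdiff_le _ _ hA
    · exact hy.sqrt_sum_sq_le _
  have b2 : ‖∑ i ∈ s \ A, ∑ j ∈ A, B i j‖ ≤ k * ‖T‖ * (‖ξ‖ * ‖η - ∑ j ∈ A, y j‖) := by
    refine (h.block_rect_le T hx hy _ _).trans ?_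
    gcongr
    · exact hx.sqrt_sum_sq_le _
    · exact hy.sqrt_sum_sq_sdiff_le _ _ hAs
  have b3 : ‖∑ i ∈ A, ∑ j ∈ A, (ψ (i * j⁻¹) - 1) * inner ℂ (y i) (T (x j))‖ ≤
      (A.card : ℝ) ^ 2 * δ * (‖T‖ * (‖ξ‖ * ‖η‖)) := by
    calc _ ≤ ∑ i ∈ A, ∑ j ∈ A, δ * (‖T‖ * (‖ξ‖ * ‖η‖)) := by
          refine norm_sum_le_of_le _ fun i hi => norm_sum_le_of_le _ fun j hj => ?_
          rw [norm_mul]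
          have hin : ‖inner ℂ (y i) (T (x j))‖ ≤ ‖T‖ * (‖ξ‖ * ‖η‖) := by
            calc _ ≤ ‖y i‖ * (‖T‖ * ‖x j‖) :=
                  (norm_inner_le_norm _ _).trans (by gcongr; exact T.le_opNorm _)
              _ ≤ ‖η‖ * (‖T‖ * ‖ξ‖) := by
                  gcongr
                  · exact hy.norm_le i
                  · exact hx.norm_le j
              _ = _ := by ring
          exact mul_le_mul (hδ i hi j hj) hin (norm_nonneg _)
            ((norm_nonneg _).trans (hδ i hi j hj))
      _ = _ := by simp only [Finset.sum_const, nsmul_eq_mul]; ring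
  have hxA : ‖∑ j ∈ A, x j‖ ≤ ‖ξ‖ := by
    have h1 : ‖∑ j ∈ A, x j‖ ≤ √(∑ j ∈ A, ‖x j‖ ^ 2) := by
      apply Real.le_sqrt_of_sq_le
      have h0 : IsBlockFamily (∑ j ∈ A, x j) (fun j : A => x j) := by
        refine ⟨fun i j hij => hx.orthogonal _ _ (fun h => hij (Subtype.ext h)), fun i => ?_⟩
        rw [inner_sum, Finset.sum_eq_single (i : Λ)]
        · rw [inner_self_eq_norm_sq_to_K]; simp
        · exact fun j _ hji => hx.orthogonal _ _ hji.symm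
        · exact fun hn => absurd i.2 hn
      have := h0.norm_sub_sum_sq Finset.univ
      rw [Finset.sum_coe_sort A x, sub_self, norm_zero,
        Finset.sum_coe_sort A (fun j => ‖x j‖ ^ 2)] at this
      linarith
    exact h1.trans (hx.sqrt_sum_sq_le A)
  have b4 : ‖inner ℂ (η - ∑ i ∈ A, y i) (T (∑ j ∈ A, x j))‖ ≤
      ‖T‖ * (‖ξ‖ * ‖η - ∑ i ∈ A, y i‖) := by
    calc _ ≤ ‖η - ∑ i ∈ A, y i‖ * (‖T‖ * ‖ξ‖) :=
          (norm_inner_le_norm _ _).trans (by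
            gcongr; exact (T.le_opNorm _).trans (by gcongr))
      _ = _ := by ring
  have b5 : ‖inner ℂ η (T (ξ - ∑ j ∈ A, x j))‖ ≤ ‖T‖ * (‖ξ - ∑ j ∈ A, x j‖ * ‖η‖) := by
    calc _ ≤ ‖η‖ * (‖T‖ * ‖ξ - ∑ j ∈ A, x j‖) :=
          (norm_inner_le_norm _ _).trans (by gcongr; exact T.le_opNorm _)
      _ = _ := by ring
  have e : ∑ i ∈ s, ∑ j ∈ A', B i j - inner ℂ η (T ξ) =
      ∑ i ∈ s, ∑ j ∈ A' \ A, B i j + ∑ i ∈ s \ A, ∑ j ∈ A, B i j +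
      ∑ i ∈ A, ∑ j ∈ A, (ψ (i * j⁻¹) - 1) * inner ℂ (y i) (T (x j)) -
      (inner ℂ (η - ∑ i ∈ A, y i) (T (∑ j ∈ A, x j)) + inner ℂ η (T (ξ - ∑ j ∈ A, x j))) := by
    rw [split1, split2, sub_eq_add_neg _ (inner ℂ (η - _) _ + _), ← split3]; ring
  rw [e]
  refine (norm_sub_le _ _).trans ?_
  have t1 := norm_add₃_le (a := ∑ i ∈ s, ∑ j ∈ A' \ A, B i j) (b := ∑ i ∈ s \ A, ∑ j ∈ A, B i j)
    (c := ∑ i ∈ A, ∑ j ∈ A, (ψ (i * j⁻¹) - 1) * inner ℂ (y i) (T (x j)))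
  have t2 := norm_add_le (inner ℂ (η - ∑ i ∈ A, y i) (T (∑ j ∈ A, x j)))
    (inner ℂ η (T (ξ - ∑ j ∈ A, x j)))
  linarith

end BlockDecompositions

/-! ### Fundamental domains and lifts of multipliers. -/

section TranslationDomains

variable {G : Type u} [Group G] [TopologicalSpace G] [IsTopologicalGroup G]
  [SecondCountableTopology G] [MeasurableSpace G] [BorelSpace G]

/-- `D` is a Borel fundamental domain of finite measure for right translation by `Γ`, and `μ` is
invariant under right translation by `Γ`. -/
structure IsLatticeDomain (μ : Measure G) (Γ : Subgroup G) (D : Set G) : Prop where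
  measurableSet : MeasurableSet D
  measure_ne_zero : μ D ≠ 0
  measure_ne_top : μ D ≠ ∞
  exists_mem : ∀ z : G, ∃ γ : Γ, z * (γ : G)⁻¹ ∈ D
  eq_of_mem : ∀ (z : G) (γ γ' : Γ), z * (γ : G)⁻¹ ∈ D → z * (γ' : G)⁻¹ ∈ D → γ = γ'
  measurePreserving : ∀ γ : Γ, MeasurePreserving (fun z : G => z * (γ : G)) μ μ

/-- The translate `D γ`. -/
def tile {Γ : Subgroup G} (D : Set G) (γ : Γ) : Set G := (fun z => z * (γ : G)⁻¹) ⁻¹' D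

namespace IsLatticeDomain

variable {μ : Measure G} {Γ : Subgroup G} {D : Set G}

theorem measurableSet_tile (hD : IsLatticeDomain μ Γ D) (γ : Γ) : MeasurableSet (tile D γ) :=
  hD.measurableSet.preimage (measurable_mul_const _)

theorem measure_tile (hD : IsLatticeDomain μ Γ D) (γ : Γ) : μ (tile D γ) = μ D :=
  (hD.measurePreserving γ⁻¹).measure_preimage hD.measurableSet.nullMeasurableSet

theorem measure_tile_ne_top (hD : IsLatticeDomain μ Γ D) (γ : Γ) : μ (tile D γ) ≠ ∞ := by
  rw [hD.measure_tile]; exact hD.measure_ne_top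

theorem measureReal_pos (hD : IsLatticeDomain μ Γ D) : 0 < μ.real D :=
  ENNReal.toReal_pos hD.measure_ne_zero hD.measure_ne_top

theorem disjoint_tile {γ γ' : Γ} (hD : IsLatticeDomain μ Γ D) (h : γ ≠ γ') :
    Disjoint (tile D γ) (tile D γ') :=
  Set.disjoint_left.2 fun z hz hw => h (hD.eq_of_mem z γ γ' hz hw)

/-- The component of `ξ` supported on `D γ q⁻¹`. -/
def component (hD : IsLatticeDomain μ Γ D) (γ : Γ) (ξ : Lp ℂ 2 μ) (q : G) : Lp ℂ 2 μ :=
  translateField μ (hD.measurableSet_tile γ) ξ q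

/-- Moving `q` by the lattice permutes the blocks. This identity turns an integral over `G` into
Schur sums over `Γ` for each `p ∈ D`. -/
theorem component_mul_inv (hD : IsLatticeDomain μ Γ D) (σ γ : Γ) (ξ : Lp ℂ 2 μ) (p : G) :
    hD.component σ ξ (p * (γ : G)⁻¹) = hD.component (σ * γ) ξ p := by
  have hset : (fun z => z * (p * (γ : G)⁻¹)) ⁻¹' tile D σ =
      (fun z => z * p) ⁻¹' tile D (σ * γ) := by
    ext z
    simp [tile, mul_assoc]
  exact DFunLike.congr_fun (restrictLp_congr hset _ _) ξ

theorem isBlockFamily_component (hD : IsLatticeDomain μ Γ D) (ξ : Lp ℂ 2 μ) (q : G) :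
    IsBlockFamily ξ (fun γ => hD.component γ ξ q) where
  orthogonal _ _ hij := inner_restrictLp_of_disjoint _ _ ((hD.disjoint_tile hij).preimage _) _ _
  inner_self _ := inner_restrictLp_self _ _

theorem hasSum_setIntegral [Countable Γ] (hD : IsLatticeDomain μ Γ D) {F : G → ℂ}
    (hF : Integrable F μ) :
    HasSum (fun γ : Γ => ∫ p in D, F (p * (γ : G)⁻¹) ∂μ) (∫ q, F q ∂μ) := by
  have hU : ⋃ γ : Γ, tile D γ⁻¹ = Set.univ := by
    refine Set.eq_univ_of_forall fun z => ?_
    obtain ⟨γ, hγ⟩ := hD.exists_mem z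
    exact Set.mem_iUnion.2 ⟨γ⁻¹, by simpa [tile] using hγ⟩
  have h1 := hasSum_integral_iUnion (fun γ : Γ => hD.measurableSet_tile γ⁻¹)
    (fun γ γ' h => hD.disjoint_tile (fun h' => h (inv_injective h'))) (f := F) (μ := μ)
    (by rw [hU]; exact hF.integrableOn)
  rw [hU, setIntegral_univ] at h1
  refine h1.congr_fun fun γ => ?_
  have h2 := (hD.measurePreserving γ⁻¹).setIntegral_preimage_emb
    (MeasurableEquiv.mulRight ((γ⁻¹ : Γ) : G)).measurableEmbedding F (tile D γ⁻¹)
  rw [← h2]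
  have hset : (fun z : G => z * ((γ⁻¹ : Γ) : G)) ⁻¹' tile D γ⁻¹ = D := by
    ext z; simp [tile]
  rw [hset]
  simp

variable [SigmaFinite μ] [μ.IsMulLeftInvariant]

/-- `S` is the map on the group von Neumann algebra induced by `ψ` on `Γ`: the average over
`p ∈ D` of the Schur multipliers `ψ(γ γ'⁻¹)` on the blocks `D γ p⁻¹`. -/
def IsLift (hD : IsLatticeDomain μ Γ D) (ψ : Γ → ℂ) (F : Finset Γ)
    (S : GroupVN μ →L[ℂ] GroupVN μ) : Prop :=
  ∀ (T : GroupVN μ) (ξ η : Lp ℂ 2 μ),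
    HasSum (fun γ : Γ => ∫ p in D, ∑ σ ∈ F, ψ σ * inner ℂ (hD.component (σ * γ) η p)
        ((T : Lp ℂ 2 μ →L[ℂ] Lp ℂ 2 μ) (hD.component γ ξ p)) ∂μ)
      ((μ.real D : ℂ) * inner ℂ η ((S T : Lp ℂ 2 μ →L[ℂ] Lp ℂ 2 μ) ξ))

theorem integrable_component (hD : IsLatticeDomain μ Γ D) (T : Lp ℂ 2 μ →L[ℂ] Lp ℂ 2 μ)
    (ξ η : Lp ℂ 2 μ) (γ γ' : Γ) :
    Integrable (fun p => inner ℂ (hD.component γ' η p) (T (hD.component γ ξ p))) μ :=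
  integrable_inner_translateField _ (hD.measure_tile_ne_top γ) _ (hD.measure_tile_ne_top γ') T ξ η

/-- `S` is the combination, with weights `ψ σ / μ(D)`, of the translation maps for the pairs `(D,
Dσ)`. Unfolding its integral over `G` along `Γ` produces the block form. -/
theorem exists_isLift [Countable Γ] (hD : IsLatticeDomain μ Γ D) (ψ : Γ → ℂ) (F : Finset Γ) :
    ∃ S : GroupVN μ →L[ℂ] GroupVN μ, hD.IsLift ψ F S ∧
      IsNormalMultiplierMap (fun x => ((μ.real D)⁻¹ : ℂ) * ∑ σ ∈ F,
        ψ σ * (μ.real (tile D σ ∩ (fun z => x⁻¹ * z) ⁻¹' tile D (1 : Γ)) : ℂ)) S := by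
  choose S hS hin using fun σ : Γ => exists_translateMap (hD.measurableSet_tile 1)
    (hD.measure_tile_ne_top 1) (hD.measurableSet_tile σ) (hD.measure_tile_ne_top σ)
  refine ⟨((μ.real D)⁻¹ : ℂ) • ∑ σ ∈ F, ψ σ • S σ, fun T ξ η => ?_,
    (IsNormalMultiplierMap.sum F fun σ => (hS σ).smul (ψ σ)).smul _⟩
  have hC : (μ.real D : ℂ) ≠ 0 := by exact_mod_cast hD.measureReal_pos.ne'
  have e : (μ.real D : ℂ) * inner ℂ η
      (((((μ.real D)⁻¹ : ℂ) • ∑ σ ∈ F, ψ σ • S σ) T : Lp ℂ 2 μ →L[ℂ] Lp ℂ 2 μ) ξ) =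
      ∫ q, ∑ σ ∈ F, ψ σ * inner ℂ (hD.component σ η q)
        ((T : Lp ℂ 2 μ →L[ℂ] Lp ℂ 2 μ) (hD.component 1 ξ q)) ∂μ := by
    rw [integral_finsetSum _ fun σ _ => (hD.integrable_component T ξ η 1 σ).const_mul _]
    have e1 : ((((((μ.real D)⁻¹ : ℂ) • ∑ σ ∈ F, ψ σ • S σ) T : GroupVN μ) :
        Lp ℂ 2 μ →L[ℂ] Lp ℂ 2 μ) ξ) = ((μ.real D)⁻¹ : ℂ) • ∑ σ ∈ F,
          ψ σ • (S σ T : Lp ℂ 2 μ →L[ℂ] Lp ℂ 2 μ) ξ := by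
      simp
    rw [e1, inner_smul_right, mul_inv_cancel_left₀ hC, inner_sum]
    refine Finset.sum_congr rfl fun σ _ => ?_
    rw [inner_smul_right, hin, integral_const_mul]
    rfl
  rw [e]
  have h := hD.hasSum_setIntegral (F := fun q => ∑ σ ∈ F, ψ σ * inner ℂ (hD.component σ η q)
        ((T : Lp ℂ 2 μ →L[ℂ] Lp ℂ 2 μ) (hD.component 1 ξ q)))
    (integrable_finsetSum _ fun σ _ => (hD.integrable_component T ξ η 1 σ).const_mul _)
  simpa only [component_mul_inv, one_mul] using h

theorem IsLift.cbNorm_le {hD : IsLatticeDomain μ Γ D} {ψ : Γ → ℂ} {F : Finset Γ}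
    {S : GroupVN μ →L[ℂ] GroupVN μ} (hS : hD.IsLift ψ F S) {k : ℝ} (hk : 0 ≤ k)
    (hψ : HerzSchurBound ψ k) (hF : ∀ i, ψ i ≠ 0 → i ∈ F) :
    cbNorm (S : GroupVN μ →ₗ[ℂ] GroupVN μ) ≤ ENNReal.ofReal k := by
  refine iSup_le fun n => iSup_le fun a => iSup_le fun ha => ?_
  rw [← ofReal_norm]
  refine ENNReal.ofReal_le_ofReal ?_
  refine ContinuousLinearMap.opNorm_le_of_inner _ hk fun ξ η => ?_
  -- Cutting coordinatewise gives blocks of the `n`-fold sum with the same multiplier `ψ`, so the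
  -- Schur bound applies to the operator of the whole matrix, independently of `n`.
  let X : (PiLp 2 fun _ : Fin n => Lp ℂ 2 μ) → Γ → G → PiLp 2 (fun _ : Fin n => Lp ℂ 2 μ) :=
    fun ξ γ p => WithLp.toLp 2 fun i => hD.component γ (ξ i) p
  have hX : ∀ ξ p, IsBlockFamily ξ (fun γ => X ξ γ p) := by
    intro ξ p
    refine ⟨fun i j hij => ?_, fun i => ?_⟩
    · rw [PiLp.inner_apply]
      exact Finset.sum_eq_zero fun m _ => (hD.isBlockFamily_component (ξ m) p).orthogonal i j hij
    · rw [PiLp.inner_apply, PiLp.norm_sq_eq_of_L2, Complex.ofReal_sum]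
      exact Finset.sum_congr rfl fun m _ => (hD.isBlockFamily_component (ξ m) p).inner_self i
  have hint : ∀ (i j : Fin n) (γ : Γ), Integrable (fun p => ∑ σ ∈ F, ψ σ *
      inner ℂ (hD.component (σ * γ) (η i) p)
        ((a i j : Lp ℂ 2 μ →L[ℂ] Lp ℂ 2 μ) (hD.component γ (ξ j) p))) (μ.restrict D) :=
    fun i j γ => (integrable_finsetSum _ fun σ _ =>
      (hD.integrable_component _ _ _ _ _).const_mul _).restrict
  have hpt : ∀ (γ : Γ) (p : G), ∑ σ ∈ F, ψ σ *
      inner ℂ (X η (σ * γ) p) (matrixOperator a (X ξ γ p)) = ∑ i, ∑ j, ∑ σ ∈ F, ψ σ *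
      inner ℂ (hD.component (σ * γ) (η i) p)
        ((a i j : Lp ℂ 2 μ →L[ℂ] Lp ℂ 2 μ) (hD.component γ (ξ j) p)) := by
    intro γ p
    simp only [inner_matrixOperator, Finset.mul_sum]
    rw [Finset.sum_comm]
    refine Finset.sum_congr rfl fun i _ => ?_
    rw [Finset.sum_comm]
  have hint' : ∀ γ : Γ, Integrable (fun p => ∑ σ ∈ F, ψ σ *
      inner ℂ (X η (σ * γ) p) (matrixOperator a (X ξ γ p))) (μ.restrict D) := by
    intro γ
    simp only [hpt]
    exact integrable_finsetSum _ fun i _ => integrable_finsetSum _ fun j _ => hint i j γ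
  have hsum : HasSum (fun γ : Γ => ∫ p in D, ∑ σ ∈ F, ψ σ *
      inner ℂ (X η (σ * γ) p) (matrixOperator a (X ξ γ p)) ∂μ)
      ((μ.real D : ℂ) * inner ℂ η (matrixOperator (a.map S) ξ)) := by
    have h := hasSum_sum (s := Finset.univ) fun i _ =>
      hasSum_sum (s := Finset.univ) fun j _ => hS (a i j) (ξ j) (η i)
    rw [inner_matrixOperator, Finset.mul_sum]
    simp only [Finset.mul_sum]
    refine h.congr_fun fun γ => ?_
    simp only [hpt]
    rw [integral_finsetSum _ fun i _ => integrable_finsetSum _ fun j _ => hint i j γ]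
    exact Finset.sum_congr rfl fun i _ => integral_finsetSum _ fun j _ => hint i j γ
  have hle : ∀ A : Finset Γ, ‖∑ γ ∈ A, ∫ p in D, ∑ σ ∈ F, ψ σ *
      inner ℂ (X η (σ * γ) p) (matrixOperator a (X ξ γ p)) ∂μ‖ ≤
      μ.real D * (k * (‖ξ‖ * ‖η‖)) := by
    intro A
    rw [← integral_finsetSum _ fun γ _ => hint' γ, mul_comm]
    refine norm_setIntegral_le_of_norm_le_const hD.measure_ne_top.lt_top fun p _ => ?_
    refine (hψ.norm_sum_support_le hk (matrixOperator a) (hX ξ p) (hX η p) hF A).trans ?_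
    gcongr
    exact mul_le_of_le_one_right hk ha
  have h := le_of_tendsto hsum.norm (Eventually.of_forall hle)
  rw [norm_mul, Complex.norm_real, Real.norm_of_nonneg measureReal_nonneg] at h
  exact le_of_mul_le_mul_left h hD.measureReal_pos

end IsLatticeDomain

end TranslationDomains

/-! ### Convergence of the lifted maps. -/

section Convergence

variable {G : Type u} [Group G] [TopologicalSpace G] [IsTopologicalGroup G]
  [SecondCountableTopology G] [MeasurableSpace G] [BorelSpace G]
  {μ : Measure G} [SigmaFinite μ] [μ.IsMulLeftInvariant] {Γ : Subgroup G} {D : Set G}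

namespace IsLatticeDomain

theorem IsLift.norm_inner_le {hD : IsLatticeDomain μ Γ D} {ψ : Γ → ℂ} {F : Finset Γ}
    {S : GroupVN μ →L[ℂ] GroupVN μ} (hS : hD.IsLift ψ F S) {k : ℝ} (hk : 0 ≤ k)
    (hψ : HerzSchurBound ψ k) (hF : ∀ i, ψ i ≠ 0 → i ∈ F) (T : GroupVN μ) (ξ η : Lp ℂ 2 μ) :
    ‖inner ℂ η ((S T : Lp ℂ 2 μ →L[ℂ] Lp ℂ 2 μ) ξ)‖ ≤ k * ‖T‖ * (‖ξ‖ * ‖η‖) := by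
  have hle : ∀ A : Finset Γ, ‖∑ γ ∈ A, ∫ p in D, ∑ σ ∈ F, ψ σ *
      inner ℂ (hD.component (σ * γ) η p)
        ((T : Lp ℂ 2 μ →L[ℂ] Lp ℂ 2 μ) (hD.component γ ξ p)) ∂μ‖ ≤
      μ.real D * (k * ‖T‖ * (‖ξ‖ * ‖η‖)) := by
    intro A
    rw [← integral_finsetSum _ fun γ _ => (integrable_finsetSum _ fun σ _ =>
      (hD.integrable_component _ _ _ _ _).const_mul _).restrict, mul_comm]
    exact norm_setIntegral_le_of_norm_le_const hD.measure_ne_top.lt_top fun p _ =>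
      hψ.norm_sum_support_le hk _ (hD.isBlockFamily_component ξ p)
        (hD.isBlockFamily_component η p) hF A
  have h := le_of_tendsto (hS T ξ η).norm (Eventually.of_forall hle)
  rw [norm_mul, Complex.norm_real, Real.norm_of_nonneg measureReal_nonneg] at h
  exact le_of_mul_le_mul_left h hD.measureReal_pos

theorem integrable_norm_component_sq (hD : IsLatticeDomain μ Γ D) (ξ : Lp ℂ 2 μ) (γ : Γ) :
    Integrable (fun p => ‖hD.component γ ξ p‖ ^ 2) μ := by
  refine (hD.integrable_component 1 ξ ξ γ γ).re.congr (Eventually.of_forall fun p => ?_)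
  exact inner_self_eq_norm_sq (𝕜 := ℂ) _

/-- Completeness of the blocks is needed only on average over `D`; there it is the unfolded
coefficient identity at `x = 1` with `η = ξ`. -/
theorem hasSum_setIntegral_norm_component_sq [Countable Γ] (hD : IsLatticeDomain μ Γ D)
    (ξ : Lp ℂ 2 μ) :
    HasSum (fun γ : Γ => ∫ p in D, ‖hD.component γ ξ p‖ ^ 2 ∂μ) (μ.real D * ‖ξ‖ ^ 2) := by
  have h1 := hD.hasSum_setIntegral (hD.integrable_component 1 ξ ξ 1 1)
  have h2 : ∫ q, inner ℂ (hD.component 1 ξ q)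
      ((1 : Lp ℂ 2 μ →L[ℂ] Lp ℂ 2 μ) (hD.component 1 ξ q)) ∂μ = ((μ.real D * ‖ξ‖ ^ 2 : ℝ) : ℂ) := by
    have h3 := integral_inner_translateField_leftRegular (hD.measurableSet_tile 1)
      (hD.measurableSet_tile 1) (hD.measure_tile_ne_top 1) 1 ξ ξ
    rw [leftRegular_one] at h3
    refine h3.trans ?_
    have hset : tile D (1 : Γ) ∩ (fun z => (1 : G)⁻¹ * z) ⁻¹' tile D (1 : Γ) = tile D (1 : Γ) := by
      ext z; simp
    rw [hset, Measure.real, hD.measure_tile, one_apply_eq_self, inner_self_eq_norm_sq_to_K]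
    simp [Measure.real]
  rw [h2] at h1
  rw [← Complex.hasSum_ofReal]
  refine h1.congr_fun fun γ => ?_
  refine integral_complex_ofReal.symm.trans ?_
  refine integral_congr_ae (Eventually.of_forall fun p => ?_)
  beta_reduce
  rw [component_mul_inv, one_mul, one_apply_eq_self, inner_self_eq_norm_sq_to_K]
  simp

theorem eventually_setIntegral_norm_sub_sum_sq_le [Countable Γ] (hD : IsLatticeDomain μ Γ D)
    (ξ : Lp ℂ 2 μ) {τ : ℝ} (hτ : 0 < τ) : ∀ᶠ A : Finset Γ in atTop,
      ∫ p in D, ‖ξ - ∑ γ ∈ A, hD.component γ ξ p‖ ^ 2 ∂μ ≤ τ := by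
  have h1 : Tendsto (fun A : Finset Γ => μ.real D * ‖ξ‖ ^ 2 -
      ∑ γ ∈ A, ∫ p in D, ‖hD.component γ ξ p‖ ^ 2 ∂μ) atTop (𝓝 0) := by
    have := (hD.hasSum_setIntegral_norm_component_sq ξ).const_sub (μ.real D * ‖ξ‖ ^ 2)
    rwa [sub_self] at this
  filter_upwards [h1.eventually (gt_mem_nhds hτ)] with A hA
  refine le_of_eq_of_le ?_ hA.le
  have hfin : IsFiniteMeasure (μ.restrict D) := ⟨by
    rw [Measure.restrict_apply_univ]; exact hD.measure_ne_top.lt_top⟩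
  simp only [(hD.isBlockFamily_component ξ _).norm_sub_sum_sq]
  rw [integral_sub (integrable_const _) (integrable_finsetSum _ fun γ _ =>
    (hD.integrable_norm_component_sq ξ γ).restrict), integral_finsetSum _ fun γ _ =>
    (hD.integrable_norm_component_sq ξ γ).restrict]
  simp

theorem integrable_norm_sub_sum_sq (hD : IsLatticeDomain μ Γ D)
    (ξ : Lp ℂ 2 μ) (A : Finset Γ) :
    Integrable (fun p => ‖ξ - ∑ γ ∈ A, hD.component γ ξ p‖ ^ 2) (μ.restrict D) := by
  have hfin : IsFiniteMeasure (μ.restrict D) := ⟨by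
    rw [Measure.restrict_apply_univ]; exact hD.measure_ne_top.lt_top⟩
  simp only [(hD.isBlockFamily_component ξ _).norm_sub_sum_sq]
  exact (integrable_const _).sub (integrable_finsetSum _ fun γ _ =>
    (hD.integrable_norm_component_sq ξ γ).restrict)

/-- The core `A` is chosen from `ξ` and `η` alone, so the block estimate, integrated over `D`, is
uniform in `T` and in all `ψ` bounded by `k` and close to 1 on `A A⁻¹`. -/
theorem exists_finset_norm_inner_sub_le [Countable Γ] (hD : IsLatticeDomain μ Γ D) {k : ℝ}
    (hk : 0 ≤ k) (ξ η : Lp ℂ 2 μ) {ε : ℝ} (hε : 0 < ε) :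
    ∃ (F₀ : Finset Γ) (δ : ℝ), 0 < δ ∧ ∀ (ψ : Γ → ℂ) (F : Finset Γ)
      (S : GroupVN μ →L[ℂ] GroupVN μ), hD.IsLift ψ F S → HerzSchurBound ψ k →
      (∀ i, ψ i ≠ 0 → i ∈ F) → (∀ i ∈ F₀, ‖ψ i - 1‖ ≤ δ) → ∀ T : GroupVN μ,
      ‖inner ℂ η ((S T : Lp ℂ 2 μ →L[ℂ] Lp ℂ 2 μ) ξ) -
        inner ℂ η ((T : Lp ℂ 2 μ →L[ℂ] Lp ℂ 2 μ) ξ)‖ ≤ ε * ‖T‖ := by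
  classical
  have hfin : IsFiniteMeasure (μ.restrict D) := ⟨by
    rw [Measure.restrict_apply_univ]; exact hD.measure_ne_top.lt_top⟩
  set C := μ.real D with hC
  have hC0 : 0 < C := hD.measureReal_pos
  set M := (k + 1) * (‖ξ‖ + ‖η‖) with hM
  have hM0 : 0 ≤ M := by positivity
  -- Tails with mean square at most `θ²` contribute at most `2 M θ ≤ ε / 2`; the core contributes `N
  -- δ ≤ ε / 2`. Adding 1 avoids division by zero.
  set θ := ε / (4 * (M + 1)) with hθ
  have hθ0 : 0 < θ := by positivity
  obtain ⟨A, hAξ, hAη⟩ := ((hD.eventually_setIntegral_norm_sub_sum_sq_le ξ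
    (τ := C * θ ^ 2) (by positivity)).and (hD.eventually_setIntegral_norm_sub_sum_sq_le η
    (τ := C * θ ^ 2) (by positivity))).exists
  set N := (A.card : ℝ) ^ 2 * (‖ξ‖ * ‖η‖) with hN
  have hN0 : 0 ≤ N := by positivity
  refine ⟨(A ×ˢ A).image fun p => p.1 * p.2⁻¹, ε / (2 * (N + 1)), by positivity, ?_⟩
  intro ψ F S hS hψ hF hF₀ T
  set δ := ε / (2 * (N + 1)) with hδ
  set u : G → ℝ := fun p => ‖ξ - ∑ γ ∈ A, hD.component γ ξ p‖ with hu
  set v : G → ℝ := fun p => ‖η - ∑ γ ∈ A, hD.component γ η p‖ with hv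
  have hδ' : ∀ i ∈ A, ∀ j ∈ A, ‖ψ (i * j⁻¹) - 1‖ ≤ δ := fun i hi j hj =>
    hF₀ _ (Finset.mem_image.2 ⟨(i, j), Finset.mk_mem_product hi hj, rfl⟩)
  -- Plays the role of Cauchy-Schwarz: only the integrals of the squared tails are controlled.
  have amgm : ∀ t : ℝ, 0 ≤ t → t ≤ θ + t ^ 2 / θ := by
    intro t ht
    rw [← sub_nonneg]
    have : θ + t ^ 2 / θ - t = ((θ - t) ^ 2 + θ * t) / θ := by field_simp; ring
    rw [this]; positivity
  let b : G → ℝ := fun p => ‖T‖ * ((k + 1) * ((θ + u p ^ 2 / θ) * ‖η‖ +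
    ‖ξ‖ * (θ + v p ^ 2 / θ)) + N * δ)
  have hui : Integrable (fun p => u p ^ 2) (μ.restrict D) := hD.integrable_norm_sub_sum_sq ξ A
  have hvi : Integrable (fun p => v p ^ 2) (μ.restrict D) := hD.integrable_norm_sub_sum_sq η A
  have hui' : Integrable (fun p => (θ + u p ^ 2 / θ) * ‖η‖) (μ.restrict D) :=
    ((integrable_const _).add (hui.div_const _)).mul_const _
  have hvi' : Integrable (fun p => ‖ξ‖ * (θ + v p ^ 2 / θ)) (μ.restrict D) :=
    ((integrable_const _).add (hvi.div_const _)).const_mul _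
  have huv : Integrable (fun p => (k + 1) * ((θ + u p ^ 2 / θ) * ‖η‖ + ‖ξ‖ * (θ + v p ^ 2 / θ)))
      (μ.restrict D) := (hui'.add hvi').const_mul _
  have hb : Integrable b (μ.restrict D) :=
    (huv.add (integrable_const _)).const_mul _
  have hbint : ∫ p in D, b p ∂μ ≤ C * (ε * ‖T‖) := by
    have e : ∫ p in D, b p ∂μ = ‖T‖ * ((k + 1) * ((C * θ + (∫ p in D, u p ^ 2 ∂μ) / θ) * ‖η‖ +
        ‖ξ‖ * (C * θ + (∫ p in D, v p ^ 2 ∂μ) / θ)) + C * (N * δ)) := by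
      simp only [b]
      rw [integral_const_mul, integral_add huv (integrable_const _),
        integral_const_mul, integral_add hui' hvi', integral_mul_const, integral_const_mul,
        integral_add (integrable_const _) (hui.div_const _),
        integral_add (integrable_const _) (hvi.div_const _), integral_div θ fun p => u p ^ 2,
        integral_div θ fun p => v p ^ 2]
      simp only [integral_const, measureReal_restrict_apply_univ, smul_eq_mul, ← hC]
    rw [e]
    have h1 : (∫ p in D, u p ^ 2 ∂μ) / θ ≤ C * θ := by
      rw [div_le_iff₀ hθ0]; linarith [hAξ]
    have h2 : (∫ p in D, v p ^ 2 ∂μ) / θ ≤ C * θ := by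
      rw [div_le_iff₀ hθ0]; linarith [hAη]
    have h3 : N * δ ≤ ε / 2 := by
      calc N * δ ≤ (N + 1) * δ := by gcongr; linarith
        _ = ε / 2 := by rw [hδ]; field_simp
    have h4 : M * (2 * θ) ≤ ε / 2 := by
      calc M * (2 * θ) ≤ (M + 1) * (2 * θ) := by gcongr; linarith
        _ = ε / 2 := by rw [hθ]; field_simp; norm_num
    calc _ ≤ ‖T‖ * ((k + 1) * ((C * θ + C * θ) * ‖η‖ + ‖ξ‖ * (C * θ + C * θ)) + C * (ε / 2)) := by
          gcongr
      _ = ‖T‖ * (C * (M * (2 * θ)) + C * (ε / 2)) := by rw [hM]; ring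
      _ ≤ ‖T‖ * (C * (ε / 2) + C * (ε / 2)) := by gcongr
      _ = _ := by ring
  set X : Γ → G → ℂ := fun γ p => ∑ σ ∈ F, ψ σ * inner ℂ (hD.component (σ * γ) η p)
        ((T : Lp ℂ 2 μ →L[ℂ] Lp ℂ 2 μ) (hD.component γ ξ p)) with hX
  have hXi : ∀ γ, Integrable (X γ) (μ.restrict D) := fun γ => (integrable_finsetSum _ fun σ _ =>
      (hD.integrable_component _ _ _ _ _).const_mul _).restrict
  have hle : ∀ A' : Finset Γ, A ⊆ A' → ‖∑ γ ∈ A', ∫ p in D, X γ p ∂μ -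
      (C : ℂ) * inner ℂ η ((T : Lp ℂ 2 μ →L[ℂ] Lp ℂ 2 μ) ξ)‖ ≤ C * (ε * ‖T‖) := by
    intro A' hA'
    have e : ∑ γ ∈ A', ∫ p in D, X γ p ∂μ - (C : ℂ) * inner ℂ η
        ((T : Lp ℂ 2 μ →L[ℂ] Lp ℂ 2 μ) ξ) = ∫ p in D, (∑ γ ∈ A', X γ p -
          inner ℂ η ((T : Lp ℂ 2 μ →L[ℂ] Lp ℂ 2 μ) ξ)) ∂μ := by
      rw [integral_sub (integrable_finsetSum _ fun γ _ => hXi γ) (integrable_const _),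
        integral_finsetSum _ fun γ _ => hXi γ]
      simp [hC]
    rw [e]
    refine (norm_integral_le_of_norm_le hb (Eventually.of_forall fun p => ?_)).trans hbint
    refine (hψ.norm_sum_support_sub_le hk _ (hD.isBlockFamily_component ξ p)
        (hD.isBlockFamily_component η p) hF hA' hδ').trans ?_
    change ‖T‖ * ((k + 1) * (u p * ‖η‖ + ‖ξ‖ * v p) + (A.card : ℝ) ^ 2 * δ * (‖ξ‖ * ‖η‖)) ≤ b p
    have hNδ : (A.card : ℝ) ^ 2 * δ * (‖ξ‖ * ‖η‖) = N * δ := by rw [hN]; ring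
    rw [hNδ]
    have h1 := amgm (u p) (norm_nonneg _)
    have h2 := amgm (v p) (norm_nonneg _)
    simp only [b]
    gcongr
  have hlim := ((hS T ξ η).sub_const
    ((C : ℂ) * inner ℂ η ((T : Lp ℂ 2 μ →L[ℂ] Lp ℂ 2 μ) ξ))).norm
  have h := le_of_tendsto hlim ((eventually_ge_atTop A).mono fun A' hA' => hle A' hA')
  rw [← mul_sub, norm_mul, Complex.norm_real, Real.norm_of_nonneg hC0.le] at h
  exact le_of_mul_le_mul_left h hC0

end IsLatticeDomain

end Convergence

/-! ### The approximate unit built from lifts. -/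

section Sufficiency

variable {G : Type u} [Group G] [TopologicalSpace G] [IsTopologicalGroup G]
  [T2Space G] [LocallyCompactSpace G] [SecondCountableTopology G]
  [MeasurableSpace G] [BorelSpace G] {μ : Measure G} [μ.IsHaarMeasure]

theorem sum_coefficient_mem_fourierAlgebra {ι : Type*} (s : Finset ι) (c : ι → ℂ)
    (f g : ι → Lp ℂ 2 μ) :
    (fun x => ∑ i ∈ s, c i * inner ℂ (g i) (leftRegular μ x (f i))) ∈ fourierAlgebra μ := by
  classical
  refine ⟨∑ i ∈ s, c i • vectorFunctional (f i) (g i), ?_, fun x => ?_⟩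
  · induction s using Finset.induction_on with
    | empty => simpa using IsNormalFunctional.zero
    | insert a s ha ih =>
      rw [Finset.sum_insert ha]
      exact ((isNormalFunctional_vectorFunctional _ _).smul _).add ih
  · simp only [sum_apply, smul_apply, vectorFunctional_apply, smul_eq_mul]
    rfl

/-- Finitely supported Herz-Schur approximations on a lattice induce an approximate unit. -/
theorem IsLatticeDomain.hasCBApproximateUnit {Γ : Subgroup G} [Countable Γ] {D : Set G}
    (hD : IsLatticeDomain μ Γ D) {k : ℝ} (hk : 0 ≤ k)
    (h : HasFiniteHerzSchurApproximation Γ k) : HasCBApproximateUnit μ k := by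
  classical
  have hpos : ∀ n : ℕ, (0 : ℝ) < 1 / ((n : ℝ) + 1) := fun n => by positivity
  -- The net is indexed by a finite set to control together with a tolerance `1 / (n + 1)`.
  choose ψ hfin hψ hψ1 using fun α : Finset Γ × ℕ => h α.1 (1 / ((α.2 : ℝ) + 1)) (hpos _)
  let F : Finset Γ × ℕ → Finset Γ := fun α => (hfin α).toFinset
  have hF : ∀ α i, ψ α i ≠ 0 → i ∈ F α := fun α i hi => (hfin α).mem_toFinset.2 hi
  choose S hlift hS using fun α => hD.exists_isLift (ψ α) (F α)
  let φ : Finset Γ × ℕ → G → ℂ := fun α x => ((μ.real D)⁻¹ : ℂ) * ∑ σ ∈ F α,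
        ψ α σ * (μ.real (tile D σ ∩ (fun z => x⁻¹ * z) ⁻¹' tile D (1 : Γ)) : ℂ)
  have hφeq : ∀ α, φ α = fun x => ∑ σ ∈ F α, (((μ.real D)⁻¹ : ℂ) * ψ α σ) *
      inner ℂ (indicatorConstLp 2 (hD.measurableSet_tile σ) (hD.measure_tile_ne_top σ) (1 : ℂ))
        (leftRegular μ x (indicatorConstLp 2 (hD.measurableSet_tile 1)
          (hD.measure_tile_ne_top 1) (1 : ℂ))) := by
    intro α
    funext x
    simp only [φ, inner_indicator_leftRegular_indicator, Finset.mul_sum, mul_assoc]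
  have hcont : ∀ α, Continuous (φ α) := by
    intro α
    rw [hφeq]
    exact continuous_finsetSum _ fun σ _ => continuous_const.mul
      (continuous_const.inner (continuous_leftRegular μ _))
  refine ⟨Finset Γ × ℕ, inferInstance, inferInstance, inferInstance, φ, fun α => ?_,
    fun u hu => ?_, fun α => ?_⟩
  · rw [hφeq]
    exact sum_coefficient_mem_fourierAlgebra _ _ _ _
  · obtain ⟨ω, hω⟩ := hu
    have hrep : ∀ α, Represents (ω ∘L S α - ω) (φ α * u - u) := fun α =>
      have h1 := (hS α).represents hω
      ⟨h1.1.sub hω.1, fun x => by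
        rw [Pi.sub_apply, h1.2 x, hω.2 x]; rfl⟩
    obtain ⟨f, g, hf, hg, hsum⟩ := hω.1
    have hs := summable_norm_mul_norm hf hg
    have key : ∀ ε : ℝ, 0 < ε → ∀ᶠ α in atTop, ‖ω ∘L S α - ω‖ ≤ ε := by
      intro ε hε
      -- A tail term of `ω ∘ S α - ω` costs `k` from `S α` and 1 from the identity, uniformly in
      -- `α`; only finitely many terms need convergence.
      have htail := (tendsto_sum_nat_add (fun n => ‖f n‖ * ‖g n‖)).const_mul (k + 1)
      rw [mul_zero] at htail
      obtain ⟨N, hN⟩ := (htail.eventually (gt_mem_nhds (half_pos hε))).exists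
      have hev : ∀ᶠ α in atTop, ∀ n ∈ Finset.range N, ∀ T : GroupVN μ,
          ‖inner ℂ (g n) ((S α T : Lp ℂ 2 μ →L[ℂ] Lp ℂ 2 μ) (f n)) -
            inner ℂ (g n) ((T : Lp ℂ 2 μ →L[ℂ] Lp ℂ 2 μ) (f n))‖ ≤
            (ε / 2 / (N + 1)) * ‖T‖ := by
        rw [Filter.eventually_all_finset]
        intro n _
        obtain ⟨F₀, δ, hδ, hF₀⟩ := hD.exists_finset_norm_inner_sub_le hk (f n) (g n)
          (show 0 < ε / 2 / ((N : ℝ) + 1) by positivity)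
        obtain ⟨m, hm⟩ := exists_nat_one_div_lt hδ
        filter_upwards [eventually_ge_atTop (F₀, m)] with α hα
        refine hF₀ (ψ α) (F α) (S α) (hlift α) (hψ α) (hF α) fun i hi => ?_
        refine (hψ1 α i (hα.1 hi)).le.trans (le_trans ?_ hm.le)
        have : (m : ℝ) ≤ α.2 := by exact_mod_cast hα.2
        gcongr
      filter_upwards [hev] with α hα
      refine ContinuousLinearMap.opNorm_le_bound _ hε.le fun T => ?_
      have hT : HasSum (fun n => inner ℂ (g n) ((S α T : Lp ℂ 2 μ →L[ℂ] Lp ℂ 2 μ) (f n)) -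
            inner ℂ (g n) ((T : Lp ℂ 2 μ →L[ℂ] Lp ℂ 2 μ) (f n))) ((ω ∘L S α - ω) T) :=
        (hsum (S α T)).sub (hsum T)
      have hT2 := (hasSum_nat_add_iff' N).2 hT
      have htl := hT2.norm_le_of_bounded
        ((((summable_nat_add_iff N).2 hs).hasSum.mul_left ((k + 1) * ‖T‖))) fun n => by
          refine (norm_sub_le _ _).trans ?_
          have h1 := (hlift α).norm_inner_le hk (hψ α) (hF α) T (f (n + N)) (g (n + N))
          have h2 : ‖inner ℂ (g (n + N)) ((T : Lp ℂ 2 μ →L[ℂ] Lp ℂ 2 μ) (f (n + N)))‖ ≤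
              ‖T‖ * (‖f (n + N)‖ * ‖g (n + N)‖) := by
            have h3 : ‖(T : Lp ℂ 2 μ →L[ℂ] Lp ℂ 2 μ) (f (n + N))‖ ≤ ‖T‖ * ‖f (n + N)‖ :=
              (T : Lp ℂ 2 μ →L[ℂ] Lp ℂ 2 μ).le_opNorm _
            calc _ ≤ ‖g (n + N)‖ * (‖T‖ * ‖f (n + N)‖) :=
                  (norm_inner_le_norm _ _).trans (by gcongr)
              _ = _ := by ring
          linarith
      have hhead : ‖∑ n ∈ Finset.range N,
          (inner ℂ (g n) ((S α T : Lp ℂ 2 μ →L[ℂ] Lp ℂ 2 μ) (f n)) -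
            inner ℂ (g n) ((T : Lp ℂ 2 μ →L[ℂ] Lp ℂ 2 μ) (f n)))‖ ≤ ε / 2 * ‖T‖ := by
        calc _ ≤ ∑ n ∈ Finset.range N, (ε / 2 / (N + 1)) * ‖T‖ :=
              norm_sum_le_of_le _ fun n hn => hα n hn T
          _ = (N / (N + 1)) * (ε / 2 * ‖T‖) := by
              simp only [Finset.sum_const, Finset.card_range, nsmul_eq_mul]; ring
          _ ≤ 1 * (ε / 2 * ‖T‖) := by
              gcongr
              exact (div_le_one (by positivity)).2 (by linarith)
          _ = _ := one_mul _
      have htl' : (k + 1) * ‖T‖ * ∑' n, ‖f (n + N)‖ * ‖g (n + N)‖ ≤ ε / 2 * ‖T‖ := by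
        have := mul_le_mul_of_nonneg_right hN.le (norm_nonneg T)
        linarith
      have hfinal := norm_le_norm_sub_add ((ω ∘L S α - ω) T) (∑ n ∈ Finset.range N,
          (inner ℂ (g n) ((S α T : Lp ℂ 2 μ →L[ℂ] Lp ℂ 2 μ) (f n)) -
            inner ℂ (g n) ((T : Lp ℂ 2 μ →L[ℂ] Lp ℂ 2 μ) (f n))))
      linarith
    rw [ENNReal.tendsto_nhds_zero]
    intro ε hε
    rcases eq_or_ne ε ∞ with rfl | htop
    · exact Eventually.of_forall fun _ => le_top
    · filter_upwards [key ε.toReal (ENNReal.toReal_pos hε.ne' htop)] with α hα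
      refine (iInf₂_le (ω ∘L S α - ω) (hrep α)).trans ?_
      rw [← ofReal_norm]
      exact ENNReal.ofReal_le_of_le_toReal hα
  · refine iInf_le_of_le ⟨hcont α, fun u hu => (hS α).mul_mem hu⟩ ?_
    exact iInf_le_of_le _ (iInf_le_of_le (hS α).isTransposeMultiplier
      ((hlift α).cbNorm_le hk (hψ α) (hF α)))

end Sufficiency

/-! ### Unfolding a measure from `G ⧸ Γ` to `G`. -/

section UnfoldedMeasure

variable {G : Type u} [Group G] [MeasurableSpace G] {Γ : Subgroup G}

/-- The counting measure of the coset `q`, as a measure on `G`. -/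
def cosetMeasure (q : G ⧸ Γ) : Measure G :=
  Measure.sum fun γ : Γ => Measure.dirac (q.out * (γ : G))

/-- Reindexing by a lattice element makes the sum independent of the representative chosen by
`Quotient.out`. -/
theorem cosetMeasure_mk_apply (g : G) {s : Set G} (hs : MeasurableSet s) :
    cosetMeasure (g : G ⧸ Γ) s = ∑' γ : Γ, s.indicator 1 (g * (γ : G)) := by
  obtain ⟨h, hh⟩ := QuotientGroup.mk_out_eq_mul Γ g
  rw [cosetMeasure, Measure.sum_apply _ hs]
  simp_rw [Measure.dirac_apply' _ hs, hh]
  rw [← (Equiv.mulLeft h).tsum_eq fun γ : Γ => s.indicator 1 (g * (γ : G))]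
  simp [mul_assoc]

theorem cosetMeasure_smul_apply [MeasurableMul G] (g : G) (q : G ⧸ Γ) {s : Set G}
    (hs : MeasurableSet s) :
    cosetMeasure (g • q) s = cosetMeasure q ((fun x => g * x) ⁻¹' s) := by
  induction q using QuotientGroup.induction_on with | H x => ?_
  rw [MulAction.Quotient.smul_coe, smul_eq_mul, cosetMeasure_mk_apply _ hs,
    cosetMeasure_mk_apply _ (measurable_const_mul g hs)]
  refine tsum_congr fun γ => ?_
  rw [mul_assoc]
  rfl

theorem cosetMeasure_preimage_mul_right [MeasurableMul G] (γ : Γ) (q : G ⧸ Γ) {s : Set G}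
    (hs : MeasurableSet s) :
    cosetMeasure q ((fun x => x * (γ : G)) ⁻¹' s) = cosetMeasure q s := by
  induction q using QuotientGroup.induction_on with | H x => ?_
  rw [cosetMeasure_mk_apply _ hs, cosetMeasure_mk_apply _ (measurable_mul_const (γ : G) hs),
    ← (Equiv.mulRight γ).tsum_eq fun γ : Γ => s.indicator 1 (x * (γ : G))]
  refine tsum_congr fun σ => ?_
  simp only [Equiv.coe_mulRight, Subgroup.coe_mul, ← mul_assoc]
  rfl

theorem cosetMeasure_le_one {s : Set G} (hs : MeasurableSet s)
    (h : ∀ x ∈ s, ∀ γ : Γ, x * (γ : G) ∈ s → γ = 1) (q : G ⧸ Γ) : cosetMeasure q s ≤ 1 := by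
  induction q using QuotientGroup.induction_on with | H x => ?_
  rw [cosetMeasure_mk_apply _ hs]
  by_cases hx : ∃ σ : Γ, x * (σ : G) ∈ s
  · obtain ⟨σ, hσ⟩ := hx
    rw [tsum_eq_single σ]
    · exact Set.indicator_le_self' (fun _ _ => zero_le) _
    · intro γ hγ
      refine Set.indicator_of_notMem (fun hmem => hγ ?_) _
      have := h _ hσ (σ⁻¹ * γ) (by simpa [mul_assoc] using hmem)
      exact (inv_mul_eq_one.1 this).symm
  · push Not at hx
    simp [hx]

theorem one_le_cosetMeasure {s : Set G} (hs : MeasurableSet s)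
    (h : ∀ x : G, ∃ γ : Γ, x * (γ : G) ∈ s) (q : G ⧸ Γ) : 1 ≤ cosetMeasure q s := by
  induction q using QuotientGroup.induction_on with | H x => ?_
  rw [cosetMeasure_mk_apply _ hs]
  obtain ⟨γ, hγ⟩ := h x
  refine le_trans ?_ (ENNReal.le_tsum γ)
  rw [Set.indicator_of_mem hγ]
  rfl

theorem measurable_cosetMeasure [MeasurableMul G] [Countable Γ] :
    Measurable (cosetMeasure : G ⧸ Γ → Measure G) := by
  refine Measure.measurable_of_measurable_coe _ fun s hs => measurable_from_quotient.2 ?_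
  have : ((fun q : G ⧸ Γ => cosetMeasure q s) ∘ Quotient.mk'') =
      fun g : G => ∑' γ : Γ, s.indicator 1 (g * (γ : G)) :=
    funext fun g => cosetMeasure_mk_apply g hs
  rw [this]
  exact Measurable.tsum fun γ =>
    (measurable_one.indicator hs).comp (measurable_mul_const _)

/-- The measure on `G` obtained by integrating the counting measures of the cosets. -/
def unfoldedMeasure (ν : Measure (G ⧸ Γ)) : Measure G := ν.bind cosetMeasure

variable [MeasurableMul G] [Countable Γ] (ν : Measure (G ⧸ Γ))

theorem unfoldedMeasure_apply {s : Set G} (hs : MeasurableSet s) :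
    unfoldedMeasure ν s = ∫⁻ q, cosetMeasure q s ∂ν :=
  Measure.bind_apply hs measurable_cosetMeasure.aemeasurable

theorem isMulLeftInvariant_unfoldedMeasure [SMulInvariantMeasure G (G ⧸ Γ) ν] :
    (unfoldedMeasure ν).IsMulLeftInvariant := by
  refine ⟨fun g => Measure.ext fun s hs => ?_⟩
  have hg : MeasurePreserving (fun q : G ⧸ Γ => g • q) ν ν := by
    have hm : Measurable fun q : G ⧸ Γ => g • q :=
      measurable_from_quotient.2 (measurable_quotient_mk''.comp (measurable_const_mul g))
    exact ⟨hm, Measure.ext fun t ht =>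
      (Measure.map_apply hm ht).trans (SMulInvariantMeasure.measure_preimage_smul g ht)⟩
  rw [Measure.map_apply (measurable_const_mul g) hs, unfoldedMeasure_apply _ hs,
    unfoldedMeasure_apply _ (measurable_const_mul g hs)]
  refine (lintegral_congr fun q => (cosetMeasure_smul_apply g q hs).symm).trans ?_
  exact hg.lintegral_comp ((Measure.measurable_coe hs).comp measurable_cosetMeasure)

theorem measurePreserving_mul_right_unfoldedMeasure (γ : Γ) :
    MeasurePreserving (fun x => x * (γ : G)) (unfoldedMeasure ν) (unfoldedMeasure ν) := by
  refine ⟨measurable_mul_const _, Measure.ext fun s hs => ?_⟩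
  rw [Measure.map_apply (measurable_mul_const _) hs, unfoldedMeasure_apply _ hs,
    unfoldedMeasure_apply _ (measurable_mul_const (γ : G) hs)]
  exact lintegral_congr fun q => cosetMeasure_preimage_mul_right γ q hs

theorem unfoldedMeasure_le {s : Set G} (hs : MeasurableSet s)
    (h : ∀ x ∈ s, ∀ γ : Γ, x * (γ : G) ∈ s → γ = 1) : unfoldedMeasure ν s ≤ ν Set.univ := by
  rw [unfoldedMeasure_apply _ hs, ← lintegral_one]
  exact lintegral_mono (cosetMeasure_le_one hs h)

theorem le_unfoldedMeasure {s : Set G} (hs : MeasurableSet s)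
    (h : ∀ x : G, ∃ γ : Γ, x * (γ : G) ∈ s) : ν Set.univ ≤ unfoldedMeasure ν s := by
  rw [unfoldedMeasure_apply _ hs, ← lintegral_one]
  exact lintegral_mono (one_le_cosetMeasure hs h)

end UnfoldedMeasure

/-! ### Existence of fundamental domains. -/

section LatticeDomains

variable {G : Type u} [Group G] [TopologicalSpace G] [IsTopologicalGroup G]

theorem exists_isOpen_translates_disjoint (Γ : Subgroup G) [DiscreteTopology Γ] :
    ∃ U : Set G, IsOpen U ∧ (1 : G) ∈ U ∧
      ∀ x ∈ U, ∀ γ : Γ, x * (γ : G) ∈ U → γ = 1 := by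
  obtain ⟨V, hV, hV1⟩ := isOpen_induced_iff.1 (isOpen_discrete ({1} : Set Γ))
  have h1 : (1 : G) ∈ V := by
    have : (1 : Γ) ∈ (Subtype.val ⁻¹' V : Set Γ) := by rw [hV1]; rfl
    exact this
  have hcont : ContinuousAt (fun p : G × G => p.1⁻¹ * p.2) (1, 1) := by fun_prop
  have hmem : (fun p : G × G => p.1⁻¹ * p.2) ⁻¹' V ∈ 𝓝 ((1, 1) : G × G) :=
    hcont (by simpa using hV.mem_nhds h1)
  obtain ⟨U, hU, hU1, hsub⟩ := exists_nhds_square hmem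
  refine ⟨U, hU, hU1, fun x hx γ hγ => ?_⟩
  have : (γ : G) ∈ V := by simpa using hsub (Set.mk_mem_prod hx hγ)
  have : γ ∈ (Subtype.val ⁻¹' V : Set Γ) := this
  rwa [hV1] at this

variable [SecondCountableTopology G] [MeasurableSpace G] [BorelSpace G]

/-- Countably many translates `V n` of a small open set cover `G`, each meeting a coset at most
once. Removing from `V n` the `Γ`-saturations of its predecessors leaves exactly one point of each
coset. -/
theorem exists_measurableSet_transversal (Γ : Subgroup G) [DiscreteTopology Γ] :
    ∃ D : Set G, MeasurableSet D ∧ (∀ z : G, ∃ γ : Γ, z * (γ : G) ∈ D) ∧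
      ∀ x ∈ D, ∀ γ : Γ, x * (γ : G) ∈ D → γ = 1 := by
  obtain ⟨U, hU, hU1, hUΓ⟩ := exists_isOpen_translates_disjoint Γ
  obtain ⟨s, hs, hcov⟩ := TopologicalSpace.countable_cover_nhds
    (f := fun x : G => (fun z => x⁻¹ * z) ⁻¹' U)
    fun x => (hU.preimage (continuous_const_mul _)).mem_nhds (by simpa using hU1)
  have hne : s.Nonempty := by
    have : (1 : G) ∈ ⋃ x ∈ s, (fun z => x⁻¹ * z) ⁻¹' U := hcov ▸ Set.mem_univ _
    obtain ⟨x, hx, -⟩ := Set.mem_iUnion₂.1 this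
    exact ⟨x, hx⟩
  obtain ⟨g, rfl⟩ := hs.exists_eq_range hne
  let V : ℕ → Set G := fun n => (fun z => (g n)⁻¹ * z) ⁻¹' U
  have hVo : ∀ n, IsOpen (V n) := fun n => hU.preimage (continuous_const_mul _)
  have hVcov : ∀ z, ∃ n, z ∈ V n := by
    intro z
    have : z ∈ ⋃ x ∈ Set.range g, (fun z => x⁻¹ * z) ⁻¹' U := hcov ▸ Set.mem_univ _
    obtain ⟨_, ⟨n, rfl⟩, hx⟩ := Set.mem_iUnion₂.1 this
    exact ⟨n, hx⟩
  have hVΓ : ∀ n, ∀ x ∈ V n, ∀ γ : Γ, x * (γ : G) ∈ V n → γ = 1 := fun n x hx γ hγ =>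
    hUΓ _ hx γ (by simpa [V, mul_assoc] using hγ)
  let W : ℕ → Set G := fun n => ⋃ γ : Γ, (fun z => z * (γ : G)) ⁻¹' V n
  have hWo : ∀ n, IsOpen (W n) := fun n =>
    isOpen_iUnion fun γ => (hVo n).preimage (continuous_mul_const _)
  have hW : ∀ n z, z ∈ W n ↔ ∃ γ : Γ, z * (γ : G) ∈ V n := fun n z => Set.mem_iUnion
  have hWmul : ∀ n z (γ : Γ), z * (γ : G) ∈ W n → z ∈ W n := by
    intro n z γ h
    obtain ⟨σ, hσ⟩ := (hW _ _).1 h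
    exact (hW _ _).2 ⟨γ * σ, by simpa [mul_assoc] using hσ⟩
  have hVW : ∀ n, V n ⊆ W n := fun n z hz => (hW _ _).2 ⟨1, by simpa using hz⟩
  refine ⟨⋃ n, V n \ ⋃ m, ⋃ (_ : m < n), W m, ?_, ?_, ?_⟩
  · exact MeasurableSet.iUnion fun n => (hVo n).measurableSet.diff
      (MeasurableSet.iUnion fun m => MeasurableSet.iUnion fun _ => (hWo m).measurableSet)
  · intro z
    classical
    have hex : ∃ n, z ∈ W n := (hVcov z).imp fun n hn => hVW n hn
    obtain ⟨γ, hγ⟩ := (hW _ _).1 (Nat.find_spec hex)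
    refine ⟨γ, Set.mem_iUnion.2 ⟨Nat.find hex, hγ, fun hmem => ?_⟩⟩
    obtain ⟨m, hm, hz⟩ := Set.mem_iUnion₂.1 hmem
    exact Nat.find_min hex hm (hWmul _ _ _ hz)
  · intro x hx γ hγ
    obtain ⟨n, hn, hn'⟩ := Set.mem_iUnion.1 hx
    obtain ⟨m, hm, hm'⟩ := Set.mem_iUnion.1 hγ
    have hxm : x ∈ W m := (hW _ _).2 ⟨γ, hm⟩
    have hxn : x * (γ : G) ∈ W n :=
      (hW _ _).2 ⟨γ⁻¹, by simpa using hn⟩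
    have hmn : ¬ m < n := fun h => hn' (Set.mem_iUnion₂.2 ⟨m, h, hxm⟩)
    have hnm : ¬ n < m := fun h => hm' (Set.mem_iUnion₂.2 ⟨n, h, hxn⟩)
    obtain rfl : n = m := by omega
    exact hVΓ n x hn γ hm

/-- The unfolded measure is left invariant and locally finite, hence a multiple `c` of `μ`. It is
right `Γ`-invariant by construction and gives a transversal the total mass of `ν`; both facts pass
to `μ` because `ν ≠ 0` forces `c ≠ 0`. -/
theorem IsGroupLattice.exists_isLatticeDomain [T2Space G] [LocallyCompactSpace G] (μ : Measure G)
    [μ.IsHaarMeasure] {Γ : Subgroup G} (hΓ : IsGroupLattice Γ) :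
    ∃ D, IsLatticeDomain μ Γ D := by
  have := hΓ.discrete
  have : Countable Γ := TopologicalSpace.separableSpace_iff_countable.1 inferInstance
  obtain ⟨ν, hν0, _, _⟩ := hΓ.exists_measure
  have hinv := isMulLeftInvariant_unfoldedMeasure ν
  obtain ⟨U, hU, hU1, hUΓ⟩ := exists_isOpen_translates_disjoint Γ
  have hfin : IsLocallyFiniteMeasure (unfoldedMeasure ν) := by
    refine ⟨fun x => ⟨(fun z => x⁻¹ * z) ⁻¹' U, (hU.preimage (continuous_const_mul _)).mem_nhds
      (by simpa using hU1), ?_⟩⟩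
    rw [measure_preimage_mul]
    exact (unfoldedMeasure_le ν hU.measurableSet hUΓ).trans_lt (measure_lt_top _ _)
  have heq := Measure.isMulLeftInvariant_eq_smul (unfoldedMeasure ν) μ
  set c := Measure.haarScalarFactor (unfoldedMeasure ν) μ
  obtain ⟨D, hDm, hDex, hDuniq⟩ := exists_measurableSet_transversal Γ
  have hD : c * μ D = ν Set.univ := by
    have h := le_antisymm (unfoldedMeasure_le ν hDm hDuniq) (le_unfoldedMeasure ν hDm hDex)
    rw [heq] at h
    exact h
  have hν : ν Set.univ ≠ 0 := by simpa using hν0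
  have hc : (c : ℝ≥0∞) ≠ 0 := fun h => hν (by rw [← hD, h, zero_mul])
  refine ⟨D, hDm, fun h => hν (by rw [← hD, h, mul_zero]), fun h => ?_, ?_, ?_, ?_⟩
  · rw [h, ENNReal.mul_top hc] at hD
    exact measure_ne_top ν _ hD.symm
  · intro z
    obtain ⟨γ, hγ⟩ := hDex z
    exact ⟨γ⁻¹, by simpa using hγ⟩
  · intro z γ γ' h h'
    have := hDuniq _ h (γ * γ'⁻¹) (by simpa [mul_assoc] using h')
    exact mul_inv_eq_one.1 this
  · intro γ
    refine ⟨measurable_mul_const _, Measure.ext fun s hs => ?_⟩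
    have h := (measurePreserving_mul_right_unfoldedMeasure ν γ).measure_preimage
      hs.nullMeasurableSet
    rw [heq] at h
    rw [Measure.map_apply (measurable_mul_const _) hs]
    exact (ENNReal.mul_right_inj hc ENNReal.coe_ne_top).1 h

end LatticeDomains

/-! ### A discrete group as a lattice in itself. -/

section DiscreteGroups

theorem HasFiniteHerzSchurApproximation.congr {Λ Λ' : Type*} [Group Λ] [Group Λ'] {k : ℝ}
    (h : HasFiniteHerzSchurApproximation Λ k) (e : Λ' ≃* Λ) :
    HasFiniteHerzSchurApproximation Λ' k := by
  classical
  intro F ε hε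
  obtain ⟨ψ, hfin, hψ, hF⟩ := h (F.image e) ε hε
  refine ⟨ψ ∘ e, hfin.preimage e.injective.injOn, hψ.comp e.toMonoidHom e.injective, ?_⟩
  exact fun x hx => hF _ (Finset.mem_image_of_mem _ hx)

variable {Λ : Type u} [Group Λ] [MeasurableSpace Λ]

theorem isLatticeDomain_count [MeasurableMul Λ] [MeasurableSingletonClass Λ] :
    IsLatticeDomain (Measure.count : Measure Λ) ⊤ {1} where
  measurableSet := measurableSet_singleton _
  measure_ne_zero := by simp
  measure_ne_top := by simp
  exists_mem z := ⟨⟨z, trivial⟩, by simp⟩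
  eq_of_mem z γ γ' h h' := by
    rw [Set.mem_singleton_iff, mul_inv_eq_one] at h h'
    exact Subtype.ext (h.symm.trans h')
  measurePreserving γ := measurePreserving_mul_right _ _

theorem isHaarMeasure_count [TopologicalSpace Λ] [DiscreteTopology Λ] [BorelSpace Λ] :
    (Measure.count : Measure Λ).IsHaarMeasure where
  lt_top_of_isCompact K hK := by
    have := hK.finite_of_discrete
    exact Measure.count_apply_lt_top.2 this
  open_pos U hU hne h := hne.ne_empty (Measure.count_eq_zero_iff.1 h)

end DiscreteGroups

end

theorem theorem2p3 {G : Type u} [Group G] [TopologicalSpace G] [IsTopologicalGroup G]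
    [T2Space G] [LocallyCompactSpace G] [SecondCountableTopology G]
    [MeasurableSpace G] [BorelSpace G]
    (μ : Measure G) [μ.IsHaarMeasure]
    (Γ : Subgroup G) (hΓ : IsGroupLattice Γ) (k : ℝ) (hk : 1 ≤ k) :
    HasCBApproximateUnit μ k ↔ HasCBApproximateUnit (Measure.count : Measure Γ) k := by
  have := hΓ.discrete
  have : Countable Γ := TopologicalSpace.separableSpace_iff_countable.1 inferInstance
  have := isHaarMeasure_count (Λ := Γ)
  have hk0 : 0 ≤ k := zero_le_one.trans hk
  constructor
  · intro h
    -- Restriction from `G` to `Γ`, then lifting from `⊤` to `Γ` with the one-point domain.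
    exact isLatticeDomain_count.hasCBApproximateUnit hk0
      ((h.hasFiniteHerzSchurApproximation hk Γ hΓ.isClosed).congr Subgroup.topEquiv)
  · intro h
    obtain ⟨D, hD⟩ := hΓ.exists_isLatticeDomain μ
    -- Restriction from `Γ` to its subgroup `⊤`, then lifting from `Γ` to `G`.
    exact hD.hasCBApproximateUnit hk0
      ((h.hasFiniteHerzSchurApproximation hk ⊤ isClosed_univ).congr Subgroup.topEquiv.symm)
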